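/- Let $\omega\subset\mathbb R^2$ be an open set (for instance a bounded domain with Lipschitz boundary) and let $L>0$. Put $\Omega=\omega\times(-L,L)$, $\Omega^b=\omega\times(-L,0)$, $\Omega^a=\omega\times(0,L)$ and, for $0<\varepsilon<L$, $\Omega^a_\varepsilon=\omega\times(\varepsilon,L)$ and $\Omega^M_\varepsilon=\omega\times(0,\varepsilon)$. Let $Y'=(0,1)^2$ and $Y=(0,1)^3$, and let $H^1_{per}(Y)$ be the space of all $v\in H^1(Y)$ whose traces on the faces $y_1=0$ and $y_1=1$ coincide and whose traces on the faces $y_2=0$ and $y_2=1$ coincide. For a function $f$ on $\Omega$, the unfolded function $\mathcal T_\varepsilon(f)$ on $\omega\times Y$ is given, for a.e. $(x',y)\in\omega\times Y$, by $\mathcal T_\varepsilon(f)(x',y)=f\big(\varepsilon(\xi_1+y_1),\varepsilon(\xi_2+y_2),\varepsilon y_3\big)$ if $x'\in\varepsilon(\xi+Y')$ for some $\xi=(\xi_1,\xi_2)\in\mathbb Z^2$ with $\varepsilon(\xi+Y')\subset\omega$, and $\mathcal T_\varepsilon(f)(x',y)=0$ otherwise. The function $f(\cdot+\varepsilon\mathbf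 e_3)$ on $\Omega^a$ is formed after extending $f$ by reflection in the plane $x_3=L$, i.e. by $f(x',x_3)=f(x',2L-x_3)$ for $x_3>L$. Let $(\varepsilon_n)$ be a sequence in $(0,L)$ with $\varepsilon_n\to0$, and let $\phi_n\in H^1(\Omega)$ satisfy, with a constant $C$ independent of $n$, $$\|\phi_n\|^2_{H^1(\Omega^a_{\varepsilon_n})}+\|\phi_n\|^2_{H^1(\Omega^b)}+\varepsilon_n\|\nabla\phi_n\|^2_{L^2(\Omega^M_{\varepsilon_n})}+\frac1{\varepsilon_n}\|\phi_n\|^2_{L^2(\Omega^M_{\varepsilon_n})}\le C .$$ Then there exist a subsequence (still indexed by $n$) and $\phi^b\in H^1(\Omega^b)$, $\phi^a\in H^1(\Omega^a)$, $\widehat\phi\in L^2(\omega;H^1_{per}(Y))$ such that $$\phi_n\rightharpoonup\phi^b\ \text{ weakly in } H^1(\Omega^b),\qquad \phi_n(\cdot+\varepsilon_n\mathbf e_3)\rightharpoonup\phi^a\ \text{ weakly in } H^1(\Omega^a),\qquad \mathcal T_{\varepsilon_n}(\phi_n)\rightharpoonup\widehat\phi\ \text{ weakly in } L^2(\omega;H^1(Y)).$$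 Moreover, in the sense of traces, for a.e. $(x',y_1,y_2)\in\omega\times Y'$, $$\phi^b(x',0)=\widehat\phi(x',y_1,y_2,0),\qquad \phi^a(x',0)=\widehat\phi(x',y_1,y_2,1).$$ -/

import Mathlib

open MeasureTheory Set Filter Topology

namespace Layer

noncomputable section

/-- Points `x' = (x₁, x₂)` of the plane. Only Lebesgue measure and the topology matter. -/
abbrev R2 : Type := ℝ × ℝ

/-- Points `x = (x', x₃)` of the space, `volume` is the three-dimensional Lebesgue measure. -/
abbrev R3 : Type := R2 × ℝ

/-- The coordinate directions `e₁, e₂, e₃`. -/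
def dir : Fin 3 → R3 := ![((1, 0), 0), ((0, 1), 0), ((0, 0), 1)]

/-- The classical partial derivative `∂ᵢ ψ`. -/
def pd (i : Fin 3) (ψ : R3 → ℝ) (x : R3) : ℝ := fderiv ℝ ψ x (dir i)

/-- `ψ ∈ C_c^∞(W)`. -/
def IsTest (W : Set R3) (ψ : R3 → ℝ) : Prop :=
  ContDiff ℝ ((⊤ : ℕ∞) : WithTop ℕ∞) ψ ∧ HasCompactSupport ψ ∧ tsupport ψ ⊆ W

/-- The Lebesgue space `L²(U)`. -/
abbrev L2 (U : Set R3) : Type := Lp ℝ 2 (volume.restrict U)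

/-- `L²(U) × L²(U)³` with its Hilbert norm `(‖u‖² + ∑ᵢ ‖pᵢ‖²)^(1/2)`. -/
abbrev L2Pair (U : Set R3) : Type := WithLp 2 (L2 U × PiLp 2 (fun _ : Fin 3 => L2 U))

lemma integrable_mul_of_compact {U : Set R3} (f : L2 U) {h : R3 → ℝ} (hc : Continuous h)
    (hs : HasCompactSupport h) : Integrable (fun x => f x * h x) (volume.restrict U) :=
  (Lp.memLp f).integrable_mul (q := 2)
    (hc.memLp_of_hasCompactSupport (p := 2) (μ := volume.restrict U) hs)

lemma IsTest.continuous {W : Set R3} {ψ : R3 → ℝ} (h : IsTest W ψ) : Continuous ψ :=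
  h.1.continuous

lemma IsTest.continuous_pd {W : Set R3} {ψ : R3 → ℝ} (h : IsTest W ψ) (i : Fin 3) :
    Continuous (pd i ψ) :=
  (h.1.continuous_fderiv (by simp)).clm_apply continuous_const

lemma IsTest.compact_pd {W : Set R3} {ψ : R3 → ℝ} (h : IsTest W ψ) (i : Fin 3) :
    HasCompactSupport (pd i ψ) :=
  h.2.1.fderiv_apply ℝ (dir i)

/-- The Sobolev space `H¹(U)`, as the space of pairs `(u, ∇u)` of a function `u ∈ L²(U)` and its
weak gradient in `L²(U)³`, with the norm `(‖u‖² + ‖∇u‖²)^(1/2)`. -/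
def H1 (U : Set R3) : Submodule ℝ (L2Pair U) where
  carrier := {u | ∀ (i : Fin 3) (ψ : R3 → ℝ), IsTest U ψ →
    ∫ x in U, u.fst x * pd i ψ x = - ∫ x in U, u.snd i x * ψ x}
  zero_mem' := by
    intro i ψ _
    have h1 : ∫ x in U, (0 : L2Pair U).fst x * pd i ψ x = 0 :=
      integral_eq_zero_of_ae <| by
        filter_upwards [Lp.coeFn_zero ℝ 2 (volume.restrict U)] with x hx
        change (0 : L2 U) x * _ = _
        rw [hx, Pi.zero_apply, zero_mul]
    have h2 : ∫ x in U, (0 : L2Pair U).snd i x * ψ x = 0 :=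
      integral_eq_zero_of_ae <| by
        filter_upwards [Lp.coeFn_zero ℝ 2 (volume.restrict U)] with x hx
        change (0 : L2 U) x * _ = _
        rw [hx, Pi.zero_apply, zero_mul]
    rw [h1, h2, neg_zero]
  add_mem' := by
    intro u v hu hv i ψ hψ
    have h1 : ∫ x in U, (u + v).fst x * pd i ψ x
        = ∫ x in U, (u.fst x * pd i ψ x + v.fst x * pd i ψ x) :=
      integral_congr_ae <| by
        filter_upwards [Lp.coeFn_add u.fst v.fst] with x hx
        change (u.fst + v.fst : L2 U) x * _ = _
        rw [hx, Pi.add_apply, add_mul]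
    have h2 : ∫ x in U, (u + v).snd i x * ψ x
        = ∫ x in U, (u.snd i x * ψ x + v.snd i x * ψ x) :=
      integral_congr_ae <| by
        filter_upwards [Lp.coeFn_add (u.snd i) (v.snd i)] with x hx
        change (u.snd i + v.snd i : L2 U) x * _ = _
        rw [hx, Pi.add_apply, add_mul]
    have hc := hψ.continuous_pd i
    have hs := hψ.compact_pd i
    rw [h1, h2, integral_add (integrable_mul_of_compact _ hc hs) (integrable_mul_of_compact _ hc hs),
      integral_add (integrable_mul_of_compact _ hψ.continuous hψ.2.1)
        (integrable_mul_of_compact _ hψ.continuous hψ.2.1), hu i ψ hψ, hv i ψ hψ]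
    ring
  smul_mem' := by
    intro c u hu i ψ hψ
    have h1 : ∫ x in U, (c • u).fst x * pd i ψ x = ∫ x in U, c * (u.fst x * pd i ψ x) :=
      integral_congr_ae <| by
        filter_upwards [Lp.coeFn_smul c u.fst] with x hx
        change (c • u.fst : L2 U) x * _ = _
        rw [hx, Pi.smul_apply, smul_eq_mul, mul_assoc]
    have h2 : ∫ x in U, (c • u).snd i x * ψ x = ∫ x in U, c * (u.snd i x * ψ x) :=
      integral_congr_ae <| by
        filter_upwards [Lp.coeFn_smul c (u.snd i)] with x hx
        change (c • u.snd i : L2 U) x * _ = _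
        rw [hx, Pi.smul_apply, smul_eq_mul, mul_assoc]
    rw [h1, h2, integral_const_mul, integral_const_mul, hu i ψ hψ]
    ring

/-- (A representative of) the function `u`; only its values almost everywhere in `U` matter. -/
def fn {U : Set R3} (u : H1 U) : R3 → ℝ := (u : L2Pair U).fst

/-- (A representative of) the weak partial derivative `∂ᵢ u`. -/
def grad {U : Set R3} (u : H1 U) (i : Fin 3) : R3 → ℝ := (u : L2Pair U).snd i

/-- `∫_S |u|²`, the square of the norm of `u` in `L²(S)`, for `S ⊆ U`. -/
def sqNormOn {U : Set R3} (u : H1 U) (S : Set R3) : ℝ := ∫ x in S, fn u x ^ 2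

/-- `∫_S |∇u|²`, the square of the norm of `∇u` in `L²(S)`, for `S ⊆ U`. -/
def sqNormGradOn {U : Set R3} (u : H1 U) (S : Set R3) : ℝ :=
  ∫ x in S, ∑ i : Fin 3, grad u i x ^ 2

/-- Convergence of a sequence in the weak topology of a normed space. -/
def WeakTendsto {E : Type} [NormedAddCommGroup E] [NormedSpace ℝ E] (u : ℕ → E) (v : E) : Prop :=
  Tendsto (fun n => toWeakSpace ℝ E (u n)) atTop (𝓝 (toWeakSpace ℝ E v))

/-! ### Domains -/

/-- `Ω = ω × (-L, L)`. -/
abbrev Om (ω : Set R2) (L : ℝ) : Set R3 := ω ×ˢ Ioo (-L) L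

/-- `Ωᵇ = ω × (-L, 0)`. -/
abbrev OmB (ω : Set R2) (L : ℝ) : Set R3 := ω ×ˢ Ioo (-L) 0

/-- `Ωᵃ = ω × (0, L)`. -/
abbrev OmA (ω : Set R2) (L : ℝ) : Set R3 := ω ×ˢ Ioo 0 L

/-- `Ωᵃ_ε = ω × (ε, L)`. -/
abbrev OmAEps (ω : Set R2) (L ε : ℝ) : Set R3 := ω ×ˢ Ioo ε L

/-- The layer `Ωᴹ_ε = ω × (0, ε)`. -/
abbrev OmM (ω : Set R2) (ε : ℝ) : Set R3 := ω ×ˢ Ioo 0 ε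

/-- `Y' = (0,1)²`. -/
abbrev YPlane : Set R2 := Ioo 0 1 ×ˢ Ioo 0 1

/-- The unit cell `Y = (0,1)³`. -/
abbrev Y : Set R3 := YPlane ×ˢ Ioo 0 1

/-- The Bochner space `L²(ω; H¹(Y))`. -/
abbrev L2H1 (ω : Set R2) : Type := Lp (H1 Y) 2 (volume.restrict ω)

/-! ### Shift and unfolding -/

/-- Extension of `f` by reflection in the plane `x₃ = L`. -/
def reflect (L : ℝ) (f : R3 → ℝ) (x : R3) : ℝ :=
  if x.2 ≤ L then f x else f (x.1, 2 * L - x.2)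

/-- The shifted function `f(· + ε e₃)`, where `f` is extended by reflection in `x₃ = L`. -/
def shift (L ε : ℝ) (f : R3 → ℝ) (x : R3) : ℝ := reflect L f (x.1, x.2 + ε)

/-- The integer part `[x'/ε]`. -/
def cellIndex (ε : ℝ) (x : R2) : ℤ × ℤ := (⌊x.1 / ε⌋, ⌊x.2 / ε⌋)

/-- The cell `ε(ξ + Y')`. -/
def cell (ε : ℝ) (ξ : ℤ × ℤ) : Set R2 :=
  (fun z : R2 => (ε * (ξ.1 + z.1), ε * (ξ.2 + z.2))) '' YPlane

/-- `Ξ_ε`, the indices of the cells that are contained in `ω`. -/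
def cellsIn (ε : ℝ) (ω : Set R2) : Set (ℤ × ℤ) := {ξ | cell ε ξ ⊆ ω}

open Classical in
/-- The unfolding operator: `T_ε(f)(x', y) = f(ε[(x',0)/ε] + ε y)` when `x'` lies in one of the
cells contained in `ω`, and `0` in the remaining part of `ω`. (The edges of the cells, where the
integer part is a matter of convention, form a null set.) -/
def unfold (ω : Set R2) (ε : ℝ) (f : R3 → ℝ) (x : R2) (y : R3) : ℝ :=
  if cellIndex ε x ∈ cellsIn ε ω then
    f ((ε * ((cellIndex ε x).1 + y.1.1), ε * ((cellIndex ε x).2 + y.1.2)), ε * y.2)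
  else 0

/-! ### Traces on flat faces -/

/-- `g` is the trace of `u ∈ H¹(U)` on a flat face of `U`. The face is `p '' S`, it is orthogonal
to `eᵢ`, its outward unit normal is `σ eᵢ`, and it is the part of the boundary of `U` inside the
open set `W`. The trace is the function in `L²(S)` for which Green's formula
`∫_U (u ∂ᵢψ + ∂ᵢu ψ) = ∫_face g ψ νᵢ` holds for all `ψ ∈ C_c^∞(W)`. -/
def IsFaceTrace {U : Set R3} (W : Set R3) (i : Fin 3) (σ : ℝ) (S : Set R2) (p : R2 → R3)
    (u : H1 U) (g : R2 → ℝ) : Prop :=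
  MemLp g 2 (volume.restrict S) ∧
    ∀ ψ : R3 → ℝ, IsTest W ψ →
      ∫ x in U, (fn u x * pd i ψ x + grad u i x * ψ x) = σ * ∫ z in S, g z * ψ (p z)

/-- `g(x') = u(x', b)` for `u ∈ H¹(S × (a, b))`, in the sense of traces. -/
def IsTopTrace (S : Set R2) (a b : ℝ) (u : H1 (S ×ˢ Ioo a b)) (g : R2 → ℝ) : Prop :=
  IsFaceTrace (S ×ˢ Ioi a) 2 1 S (fun z => (z, b)) u g

/-- `g(x') = u(x', a)` for `u ∈ H¹(S × (a, b))`, in the sense of traces. -/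
def IsBottomTrace (S : Set R2) (a b : ℝ) (u : H1 (S ×ˢ Ioo a b)) (g : R2 → ℝ) : Prop :=
  IsFaceTrace (S ×ˢ Iio b) 2 (-1) S (fun z => (z, a)) u g

/-- `v ∈ H¹_per(Y)`: the traces of `v` on the faces `y₁ = 0` and `y₁ = 1` coincide, and so do its
traces on the faces `y₂ = 0` and `y₂ = 1`. -/
def IsPer (v : H1 Y) : Prop :=
  (∃ g : R2 → ℝ,
    IsFaceTrace ((Iio 1 ×ˢ Ioo 0 1) ×ˢ Ioo 0 1) 0 (-1) YPlane (fun z => ((0, z.1), z.2)) v g ∧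
    IsFaceTrace ((Ioi 0 ×ˢ Ioo 0 1) ×ˢ Ioo 0 1) 0 1 YPlane (fun z => ((1, z.1), z.2)) v g) ∧
  (∃ g : R2 → ℝ,
    IsFaceTrace ((Ioo 0 1 ×ˢ Iio 1) ×ˢ Ioo 0 1) 1 (-1) YPlane (fun z => ((z.1, 0), z.2)) v g ∧
    IsFaceTrace ((Ioo 0 1 ×ˢ Ioi 0) ×ˢ Ioo 0 1) 1 1 YPlane (fun z => ((z.1, 1), z.2)) v g)

end

end Layer

namespace Layer

noncomputable section

/-! ### Weak convergence in Hilbert spaces -/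

/-! The three sequences are bounded in separable Hilbert spaces. Substituting `x = ε(ξ + y)` on each
complete cell bounds the squared norm of the unfolded function by `ε⁻¹ ∫ (φ² + ε² |∇φ|²)` over the
layer (`norm_sq_unfoldH1_le`), which is what the hypothesis controls; shifting and reflecting costs
at most a factor 2 once `ε < L / 2` (`norm_sq_shiftH1_le`). Successive extractions give the weak
limits, and it remains to identify the limit `W` in the layer.

Every property claimed of `W` is expressed by functionals `ℓ v = ∫_Y (v h + ∂ᵢv k)` (`greenL`),
where `h` and `k` may be taken periodic in `y₁, y₂`. Periodicity allows the unfolding to be undone: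
for `κ ∈ C_c^∞(ω)` the number `∫_ω κ ℓ(T_ε φ)` differs by `O(ε)` from `ε⁻¹ ∫ κ(x') (φ h(x/ε) + ε ∂ᵢφ
k(x/ε))` over the layer (`exists_unfold_pairing_error`), since only the variation of `κ` inside one
cell is lost. The limits of these layer integrals therefore determine `ℓ(W x')` for almost every
`x'`.

Periodicity: let `i` be tangential, `h = 0`, and let `k` be independent of `yᵢ` and compactly
supported in `y₃`. Integration by parts puts the derivative on `κ` alone, so the layer integral is
`O(ε)` (`exists_lateral_bound`). Thus `∂ᵢW` is orthogonal to products of functions of the other two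
variables, and by Green's formula the traces on opposite faces agree (`isPer_of_forall_test`).

Traces: in the direction `e₃`, let `k` be the product of periodic `α(y₁)`, `β(y₂)` and a bump at `y₃
= 0` or `y₃ = 1`, and `h = ∂₃k`. Green's formula on `Ω` moves the layer integral to the adjacent
block, where it becomes, up to sign, the trace of that block tested against `κ(x') α(x₁/ε) β(x₂/ε)`
(`layer_green_bottom`, `layer_green_top`). Replacing `αβ` by its mean costs `O(√ε)`: the remainder
is `ε` times a tangential divergence up to derivatives of `κ`, and is integrated by parts in a slab
of thickness `ε` (`exists_oscillating_trace_bound`). Since the block traces converge weakly, `ℓ(W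
x') = ± mean α * mean β * g(x')` with `g` the trace of the block limit; this says that the trace of
`W x'` is the constant `g(x')`.

Each such identity first holds off a null set depending on `α, β`. Separability of the spaces
involved provides a single null set (`ae_forall_inner_eq_zero`). -/

theorem weakTendsto_iff {E : Type} [NormedAddCommGroup E] [NormedSpace ℝ E] {u : ℕ → E} {v : E} :
    WeakTendsto u v ↔ ∀ f : StrongDual ℝ E, Tendsto (fun n => f (u n)) atTop (𝓝 (f v)) := by
  refine WeakBilin.tendsto_iff_forall_eval_tendsto (topDualPairing ℝ E).flip ?_
  -- The pairing must separate points for the weak topology to be described by evaluations; this is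
  -- Hahn–Banach.
  intro x y h
  by_contra hne
  obtain ⟨f, hf⟩ := SeparatingDual.exists_separating_of_ne (R := ℝ) hne
  exact hf (by simpa using congrArg (fun l => l f) h)

theorem WeakTendsto.comp {E : Type} [NormedAddCommGroup E] [NormedSpace ℝ E] {u : ℕ → E} {v : E}
    (h : WeakTendsto u v) {θ : ℕ → ℕ} (hθ : StrictMono θ) :
    WeakTendsto (fun k => u (θ k)) v :=
  Filter.Tendsto.comp (g := fun n => toWeakSpace ℝ E (u n)) h hθ.tendsto_atTop

/-- The Riesz isomorphism moves the sequence to the dual, where separability makes the closed ball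
weak-* sequentially compact; the limit functional is then moved back. -/
theorem exists_weakTendsto_of_norm_le {E : Type} [NormedAddCommGroup E] [InnerProductSpace ℝ E]
    [CompleteSpace E] [TopologicalSpace.SeparableSpace E] (u : ℕ → E) (M : ℝ)
    (hu : ∀ n, ‖u n‖ ≤ M) :
    ∃ θ : ℕ → ℕ, StrictMono θ ∧ ∃ v : E, WeakTendsto (fun k => u (θ k)) v := by
  have hmem : ∀ n, StrongDual.toWeakDual (InnerProductSpace.toDual ℝ E (u n)) ∈
      WeakDual.toStrongDual ⁻¹' Metric.closedBall (0 : StrongDual ℝ E) M := by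
    intro n
    simpa using hu n
  obtain ⟨f, -, θ, hθ, hlim⟩ := WeakDual.isSeqCompact_closedBall ℝ E 0 M hmem
  refine ⟨θ, hθ, (InnerProductSpace.toDual ℝ E).symm (WeakDual.toStrongDual f), ?_⟩
  rw [weakTendsto_iff]
  intro l
  obtain ⟨w, rfl⟩ := (InnerProductSpace.toDual ℝ E).surjective l
  rw [tendsto_iff_forall_eval_tendsto_topDualPairing] at hlim
  have := hlim w
  simp only [InnerProductSpace.toDual_apply_apply]
  simp only [real_inner_comm _ w]
  rw [InnerProductSpace.toDual_symm_apply]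
  exact this

/-- Needed for the shifted functions, whose norm is controlled only once `ε n < L / 2`. -/
theorem exists_weakTendsto_of_eventually_norm_le {E : Type} [NormedAddCommGroup E]
    [InnerProductSpace ℝ E] [CompleteSpace E] [TopologicalSpace.SeparableSpace E] (u : ℕ → E)
    (M : ℝ) (hu : ∀ᶠ n in atTop, ‖u n‖ ≤ M) :
    ∃ θ : ℕ → ℕ, StrictMono θ ∧ ∃ v : E, WeakTendsto (fun k => u (θ k)) v := by
  obtain ⟨N, hN⟩ := eventually_atTop.1 hu
  obtain ⟨θ, hθ, v, hv⟩ := exists_weakTendsto_of_norm_le (fun n => u (n + N)) M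
    (fun n => hN _ (Nat.le_add_left _ _))
  exact ⟨fun k => θ k + N, fun a b h => Nat.add_lt_add_right (hθ h) N, v, hv⟩

/-- A family of orthogonality relations, each valid almost everywhere, holds simultaneously almost
everywhere. -/
theorem ae_forall_inner_eq_zero {X H : Type*} [MeasurableSpace X] {μ : Measure X}
    [NormedAddCommGroup H] [InnerProductSpace ℝ H] [SecondCountableTopology H]
    (S : Set H) (Φ : X → H) (h : ∀ s ∈ S, ∀ᵐ x ∂μ, inner ℝ s (Φ x) = 0) :
    ∀ᵐ x ∂μ, ∀ s ∈ S, inner ℝ s (Φ x) = 0 := by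
  -- Countably many exceptional null sets are discarded for a dense subset of `S`. The relation is
  -- closed in `s`, so it extends to all of `S`; no measurability of `Φ` is involved.
  obtain ⟨D, hD, hd⟩ := TopologicalSpace.exists_countable_dense S
  have h1 : ∀ᵐ x ∂μ, ∀ s ∈ D, inner ℝ (s : H) (Φ x) = 0 :=
    (ae_ball_iff hD).2 fun s _ => h s s.2
  filter_upwards [h1] with x hx s hs
  have hcl : IsClosed {s : S | inner ℝ (s : H) (Φ x) = 0} :=
    isClosed_eq (continuous_subtype_val.inner continuous_const) continuous_const
  have := hcl.closure_subset_iff.2 hx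
  exact this (hd ⟨s, hs⟩)

/-! ### Pairings with functions in `L²` -/

section Pairing
variable {X : Type*} [MeasurableSpace X] {μ : Measure X}

/-- The functional `f ↦ ∫ f h` on `L²`. -/
def pairing {h : X → ℝ} (hh : MemLp h 2 μ) : Lp ℝ 2 μ →L[ℝ] ℝ := innerSL ℝ hh.toLp

theorem pairing_apply {h : X → ℝ} (hh : MemLp h 2 μ) (f : Lp ℝ 2 μ) :
    pairing hh f = ∫ x, f x * h x ∂μ := by
  unfold pairing
  rw [innerSL_apply_apply, L2.inner_def]
  apply integral_congr_ae
  filter_upwards [hh.coeFn_toLp] with x hx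
  rw [hx]; simp

theorem norm_sq_eq_integral (f : Lp ℝ 2 μ) : ‖f‖ ^ 2 = ∫ x, f x ^ 2 ∂μ := by
  rw [← real_inner_self_eq_norm_sq, L2.inner_def]
  apply integral_congr_ae
  filter_upwards with x
  simp [pow_two]

theorem sq_integral_mul_le {f g : X → ℝ} (hf : MemLp f 2 μ) (hg : MemLp g 2 μ) :
    (∫ x, f x * g x ∂μ) ^ 2 ≤ (∫ x, f x ^ 2 ∂μ) * ∫ x, g x ^ 2 ∂μ := by
  have h1 : ∫ x, f x * g x ∂μ = inner ℝ hf.toLp hg.toLp := by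
    rw [L2.inner_def]
    apply integral_congr_ae
    filter_upwards [hf.coeFn_toLp, hg.coeFn_toLp] with x h1 h2
    rw [h1, h2]; simp [mul_comm]
  have h2 : ∀ {f : X → ℝ} (hf : MemLp f 2 μ), ∫ x, f x ^ 2 ∂μ = ‖hf.toLp‖ ^ 2 := by
    intro f hf
    rw [norm_sq_eq_integral]
    apply integral_congr_ae
    filter_upwards [hf.coeFn_toLp] with x h1
    rw [h1]
  rw [h1, h2 hf, h2 hg, ← mul_pow, ← sq_abs]
  gcongr
  exact abs_real_inner_le_norm _ _

theorem abs_integral_mul_le {f g : X → ℝ} {A B : ℝ} (hf : MemLp f 2 μ) (hg : MemLp g 2 μ)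
    (hA : ∫ x, f x ^ 2 ∂μ ≤ A) (hB : ∫ x, g x ^ 2 ∂μ ≤ B) :
    |∫ x, f x * g x ∂μ| ≤ √(A * B) := by
  apply Real.abs_le_sqrt
  refine (sq_integral_mul_le hf hg).trans ?_
  have h1 : 0 ≤ ∫ x, f x ^ 2 ∂μ := integral_nonneg fun x => sq_nonneg _
  have h2 : 0 ≤ ∫ x, g x ^ 2 ∂μ := integral_nonneg fun x => sq_nonneg _
  gcongr
  exact h1.trans hA

end Pairing

/-! ### Completeness and separability of `H¹(U)` -/

theorem mem_H1_iff {U : Set R3} {u : L2Pair U} : u ∈ H1 U ↔ ∀ (i : Fin 3) (ψ : R3 → ℝ), IsTest U ψ →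
    ∫ x in U, u.fst x * pd i ψ x = - ∫ x in U, u.snd i x * ψ x := Iff.rfl

theorem IsTest.memLp {W : Set R3} {ψ : R3 → ℝ} (h : IsTest W ψ) (U : Set R3) :
    MemLp ψ 2 (volume.restrict U) :=
  h.continuous.memLp_of_hasCompactSupport h.2.1

theorem IsTest.memLp_pd {W : Set R3} {ψ : R3 → ℝ} (h : IsTest W ψ) (i : Fin 3) (U : Set R3) :
    MemLp (pd i ψ) 2 (volume.restrict U) :=
  (h.continuous_pd i).memLp_of_hasCompactSupport (h.compact_pd i)

/-- The function component of an element of `L²(U) × L²(U)³`. -/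
def fstL (U : Set R3) : L2Pair U →L[ℝ] L2 U := WithLp.fstL 2 ℝ _ _

/-- The gradient components of an element of `L²(U) × L²(U)³`. -/
def sndL (U : Set R3) (i : Fin 3) : L2Pair U →L[ℝ] L2 U :=
  (PiLp.proj 2 (fun _ : Fin 3 => L2 U) i : PiLp 2 (fun _ : Fin 3 => L2 U) →L[ℝ] L2 U).comp
    (WithLp.sndL 2 ℝ _ _)

theorem fstL_apply {U : Set R3} (u : L2Pair U) : fstL U u = u.fst := rfl
theorem sndL_apply {U : Set R3} (u : L2Pair U) (i : Fin 3) : sndL U i u = u.snd i := rfl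

/-- Each defining identity equates two continuous functionals, so the set is an intersection of
closed sets. -/
theorem isClosed_H1 (U : Set R3) : IsClosed (H1 U : Set (L2Pair U)) := by
  have : (H1 U : Set (L2Pair U)) = ⋂ (i : Fin 3) (ψ : R3 → ℝ) (h : IsTest U ψ),
      {u : L2Pair U | pairing (h.memLp_pd i U) (fstL U u)
        = - pairing (h.memLp U) (sndL U i u)} := by
    ext u
    simp only [SetLike.mem_coe, mem_H1_iff, mem_iInter, mem_ofPred_eq, pairing_apply, fstL_apply,
      sndL_apply]
  rw [this]
  refine isClosed_iInter fun i => isClosed_iInter fun ψ => isClosed_iInter fun h => ?_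
  exact isClosed_eq (by fun_prop) (by fun_prop)

instance (U : Set R3) : CompleteSpace (H1 U) := (isClosed_H1 U).completeSpace_coe

/-- `Lp` is separable only for finite exponents. Separability serves twice: for weak sequential
compactness, and for exchanging "almost every `x`" with "all test functions". -/
instance : Fact ((2 : ENNReal) ≠ ⊤) := ⟨by simp⟩

instance (U : Set R3) : SecondCountableTopology (L2 U) := inferInstance

instance (U : Set R3) : SecondCountableTopology (L2Pair U) := by
  have h1 : SecondCountableTopology (PiLp 2 (fun _ : Fin 3 => L2 U)) :=
    (PiLp.homeomorph 2 (fun _ : Fin 3 => L2 U)).secondCountableTopology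
  exact (WithLp.homeomorphProd 2 (L2 U) (PiLp 2 (fun _ : Fin 3 => L2 U))).secondCountableTopology

instance (U : Set R3) : SecondCountableTopology (H1 U) :=
  inferInstanceAs (SecondCountableTopology ((H1 U : Set (L2Pair U)) : Type))

instance (ω : Set R2) : SecondCountableTopology (L2H1 ω) := inferInstance

instance (ω : Set R2) : CompleteSpace (L2H1 ω) := inferInstance

/-! ### Separation by test functions -/

/-- `α ∈ C_c^∞(0, 1)`. -/
def IsTest01 (α : ℝ → ℝ) : Prop :=
  ContDiff ℝ ((⊤ : ℕ∞) : WithTop ℕ∞) α ∧ HasCompactSupport α ∧ tsupport α ⊆ Ioo 0 1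

/-- `κ ∈ C_c^∞(ω)` for a planar open set `ω`. -/
def IsTest2 (ω : Set R2) (κ : R2 → ℝ) : Prop :=
  ContDiff ℝ ((⊤ : ℕ∞) : WithTop ℕ∞) κ ∧ HasCompactSupport κ ∧ tsupport κ ⊆ ω

theorem ae_eq_zero_of_forall_test {E : Type*} [NormedAddCommGroup E] [NormedSpace ℝ E]
    [FiniteDimensional ℝ E] [MeasurableSpace E] [BorelSpace E] {μ : Measure E} {U : Set E}
    (hU : IsOpen U) {f : E → ℝ} (hf : LocallyIntegrableOn f U μ)
    (h : ∀ g : E → ℝ, ContDiff ℝ ((⊤ : ℕ∞) : WithTop ℕ∞) g → HasCompactSupport g → tsupport g ⊆ U →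
      ∫ x in U, f x * g x ∂μ = 0) : ∀ᵐ x ∂(μ.restrict U), f x = 0 := by
  rw [ae_restrict_iff' hU.measurableSet]
  refine hU.ae_eq_zero_of_integral_contDiff_smul_eq_zero hf fun g h1 h2 h3 => ?_
  rw [← h g h1 h2 h3, setIntegral_eq_integral_of_forall_compl_eq_zero]
  · simp only [smul_eq_mul, mul_comm]
  · intro x hx
    rw [image_eq_zero_of_notMem_tsupport fun hx' => hx (h3 hx'), mul_zero]

theorem volume_restrict_YPlane : (volume : Measure R2).restrict YPlane =
    (volume.restrict (Ioo (0 : ℝ) 1)).prod (volume.restrict (Ioo (0 : ℝ) 1)) := by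
  rw [Measure.prod_restrict]; rfl

instance : IsFiniteMeasure ((volume : Measure ℝ).restrict (Ioo (0 : ℝ) 1)) :=
  ⟨by simp⟩

instance : IsFiniteMeasure ((volume : Measure R2).restrict YPlane) := by
  rw [volume_restrict_YPlane]; infer_instance

theorem volume_restrict_Y : (volume : Measure R3).restrict Y =
    (volume.restrict YPlane).prod (volume.restrict (Ioo (0 : ℝ) 1)) := by
  rw [Measure.prod_restrict]; rfl

instance : IsFiniteMeasure ((volume : Measure R3).restrict Y) := by
  rw [volume_restrict_Y]; infer_instance

theorem IsTest01.memLp {α : ℝ → ℝ} (h : IsTest01 α) (U : Set ℝ) :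
    MemLp α 2 (volume.restrict U) :=
  h.1.continuous.memLp_of_hasCompactSupport h.2.1

/-- Products of one-dimensional test functions separate the points of `L²((0,1)²)`. -/
theorem ae_eq_zero_of_forall_test_prod {f : R2 → ℝ} (hf : MemLp f 2 (volume.restrict YPlane))
    (h : ∀ α β, IsTest01 α → IsTest01 β → ∫ z in YPlane, f z * (α z.1 * β z.2) = 0) :
    f =ᵐ[volume.restrict YPlane] 0 := by
  classical
  rw [volume_restrict_YPlane] at hf h ⊢
  set ν := (volume : Measure ℝ).restrict (Ioo (0 : ℝ) 1) with hν
  have hfi : Integrable f (ν.prod ν) := hf.integrable one_le_two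
  have hsec : ∀ᵐ x ∂ν, MemLp (fun y => f (x, y)) 2 ν := by
    have h1 := hf.integrable_sq.prod_right_ae
    have h2 := hfi.prod_right_ae
    filter_upwards [h1, h2] with x h1 h2
    exact (memLp_two_iff_integrable_sq h2.aestronglyMeasurable).2 h1
  -- The slices of `f` as vectors of `L²(0,1)`, with the value 0 on the null set of bad slices.
  -- Orthogonality to a fixed `β` holds for almost every slice; the exceptional set is then made
  -- independent of `β`.
  set Φ : ℝ → Lp ℝ 2 ν := fun x =>
    if hx : MemLp (fun y => f (x, y)) 2 ν then hx.toLp else 0 with hΦ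
  have hpair : ∀ {x : ℝ} (hx : MemLp (fun y => f (x, y)) 2 ν) {β : ℝ → ℝ} (hβ : MemLp β 2 ν),
      inner ℝ hβ.toLp (Φ x) = ∫ y, f (x, y) * β y ∂ν := by
    intro x hx β hβ
    change pairing hβ (Φ x) = _
    rw [pairing_apply]
    apply integral_congr_ae
    simp only [hΦ, dif_pos hx]
    filter_upwards [hx.coeFn_toLp] with y hy
    rw [hy]
  have key := ae_forall_inner_eq_zero (μ := ν)
    {s : Lp ℝ 2 ν | ∃ (β : ℝ → ℝ) (hβ : IsTest01 β), s = (hβ.memLp (Ioo 0 1)).toLp} Φ (by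
      rintro _ ⟨β, hβ, rfl⟩
      obtain ⟨Cβ, hCβ⟩ := hβ.2.1.exists_bound_of_continuous hβ.1.continuous
      have hint : Integrable (fun z : ℝ × ℝ => f z * β z.2) (ν.prod ν) := by
        refine hfi.mul_bdd (c := Cβ) ?_ ?_
        · exact (hβ.1.continuous.comp continuous_snd).aestronglyMeasurable
        · exact Eventually.of_forall fun z => hCβ _
      have h0 : ∀ᵐ x ∂ν, ∫ y, f (x, y) * β y ∂ν = 0 := by
        refine ae_eq_zero_of_forall_test isOpen_Ioo
          (IntegrableOn.locallyIntegrableOn hint.integral_prod_left) ?_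
        · intro g h1 h2 h3
          have hint2 : Integrable (fun z : ℝ × ℝ => f z * (g z.1 * β z.2)) (ν.prod ν) := by
            obtain ⟨Cg, hCg⟩ := h2.exists_bound_of_continuous h1.continuous
            have := hint.mul_bdd (g := fun z : ℝ × ℝ => g z.1) (c := Cg)
              (h1.continuous.comp continuous_fst).aestronglyMeasurable
              (Eventually.of_forall fun z => hCg _)
            refine this.congr (Eventually.of_forall fun z => ?_)
            simp only []; ring
          have h4 := h g β ⟨h1, h2, h3⟩ hβ
          rw [integral_prod _ hint2] at h4
          refine Eq.trans ?_ h4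
          apply integral_congr_ae
          filter_upwards with x
          rw [← integral_mul_const]
          congr 1 with y
          ring
      filter_upwards [h0, hsec] with x hx hx'
      rw [hpair hx', hx])
  have hz : ∀ᵐ x ∂ν, ∀ᵐ y ∂ν, f (x, y) = 0 := by
    filter_upwards [key, hsec] with x hx hx'
    refine ae_eq_zero_of_forall_test isOpen_Ioo
      (IntegrableOn.locallyIntegrableOn (hx'.integrable one_le_two)) ?_
    intro g h1 h2 h3
    have := hx _ ⟨g, ⟨h1, h2, h3⟩, rfl⟩
    rwa [hpair hx'] at this
  -- Fubini for `‖f‖` turns vanishing on almost every slice into vanishing almost everywhere on the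
  -- square.
  have hI : ∫ z, ‖f z‖ ∂(ν.prod ν) = 0 := by
    rw [integral_prod _ hfi.norm]
    refine integral_eq_zero_of_ae ?_
    filter_upwards [hz] with x hx
    refine integral_eq_zero_of_ae ?_
    filter_upwards [hx] with y hy
    simp [hy]
  rw [integral_eq_zero_iff_of_nonneg (fun _ => norm_nonneg _) hfi.norm] at hI
  filter_upwards [hI] with z hz
  simpa using hz

/-! ### Periodic extension -/

/-- The 1-periodic extension of a function on `[0, 1)`. -/
def per (α : ℝ → ℝ) (t : ℝ) : ℝ := α (Int.fract t)

theorem per_add_one (α : ℝ → ℝ) (t : ℝ) : per α (t + 1) = per α t := by simp [per]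

theorem per_int_add (α : ℝ → ℝ) (m : ℤ) {t : ℝ} (ht : t ∈ Ioo (0 : ℝ) 1) : per α (m + t) = α t := by
  unfold per
  rw [Int.fract_intCast_add, Int.fract_eq_self.2 ⟨ht.1.le, ht.2⟩]

/-- Near an integer the extension is identically zero, because `α` vanishes near both 0 and 1; near
any other point it is a translate of `α`. -/
theorem contDiff_per {α : ℝ → ℝ} (h : IsTest01 α) :
    ContDiff ℝ ((⊤ : ℕ∞) : WithTop ℕ∞) (per α) := by
  have hz : ∀ᶠ t in 𝓝 (0 : ℝ), α t = 0 := by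
    have : (0 : ℝ) ∉ tsupport α := fun h0 => lt_irrefl _ (h.2.2 h0).1
    exact notMem_tsupport_iff_eventuallyEq.1 this
  have ho : ∀ᶠ t in 𝓝 (1 : ℝ), α t = 0 := by
    have : (1 : ℝ) ∉ tsupport α := fun h0 => lt_irrefl _ (h.2.2 h0).2
    exact notMem_tsupport_iff_eventuallyEq.1 this
  rw [contDiff_iff_contDiffAt]
  intro t
  by_cases ht : Int.fract t = 0
  · have htm : ((⌊t⌋ : ℤ) : ℝ) = t := by
      have := Int.self_sub_floor t
      linarith
    have hzero : per α =ᶠ[𝓝 t] fun _ => 0 := by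
      have c1 : Tendsto (fun s : ℝ => s - ⌊t⌋) (𝓝 t) (𝓝 0) := by
        have : Tendsto (fun s : ℝ => s - ⌊t⌋) (𝓝 t) (𝓝 (t - ⌊t⌋)) :=
          (continuous_id.sub continuous_const).tendsto t
        rwa [sub_eq_zero.2 htm.symm] at this
      have c2 : Tendsto (fun s : ℝ => s - ⌊t⌋ + 1) (𝓝 t) (𝓝 1) := by
        simpa using c1.add_const 1
      have c3 : ∀ᶠ s : ℝ in 𝓝 t, s - ⌊t⌋ ∈ Ioo (-1 : ℝ) 1 := c1 (Ioo_mem_nhds (by norm_num) (by norm_num))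
      filter_upwards [c1.eventually hz, c2.eventually ho, c3] with s h1 h2 h3
      rcases lt_or_ge (s - ⌊t⌋) 0 with hs | hs
      · have : Int.fract s = s - ⌊t⌋ + 1 := by
          rw [Int.fract_eq_iff]
          exact ⟨by linarith [h3.1], by linarith, ⌊t⌋ - 1, by push_cast; ring⟩
        rw [per, this, h2]
      · have : Int.fract s = s - ⌊t⌋ := by
          rw [Int.fract_eq_iff]
          exact ⟨hs, h3.2, ⌊t⌋, by ring⟩
        rw [per, this, h1]
    exact contDiffAt_const.congr_of_eventuallyEq hzero
  · have hpos : 0 < Int.fract t := lt_of_le_of_ne (Int.fract_nonneg t) (Ne.symm ht)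
    have hmem : ∀ᶠ s in 𝓝 t, s ∈ Ioo (⌊t⌋ : ℝ) (⌊t⌋ + 1) := by
      refine Ioo_mem_nhds ?_ (Int.lt_floor_add_one t)
      have := Int.self_sub_floor t
      linarith
    have heq : per α =ᶠ[𝓝 t] fun s => α (s - ⌊t⌋) := by
      filter_upwards [hmem] with s hs
      have : Int.fract s = s - ⌊t⌋ := by
        rw [Int.fract_eq_iff]
        exact ⟨by linarith [hs.1], by linarith [hs.2], ⌊t⌋, by ring⟩
      rw [per, this]
    exact (h.1.comp (contDiff_id.sub contDiff_const)).contDiffAt.congr_of_eventuallyEq heq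

theorem exists_bound_of_periodic {f : ℝ → ℝ} (hf : Continuous f) (hp : ∀ t, f (t + 1) = f t) :
    ∃ M, 0 ≤ M ∧ ∀ t, |f t| ≤ M := by
  obtain ⟨M, hM⟩ := isCompact_Icc.exists_bound_of_continuousOn (s := Icc (0 : ℝ) 1) hf.continuousOn
  refine ⟨M, (norm_nonneg _).trans (hM 0 ⟨le_rfl, zero_le_one⟩), fun t => ?_⟩
  have hper : Function.Periodic f 1 := hp
  have : f t = f (Int.fract t) := by
    rw [Int.fract, ← hper.sub_zsmul_eq ⌊t⌋]; simp
  rw [this]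
  exact hM _ ⟨Int.fract_nonneg t, (Int.fract_lt_one t).le⟩

/-- The mean `∫₀¹ α`. -/
def mean (α : ℝ → ℝ) : ℝ := ∫ t in Ioo (0 : ℝ) 1, α t

/-- A periodic function minus its mean has a smooth bounded periodic primitive. -/
theorem exists_periodic_primitive {α : ℝ → ℝ} (h : IsTest01 α) :
    ∃ A : ℝ → ℝ, ContDiff ℝ ((⊤ : ℕ∞) : WithTop ℕ∞) A ∧ (∃ M, 0 ≤ M ∧ ∀ t, |A t| ≤ M) ∧
      ∀ t, HasDerivAt A (per α t - mean α) t := by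
  have hs : ContDiff ℝ ((⊤ : ℕ∞) : WithTop ℕ∞) (fun t => per α t - mean α) :=
    (contDiff_per h).sub contDiff_const
  set A : ℝ → ℝ := fun t => ∫ s in (0 : ℝ)..t, (per α s - mean α) with hA
  have hd : ∀ t, HasDerivAt A (per α t - mean α) t := fun t =>
    intervalIntegral.integral_hasDerivAt_right (hs.continuous.intervalIntegrable _ _)
      hs.continuous.aestronglyMeasurable.stronglyMeasurableAtFilter hs.continuous.continuousAt
  have hdA : deriv A = fun t => per α t - mean α := funext fun t => (hd t).deriv
  have hsm : ContDiff ℝ ((⊤ : ℕ∞) : WithTop ℕ∞) A := by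
    rw [contDiff_infty_iff_deriv, hdA]
    exact ⟨fun t => (hd t).differentiableAt, hs⟩
  refine ⟨A, hsm, ?_, hd⟩
  -- The primitive is itself periodic, since subtracting the mean makes the integral over one period
  -- vanish; a continuous periodic function is bounded.
  apply exists_bound_of_periodic hsm.continuous
  intro t
  have hper : Function.Periodic (fun s => per α s - mean α) 1 := fun s => by
    simp only [per_add_one]
  have h1 : ∫ s in (0 : ℝ)..1, (per α s - mean α) = 0 := by
    rw [intervalIntegral.integral_sub ((contDiff_per h).continuous.intervalIntegrable _ _)
      (by simp), intervalIntegral.integral_of_le zero_le_one, integral_Ioc_eq_integral_Ioo,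
      intervalIntegral.integral_const]
    have : ∫ s in Ioo (0 : ℝ) 1, per α s = mean α := by
      apply setIntegral_congr_fun measurableSet_Ioo
      intro s hs
      have := per_int_add α 0 hs
      simpa using this
    rw [this]; simp
  have h2 := hper.intervalIntegral_add_eq t 0
  simp only [hA]
  rw [← intervalIntegral.integral_add_adjacent_intervals (b := t)
    (hs.continuous.intervalIntegrable _ _) (hs.continuous.intervalIntegrable _ _), h2, zero_add,
    h1, add_zero]

/-! ### One-dimensional cut-offs -/

/-- A smooth step, `0` for `t ≤ -3/4` and `1` for `-1/2 ≤ t`. -/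
def step (t : ℝ) : ℝ := Real.smoothTransition (4 * t + 3)

theorem contDiff_step : ContDiff ℝ ((⊤ : ℕ∞) : WithTop ℕ∞) step :=
  Real.smoothTransition.contDiff.comp ((contDiff_const.mul contDiff_id).add contDiff_const)

theorem step_eq_zero {t : ℝ} (h : t ≤ -3 / 4) : step t = 0 :=
  Real.smoothTransition.zero_of_nonpos (by linarith)

theorem step_eq_one {t : ℝ} (h : -1 / 2 ≤ t) : step t = 1 :=
  Real.smoothTransition.one_of_one_le (by linarith)

theorem step_nonneg (t : ℝ) : 0 ≤ step t := Real.smoothTransition.nonneg _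

theorem step_le_one (t : ℝ) : step t ≤ 1 := Real.smoothTransition.le_one _

theorem deriv_step_eq_zero_of_lt {t : ℝ} (h : t < -3 / 4) : deriv step t = 0 := by
  have : step =ᶠ[𝓝 t] fun _ => 0 := by
    filter_upwards [Iio_mem_nhds h] with s hs using step_eq_zero (le_of_lt hs)
  rw [this.deriv_eq, deriv_const]

theorem deriv_step_eq_zero_of_gt {t : ℝ} (h : -1 / 2 < t) : deriv step t = 0 := by
  have : step =ᶠ[𝓝 t] fun _ => 1 := by
    filter_upwards [Ioi_mem_nhds h] with s hs using step_eq_one (le_of_lt hs)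
  rw [this.deriv_eq, deriv_const]

theorem contDiff_deriv_step : ContDiff ℝ ((⊤ : ℕ∞) : WithTop ℕ∞) (deriv step) :=
  (contDiff_infty_iff_deriv.1 contDiff_step).2

theorem exists_bound_deriv_step : ∃ M, 0 ≤ M ∧ ∀ t, |deriv step t| ≤ M := by
  obtain ⟨M, hM⟩ := isCompact_Icc.exists_bound_of_continuousOn (s := Icc (-1 : ℝ) 0)
    contDiff_deriv_step.continuous.continuousOn
  have hM0 : 0 ≤ M := (norm_nonneg _).trans (hM 0 ⟨by norm_num, le_rfl⟩)
  refine ⟨M, hM0, fun t => ?_⟩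
  rcases lt_or_ge t (-3 / 4) with h | h
  · rw [deriv_step_eq_zero_of_lt h]; simpa
  rcases lt_or_ge (-1 / 2) t with h' | h'
  · rw [deriv_step_eq_zero_of_gt h']; simpa
  exact hM t ⟨by linarith, by linarith⟩

/-! ### Calculus of test functions -/

theorem IsTest.mono {V W : Set R3} {ψ : R3 → ℝ} (h : IsTest V ψ) (hVW : V ⊆ W) : IsTest W ψ :=
  ⟨h.1, h.2.1, h.2.2.trans hVW⟩

theorem IsTest.differentiable {W : Set R3} {ψ : R3 → ℝ} (h : IsTest W ψ) : Differentiable ℝ ψ :=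
  h.1.differentiable (by simp)

theorem IsTest.add {W : Set R3} {ψ χ : R3 → ℝ} (h : IsTest W ψ) (h' : IsTest W χ) :
    IsTest W (fun x => ψ x + χ x) :=
  ⟨h.1.add h'.1, h.2.1.add h'.2.1, (tsupport_add ψ χ).trans (union_subset h.2.2 h'.2.2)⟩

theorem IsTest.const_mul {W : Set R3} {ψ : R3 → ℝ} (h : IsTest W ψ) (c : ℝ) :
    IsTest W (fun x => c * ψ x) :=
  ⟨contDiff_const.mul h.1, h.2.1.mul_left, (tsupport_mul_subset_right).trans h.2.2⟩

theorem IsTest.eq_zero {W : Set R3} {ψ : R3 → ℝ} (h : IsTest W ψ) {x : R3} (hx : x ∉ W) :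
    ψ x = 0 := image_eq_zero_of_notMem_tsupport fun h' => hx (h.2.2 h')

theorem IsTest.pd_eq_zero {W : Set R3} {ψ : R3 → ℝ} (h : IsTest W ψ) (i : Fin 3) {x : R3}
    (hx : x ∉ W) : pd i ψ x = 0 := by
  have : x ∉ tsupport (pd i ψ) := fun h' => hx (h.2.2 (tsupport_fderiv_apply_subset ℝ (dir i) h'))
  exact image_eq_zero_of_notMem_tsupport this

theorem pd_add {ψ χ : R3 → ℝ} (hψ : Differentiable ℝ ψ) (hχ : Differentiable ℝ χ) (i : Fin 3)
    (x : R3) : pd i (fun x => ψ x + χ x) x = pd i ψ x + pd i χ x := by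
  unfold pd
  rw [show (fun x => ψ x + χ x) = ψ + χ from rfl, fderiv_add (hψ x) (hχ x)]; rfl

theorem pd_const_mul {ψ : R3 → ℝ} (hψ : Differentiable ℝ ψ) (c : ℝ) (i : Fin 3)
    (x : R3) : pd i (fun x => c * ψ x) x = c * pd i ψ x := by
  unfold pd
  rw [fderiv_const_mul (hψ x)]; rfl

theorem pd_mul {ψ χ : R3 → ℝ} (hψ : Differentiable ℝ ψ) (hχ : Differentiable ℝ χ) (i : Fin 3)
    (x : R3) : pd i (fun x => ψ x * χ x) x = pd i ψ x * χ x + ψ x * pd i χ x := by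
  unfold pd
  rw [fderiv_fun_mul (hψ x) (hχ x)]
  simp only [add_apply, smul_apply, smul_eq_mul]
  ring

theorem pd_comp_fst {κ : R2 → ℝ} (hκ : Differentiable ℝ κ) (i : Fin 3) (x : R3) :
    pd i (fun x => κ x.1) x = fderiv ℝ κ x.1 (dir i).1 := by
  unfold pd
  rw [show (fun x : R3 => κ x.1) = κ ∘ Prod.fst from rfl,
    fderiv_comp x (hκ _) differentiableAt_fst, fderiv_fst]
  rfl

theorem pd_comp_snd {η : ℝ → ℝ} (hη : Differentiable ℝ η) (i : Fin 3) (x : R3) :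
    pd i (fun x => η x.2) x = (dir i).2 * deriv η x.2 := by
  unfold pd
  rw [show (fun x : R3 => η x.2) = η ∘ Prod.snd from rfl,
    fderiv_comp x (hη _) differentiableAt_snd, fderiv_snd]
  simp

/-- The product of a test function of `x'` and a test function of `x₃`. -/
theorem IsTest2.mul_snd {ω : Set R2} {J : Set ℝ} {κ : R2 → ℝ} {η : ℝ → ℝ} (hκ : IsTest2 ω κ)
    (hη : ContDiff ℝ ((⊤ : ℕ∞) : WithTop ℕ∞) η) (hc : HasCompactSupport η) (hJ : tsupport η ⊆ J) :
    IsTest (ω ×ˢ J) (fun x => κ x.1 * η x.2) := by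
  have hsub : tsupport (fun x : R3 => κ x.1 * η x.2) ⊆ tsupport κ ×ˢ tsupport η := by
    refine closure_minimal ?_ ((isClosed_tsupport κ).prod (isClosed_tsupport η))
    intro x hx
    have := mul_ne_zero_iff.1 hx
    exact ⟨subset_tsupport _ this.1, subset_tsupport _ this.2⟩
  exact ⟨(hκ.1.comp contDiff_fst).mul (hη.comp contDiff_snd),
    (hκ.2.1.isCompact.prod hc.isCompact).of_isClosed_subset (isClosed_tsupport _) hsub,
    hsub.trans (prod_mono hκ.2.2 hJ)⟩

theorem IsTest2.differentiable {ω : Set R2} {κ : R2 → ℝ} (h : IsTest2 ω κ) : Differentiable ℝ κ :=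
  h.1.differentiable (by simp)

/-! ### Weak derivatives of functions -/

/-- `f, d ∈ L²(U)` and `d = ∂ᵢ f` in the weak sense. -/
structure HasWeakPd (U : Set R3) (i : Fin 3) (f d : R3 → ℝ) : Prop where
  memLp : MemLp f 2 (volume.restrict U)
  memLp_pd : MemLp d 2 (volume.restrict U)
  integral_eq : ∀ ψ : R3 → ℝ, IsTest U ψ → ∫ x in U, f x * pd i ψ x = - ∫ x in U, d x * ψ x

theorem hasWeakPd {U : Set R3} (u : H1 U) (i : Fin 3) : HasWeakPd U i (fn u) (grad u i) :=
  ⟨Lp.memLp _, Lp.memLp _, u.2 i⟩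

theorem HasWeakPd.integrable_mul {U W : Set R3} {i : Fin 3} {f d : R3 → ℝ}
    (h : HasWeakPd U i f d) {ψ : R3 → ℝ} (hψ : IsTest W ψ) (j : Fin 3) :
    Integrable (fun x => f x * pd j ψ x) (volume.restrict U) ∧
      Integrable (fun x => d x * ψ x) (volume.restrict U) :=
  ⟨h.memLp.integrable_mul (hψ.memLp_pd j U), h.memLp_pd.integrable_mul (hψ.memLp U)⟩

theorem HasWeakPd.congr {U : Set R3} {i : Fin 3} {f d f' d' : R3 → ℝ} (h : HasWeakPd U i f d)
    (hf : f =ᵐ[volume.restrict U] f') (hd : d =ᵐ[volume.restrict U] d') :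
    HasWeakPd U i f' d' := by
  refine ⟨h.memLp.ae_eq hf, h.memLp_pd.ae_eq hd, fun ψ hψ => ?_⟩
  have h1 : ∫ x in U, f' x * pd i ψ x = ∫ x in U, f x * pd i ψ x := by
    apply integral_congr_ae
    filter_upwards [hf] with x hx; rw [hx]
  have h2 : ∫ x in U, d' x * ψ x = ∫ x in U, d x * ψ x := by
    apply integral_congr_ae
    filter_upwards [hd] with x hx; rw [hx]
  rw [h1, h2, h.integral_eq ψ hψ]

theorem setIntegral_mul_eq {U : Set R3} {f h : R3 → ℝ} (hz : ∀ x, x ∉ U → h x = 0) :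
    ∫ x in U, f x * h x = ∫ x, f x * h x :=
  setIntegral_eq_integral_of_forall_compl_eq_zero fun x hx => by rw [hz x hx, mul_zero]

theorem HasWeakPd.mono {U U' : Set R3} {i : Fin 3} {f d : R3 → ℝ} (h : HasWeakPd U i f d)
    (hU : U' ⊆ U) : HasWeakPd U' i f d := by
  refine ⟨h.memLp.mono_measure (Measure.restrict_mono hU le_rfl),
    h.memLp_pd.mono_measure (Measure.restrict_mono hU le_rfl), fun ψ hψ => ?_⟩
  have := h.integral_eq ψ (hψ.mono hU)
  rwa [setIntegral_mul_eq fun x hx => (hψ.mono hU).pd_eq_zero i hx,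
    setIntegral_mul_eq fun x hx => (hψ.mono hU).eq_zero hx,
    ← setIntegral_mul_eq fun x hx => hψ.pd_eq_zero i hx,
    ← setIntegral_mul_eq fun x hx => hψ.eq_zero hx] at this

/-- The element of `H¹(U)` given by a function and its weak gradient. -/
def ofFun {U : Set R3} {f : R3 → ℝ} {d : Fin 3 → R3 → ℝ} (h : ∀ i, HasWeakPd U i f (d i)) : H1 U :=
  ⟨WithLp.toLp 2 ((h 0).memLp.toLp, WithLp.toLp 2 fun i => (h i).memLp_pd.toLp), by
    intro i ψ hψ
    have h1 := (h 0).memLp.coeFn_toLp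
    have h2 := (h i).memLp_pd.coeFn_toLp
    exact ((h i).congr h1.symm h2.symm).integral_eq ψ hψ⟩

theorem fn_ofFun {U : Set R3} {f : R3 → ℝ} {d : Fin 3 → R3 → ℝ}
    (h : ∀ i, HasWeakPd U i f (d i)) : fn (ofFun h) =ᵐ[volume.restrict U] f :=
  (h 0).memLp.coeFn_toLp

theorem grad_ofFun {U : Set R3} {f : R3 → ℝ} {d : Fin 3 → R3 → ℝ}
    (h : ∀ i, HasWeakPd U i f (d i)) (i : Fin 3) :
    grad (ofFun h) i =ᵐ[volume.restrict U] d i :=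
  (h i).memLp_pd.coeFn_toLp

theorem norm_sq_H1 {U : Set R3} (u : H1 U) :
    ‖u‖ ^ 2 = (∫ x in U, fn u x ^ 2) + ∑ i, ∫ x in U, grad u i x ^ 2 := by
  change ‖(u : L2Pair U)‖ ^ 2 = _
  rw [WithLp.prod_norm_sq_eq_of_L2, PiLp.norm_sq_eq_of_L2, norm_sq_eq_integral]
  congr 1
  exact Finset.sum_congr rfl fun i _ => norm_sq_eq_integral _

theorem norm_sq_ofFun {U : Set R3} {f : R3 → ℝ} {d : Fin 3 → R3 → ℝ}
    (h : ∀ i, HasWeakPd U i f (d i)) :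
    ‖ofFun h‖ ^ 2 = (∫ x in U, f x ^ 2) + ∑ i, ∫ x in U, d i x ^ 2 := by
  rw [norm_sq_H1]
  congr 1
  · apply integral_congr_ae
    filter_upwards [fn_ofFun h] with x hx; rw [hx]
  · refine Finset.sum_congr rfl fun i _ => integral_congr_ae ?_
    filter_upwards [grad_ofFun h i] with x hx; rw [hx]

/-- The function part, as an operator `H¹(U) → L²(U)`. -/
def fnL (U : Set R3) : H1 U →L[ℝ] L2 U := (fstL U).comp (H1 U).subtypeL

/-- The `i`-th weak derivative, as an operator `H¹(U) → L²(U)`. -/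
def gradL (U : Set R3) (i : Fin 3) : H1 U →L[ℝ] L2 U := (sndL U i).comp (H1 U).subtypeL

/-- The functional `u ↦ ∫_U (u h + ∂ᵢu k)` on `H¹(U)`. -/
def greenL {U : Set R3} (i : Fin 3) {h k : R3 → ℝ} (hh : MemLp h 2 (volume.restrict U))
    (hk : MemLp k 2 (volume.restrict U)) : H1 U →L[ℝ] ℝ :=
  (pairing hh).comp (fnL U) + (pairing hk).comp (gradL U i)

theorem greenL_apply {U : Set R3} (i : Fin 3) {h k : R3 → ℝ} (hh : MemLp h 2 (volume.restrict U))
    (hk : MemLp k 2 (volume.restrict U)) (u : H1 U) :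
    greenL i hh hk u = ∫ x in U, (fn u x * h x + grad u i x * k x) := by
  have h1 : Integrable (fun x => fn u x * h x) (volume.restrict U) :=
    (hasWeakPd u i).memLp.integrable_mul hh
  have h2 : Integrable (fun x => grad u i x * k x) (volume.restrict U) :=
    (hasWeakPd u i).memLp_pd.integrable_mul hk
  rw [integral_add h1 h2]
  change pairing hh (fnL U u) + pairing hk (gradL U i u) = _
  rw [pairing_apply, pairing_apply]
  rfl

/-! ### Change of variables -/

section Transform
variable {e : R3 ≃ₜ R3} {k σ : ℝ} {i j : Fin 3} {U U' : Set R3}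

theorem IsTest.comp_homeomorph {ψ : R3 → ℝ} (h : IsTest U ψ)
    (he : ContDiff ℝ ((⊤ : ℕ∞) : WithTop ℕ∞) e) (hU : e ⁻¹' U ⊆ U') :
    IsTest U' (fun x => ψ (e x)) := by
  refine ⟨h.1.comp he, h.2.1.comp_homeomorph e, ?_⟩
  have : tsupport (fun x => ψ (e x)) ⊆ e ⁻¹' tsupport ψ :=
    closure_minimal (fun x hx => subset_tsupport _ hx)
      ((isClosed_tsupport ψ).preimage e.continuous)
  exact this.trans ((preimage_mono h.2.2).trans hU)

/-- The hypothesis `hd` allows `e` to exchange coordinate directions as well as to scale or reflect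
them, which covers cell maps, mirrors, translations and face coordinates alike. -/
theorem pd_comp {ψ : R3 → ℝ} (hψ : Differentiable ℝ ψ)
    (he : ContDiff ℝ ((⊤ : ℕ∞) : WithTop ℕ∞) e)
    (hd : ∀ x, fderiv ℝ e x (dir j) = σ • dir i) (x : R3) :
    pd j (fun x => ψ (e x)) x = σ * pd i ψ (e x) := by
  unfold pd
  rw [show (fun x => ψ (e x)) = ψ ∘ e from rfl,
    fderiv_comp x (hψ _) ((he.differentiable (by simp)) x)]
  simp [hd]

theorem integral_comp_homeomorph (hk : Measure.map e volume = ENNReal.ofReal k • volume)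
    (hk0 : 0 < k) (g : R3 → ℝ) : ∫ x, g (e x) = k * ∫ x, g x := by
  rw [← e.measurableEmbedding.integral_map, hk, integral_smul_measure,
    ENNReal.toReal_ofReal hk0.le, smul_eq_mul]

theorem setIntegral_comp_homeomorph (hk : Measure.map e volume = ENNReal.ofReal k • volume)
    (hk0 : 0 < k) (g : R3 → ℝ) : ∫ x in e ⁻¹' U, g (e x) = k * ∫ x in U, g x := by
  rw [← e.measurableEmbedding.setIntegral_map, hk, Measure.restrict_smul, integral_smul_measure,
    ENNReal.toReal_ofReal hk0.le, smul_eq_mul]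

theorem MemLp.comp_homeomorph (hk : Measure.map e volume = ENNReal.ofReal k • volume)
    {f : R3 → ℝ} (hf : MemLp f 2 (volume.restrict U)) (hU : U' ⊆ e ⁻¹' U) :
    MemLp (fun x => f (e x)) 2 (volume.restrict U') := by
  refine MemLp.mono_measure (Measure.restrict_mono hU le_rfl) ?_
  have h1 : MemLp f 2 (Measure.map e (volume.restrict (e ⁻¹' U))) := by
    rw [← e.measurableEmbedding.restrict_map, hk, Measure.restrict_smul]
    exact hf.smul_measure ENNReal.ofReal_ne_top
  exact (e.measurableEmbedding.memLp_map_measure_iff).1 h1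

/-- The test function is transported by `e.symm`; the change of variables puts the same factor `k`
on both sides of the defining identity. -/
theorem HasWeakPd.comp_homeomorph {f d : R3 → ℝ} (h : HasWeakPd U i f d)
    (he : ContDiff ℝ ((⊤ : ℕ∞) : WithTop ℕ∞) e)
    (he' : ContDiff ℝ ((⊤ : ℕ∞) : WithTop ℕ∞) e.symm)
    (hk : Measure.map e volume = ENNReal.ofReal k • volume) (hk0 : 0 < k)
    (hd : ∀ x, fderiv ℝ e x (dir j) = σ • dir i) (hU : U' ⊆ e ⁻¹' U) :
    HasWeakPd U' j (fun x => f (e x)) (fun x => σ * d (e x)) := by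
  refine ⟨MemLp.comp_homeomorph hk h.memLp hU,
    (MemLp.comp_homeomorph hk h.memLp_pd hU).const_mul σ, fun ψ hψ => ?_⟩
  have hψ' : IsTest U (fun x => ψ (e.symm x)) := by
    refine hψ.comp_homeomorph (e := e.symm) he' fun x hx => ?_
    have := hU hx
    simpa using this
  have hpd : ∀ x, pd j ψ x = σ * pd i (fun x => ψ (e.symm x)) (e x) := fun x => by
    rw [← pd_comp hψ'.differentiable he hd]
    simp
  have hval : ∀ x, ψ x = (fun x => ψ (e.symm x)) (e x) := fun x => by simp
  rw [setIntegral_mul_eq fun x hx => hψ.pd_eq_zero j hx,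
    setIntegral_mul_eq fun x hx => hψ.eq_zero hx]
  have h1 : ∫ x, f (e x) * pd j ψ x = σ * (k * ∫ x in U, f x * pd i (fun x => ψ (e.symm x)) x) := by
    rw [setIntegral_mul_eq fun x hx => hψ'.pd_eq_zero i hx, ← integral_comp_homeomorph hk hk0,
      ← integral_const_mul]
    congr 1 with x
    rw [hpd x]; ring
  have h2 : ∫ x, σ * d (e x) * ψ x = σ * (k * ∫ x in U, d x * ψ (e.symm x)) := by
    rw [setIntegral_mul_eq fun x hx => hψ'.eq_zero hx, ← integral_comp_homeomorph hk hk0,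
      ← integral_const_mul]
    congr 1 with x
    simp only [Homeomorph.symm_apply_apply]; ring
  rw [h1, h2, h.integral_eq _ hψ']
  ring

end Transform

/-! ### Coordinate-wise affine maps -/

/-- The homeomorphism `t ↦ c + s t` of the line. -/
def affLine (c s : ℝ) (hs : s ≠ 0) : ℝ ≃ₜ ℝ :=
  (Homeomorph.mulLeft₀ s hs).trans (Homeomorph.addLeft c)

theorem map_affLine (c s : ℝ) (hs : s ≠ 0) :
    Measure.map (affLine c s hs) volume = ENNReal.ofReal |s⁻¹| • volume := by
  have : (affLine c s hs : ℝ → ℝ) = (fun t => c + t) ∘ (fun t => s * t) := rfl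
  rw [this, ← Measure.map_map (by fun_prop) (by fun_prop), Real.map_volume_mul_left hs,
    Measure.map_smul, map_add_left_eq_self]

/-- The homeomorphism `x ↦ (c₁ + s₁ x₁, c₂ + s₂ x₂, c₃ + s₃ x₃)` of the space. -/
def aff (c s : Fin 3 → ℝ) (hs : ∀ i, s i ≠ 0) : R3 ≃ₜ R3 :=
  ((affLine (c 0) (s 0) (hs 0)).prodCongr (affLine (c 1) (s 1) (hs 1))).prodCongr
    (affLine (c 2) (s 2) (hs 2))

theorem aff_apply (c s : Fin 3 → ℝ) (hs : ∀ i, s i ≠ 0) (x : R3) :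
    aff c s hs x = ((c 0 + s 0 * x.1.1, c 1 + s 1 * x.1.2), c 2 + s 2 * x.2) := rfl

theorem map_aff (c s : Fin 3 → ℝ) (hs : ∀ i, s i ≠ 0) :
    Measure.map (aff c s hs) volume = ENNReal.ofReal (|(s 0)⁻¹| * |(s 1)⁻¹| * |(s 2)⁻¹|) • volume := by
  have h1 : (aff c s hs : R3 → R3) = Prod.map (Prod.map (affLine (c 0) (s 0) (hs 0))
    (affLine (c 1) (s 1) (hs 1))) (affLine (c 2) (s 2) (hs 2)) := rfl
  have m : ∀ c s : ℝ, ∀ hs : s ≠ 0, Measurable (affLine c s hs) := fun c s hs =>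
    (affLine c s hs).continuous.measurable
  have f : ∀ c s : ℝ, ∀ hs : s ≠ 0, SFinite (Measure.map (affLine c s hs) volume) := by
    intro c s hs; infer_instance
  rw [h1, Measure.volume_eq_prod R2 ℝ, ← Measure.map_prod_map _ _ ((m _ _ _).prodMap (m _ _ _)) (m _ _ _),
    Measure.volume_eq_prod ℝ ℝ, ← Measure.map_prod_map _ _ (m _ _ _) (m _ _ _), map_affLine, map_affLine,
    map_affLine, Measure.prod_smul_left, Measure.prod_smul_right, Measure.prod_smul_right,
    Measure.prod_smul_left, Measure.prod_smul_left, smul_smul, smul_smul,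
    ENNReal.ofReal_mul (by positivity), ENNReal.ofReal_mul (by positivity)]
  congr 1
  ring

theorem contDiff_aff (c s : Fin 3 → ℝ) (hs : ∀ i, s i ≠ 0) :
    ContDiff ℝ ((⊤ : ℕ∞) : WithTop ℕ∞) (aff c s hs) := by
  have : (aff c s hs : R3 → R3) =
    fun x => ((c 0 + s 0 * x.1.1, c 1 + s 1 * x.1.2), c 2 + s 2 * x.2) := rfl
  rw [this]
  fun_prop

theorem contDiff_aff_symm (c s : Fin 3 → ℝ) (hs : ∀ i, s i ≠ 0) :
    ContDiff ℝ ((⊤ : ℕ∞) : WithTop ℕ∞) (aff c s hs).symm := by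
  have : ((aff c s hs).symm : R3 → R3) = fun x =>
    (((s 0)⁻¹ * (-c 0 + x.1.1), (s 1)⁻¹ * (-c 1 + x.1.2)), (s 2)⁻¹ * (-c 2 + x.2)) := rfl
  rw [this]
  fun_prop

theorem fderiv_aff (c s : Fin 3 → ℝ) (hs : ∀ i, s i ≠ 0) (i : Fin 3) (x : R3) :
    fderiv ℝ (aff c s hs) x (dir i) = s i • dir i := by
  have h1 : ∀ x : R3, HasDerivAt (fun t : ℝ => aff c s hs (x + t • dir i)) (s i • dir i) 0 := by
    intro x
    simp only [aff_apply]
    have hl : ∀ a b y v : ℝ, HasDerivAt (fun t : ℝ => a + b * (y + t * v)) (b * v) 0 := by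
      intro a b y v
      have := (((hasDerivAt_id (0 : ℝ)).mul_const v).const_add y).const_mul b |>.const_add a
      simpa using this
    have := ((hl (c 0) (s 0) x.1.1 (dir i).1.1).prodMk
      (hl (c 1) (s 1) x.1.2 (dir i).1.2)).prodMk (hl (c 2) (s 2) x.2 (dir i).2)
    have he : s i • dir i = ((s 0 * (dir i).1.1, s 1 * (dir i).1.2), s 2 * (dir i).2) := by
      fin_cases i <;> simp [dir]
    rw [he]
    exact this
  have hd : DifferentiableAt ℝ (aff c s hs) x := (contDiff_aff c s hs).differentiable (by simp) x
  have h2 := hd.hasFDerivAt.comp_hasDerivAt_of_eq (0 : ℝ)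
    (((hasDerivAt_id (0 : ℝ)).smul_const (dir i)).const_add x) (by simp)
  have h3 := h2.unique (h1 x)
  simpa using h3

theorem HasWeakPd.comp_aff {U U' : Set R3} {f d : R3 → ℝ} {i : Fin 3} (h : HasWeakPd U i f d)
    (c s : Fin 3 → ℝ) (hs : ∀ i, s i ≠ 0) (hU : U' ⊆ aff c s hs ⁻¹' U) :
    HasWeakPd U' i (fun x => f (aff c s hs x)) (fun x => s i * d (aff c s hs x)) :=
  h.comp_homeomorph (contDiff_aff c s hs) (contDiff_aff_symm c s hs) (map_aff c s hs)
    (by have := hs 0; have := hs 1; have := hs 2; positivity) (fderiv_aff c s hs i) hU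

/-! ### Test functions that do not vanish near a flat face -/

/-- The cut-off `1` for `t ≤ b - 1/(2k)` and `0` for `t ≥ b - 1/(4k)`. -/
def cut (b : ℝ) (k : ℕ) (t : ℝ) : ℝ := step (k * (b - t) - 1)

theorem contDiff_cut (b : ℝ) (k : ℕ) : ContDiff ℝ ((⊤ : ℕ∞) : WithTop ℕ∞) (cut b k) :=
  contDiff_step.comp ((contDiff_const.mul (contDiff_const.sub contDiff_id)).sub contDiff_const)

theorem deriv_cut (b : ℝ) (k : ℕ) (t : ℝ) :
    deriv (cut b k) t = -(k * deriv step (k * (b - t) - 1)) := by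
  have h1 : HasDerivAt (fun t : ℝ => (k : ℝ) * (b - t) - 1) (-(k : ℝ)) t := by
    have := (((hasDerivAt_id t).const_sub b).const_mul (k : ℝ)).sub_const 1
    simpa using this
  have h2 : HasDerivAt step (deriv step (k * (b - t) - 1)) (k * (b - t) - 1) :=
    (contDiff_step.differentiable (by simp) _).hasDerivAt
  have := (h2.comp t h1).deriv
  rw [show cut b k = step ∘ fun t : ℝ => (k : ℝ) * (b - t) - 1 from rfl, this]
  ring

theorem cut_eventually {b t : ℝ} (ht : t < b) :
    ∀ᶠ k : ℕ in atTop, cut b k t = 1 ∧ deriv (cut b k) t = 0 := by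
  obtain ⟨N, hN⟩ := exists_nat_gt (1 / (b - t))
  filter_upwards [eventually_ge_atTop N] with k hk
  have hpos : 0 < b - t := sub_pos.2 ht
  have h1 : 1 < (k : ℝ) * (b - t) := by
    rw [div_lt_iff₀ hpos] at hN
    have : (N : ℝ) ≤ k := by exact_mod_cast hk
    nlinarith
  refine ⟨step_eq_one (by linarith), ?_⟩
  rw [deriv_cut, deriv_step_eq_zero_of_gt (by linarith)]
  simp

theorem dir_snd_eq_zero {i : Fin 3} (h : i ≠ 2) : (dir i).2 = 0 := by
  fin_cases i <;> simp_all [dir]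

theorem abs_dir_snd_le (i : Fin 3) : |(dir i).2| ≤ 1 := by
  fin_cases i <;> simp [dir]

/-- Where the cut-off does not vanish, `k (b - x₃) ≥ 1/4`, a closed condition that keeps the support
strictly below the face. For `k = 0` the product is zero. -/
theorem IsTest.mul_cut {S : Set R2} {a b : ℝ} {ψ : R3 → ℝ} (hψ : IsTest (S ×ˢ Ioi a) ψ) (k : ℕ) :
    IsTest (S ×ˢ Ioo a b) (fun x => ψ x * cut b k x.2) := by
  refine ⟨hψ.1.mul ((contDiff_cut b k).comp contDiff_snd), hψ.2.1.mul_right, ?_⟩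
  have h1 : tsupport (fun x : R3 => ψ x * cut b k x.2) ⊆
      tsupport ψ ∩ {x | 1 / 4 ≤ k * (b - x.2)} := by
    refine closure_minimal ?_ ((isClosed_tsupport ψ).inter
      (isClosed_le continuous_const (by fun_prop)))
    intro x hx
    obtain ⟨hx1, hx2⟩ := mul_ne_zero_iff.1 hx
    refine ⟨subset_tsupport _ hx1, ?_⟩
    by_contra hlt
    apply hx2
    have : ¬ (1 / 4 ≤ k * (b - x.2)) := hlt
    exact step_eq_zero (by linarith)
  intro x hx
  obtain ⟨hx1, hx2⟩ := h1 hx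
  have hx3 := hψ.2.2 hx1
  refine ⟨hx3.1, hx3.2, ?_⟩
  have hx2' : 1 / 4 ≤ (k : ℝ) * (b - x.2) := hx2
  have : 0 < (b - x.2) := by
    by_contra hn
    have := mul_nonpos_of_nonneg_of_nonpos (Nat.cast_nonneg (α := ℝ) k) (not_lt.1 hn)
    linarith
  linarith

/-- The defining identity of the weak derivative for a test function that need not vanish near
the face `x₃ = b`, if the direction is tangential or the test function vanishes on the face. -/
theorem HasWeakPd.integral_eq_of_face {S : Set R2} (hS : MeasurableSet S) {a b : ℝ} {i : Fin 3}
    {f d : R3 → ℝ} (h : HasWeakPd (S ×ˢ Ioo a b) i f d) {ψ : R3 → ℝ}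
    (hψ : IsTest (S ×ˢ Ioi a) ψ) (hface : i ≠ 2 ∨ ∀ z, ψ (z, b) = 0) :
    ∫ x in S ×ˢ Ioo a b, f x * pd i ψ x = - ∫ x in S ×ˢ Ioo a b, d x * ψ x := by
  set D : Set R3 := S ×ˢ Ioo a b with hD
  have hDm : MeasurableSet D := hS.prod measurableSet_Ioo
  have hcd : ∀ k, Differentiable ℝ (cut b k) := fun k => (contDiff_cut b k).differentiable (by simp)
  have hcd' : ∀ k, Differentiable ℝ (fun x : R3 => cut b k x.2) := fun k =>
    (hcd k).comp differentiable_snd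
  have hpd : ∀ k x, pd i (fun x => ψ x * cut b k x.2) x =
      pd i ψ x * cut b k x.2 + ψ x * ((dir i).2 * deriv (cut b k) x.2) := fun k x => by
    rw [pd_mul hψ.differentiable (hcd' k), pd_comp_snd (hcd k)]
  -- the uniform bound
  have hbound : ∃ C, 0 ≤ C ∧ ∀ k x, |ψ x * ((dir i).2 * deriv (cut b k) x.2)| ≤ C := by
    rcases hface with hi | hz
    · exact ⟨0, le_rfl, fun k x => by simp [dir_snd_eq_zero hi]⟩
    · obtain ⟨M, hM0, hM⟩ := exists_bound_deriv_step
      -- The derivative of the cut-off is of size `k`, but only where `|b - x₃| ≤ 1/k`. There a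
      -- Lipschitz `ψ` vanishing on the face is at most `K/k`, so the product stays bounded by `K *
      -- M`.
      obtain ⟨K, hK⟩ := hψ.1.lipschitzWith_of_hasCompactSupport hψ.2.1 (by simp)
      refine ⟨K * M, by positivity, fun k x => ?_⟩
      have h1 : |ψ x| ≤ K * |b - x.2| := by
        have := hK.dist_le_mul x (x.1, b)
        rw [hz, dist_zero_right, Real.norm_eq_abs] at this
        refine this.trans (le_of_eq ?_)
        rw [Prod.dist_eq, dist_self, Real.dist_eq, max_eq_right (abs_nonneg _), abs_sub_comm]
      rw [deriv_cut, abs_mul, abs_mul, abs_neg, abs_mul, Nat.abs_cast]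
      by_cases hr : (k : ℝ) * (b - x.2) - 1 ∈ Icc (-3 / 4 : ℝ) (-1 / 2)
      · have h2 : (k : ℝ) * |b - x.2| ≤ 1 := by
          rw [← Nat.abs_cast k, ← abs_mul, abs_le]
          constructor <;> linarith [hr.1, hr.2]
        calc |ψ x| * (|(dir i).2| * (k * |deriv step (k * (b - x.2) - 1)|))
            ≤ (K * |b - x.2|) * (1 * (k * M)) := by
              gcongr
              · exact abs_dir_snd_le i
              · exact hM _
          _ = (K * M) * (k * |b - x.2|) := by ring
          _ ≤ (K * M) * 1 := by gcongr
          _ = K * M := mul_one _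
      · have : deriv step (k * (b - x.2) - 1) = 0 := by
          rw [mem_Icc, not_and_or, not_le, not_le] at hr
          rcases hr with hr | hr
          · exact deriv_step_eq_zero_of_lt hr
          · exact deriv_step_eq_zero_of_gt hr
        rw [this]
        simp only [abs_zero, mul_zero]
        positivity
  obtain ⟨C, hC0, hC⟩ := hbound
  have hlimL : Tendsto (fun k : ℕ => ∫ x in D, f x * pd i (fun x => ψ x * cut b k x.2) x) atTop
      (𝓝 (∫ x in D, f x * pd i ψ x)) := by
    refine tendsto_integral_of_dominated_convergence
      (fun x => |f x| * (|pd i ψ x| + (tsupport ψ).indicator (fun _ => C) x)) ?_ ?_ ?_ ?_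
    · intro k
      exact h.memLp.1.mul ((hψ.mul_cut k (b := b)).continuous_pd i).aestronglyMeasurable
    · refine h.memLp.abs.integrable_mul (q := 2) (MemLp.add (hψ.memLp_pd i D).abs ?_)
      refine memLp_indicator_const 2 (isClosed_tsupport ψ).measurableSet C (Or.inr ?_)
      exact ((Measure.restrict_apply_le _ _).trans_lt hψ.2.1.isCompact.measure_lt_top).ne
    · intro k
      refine Eventually.of_forall fun x => ?_
      rw [Real.norm_eq_abs, abs_mul, hpd]
      refine mul_le_mul_of_nonneg_left ?_ (abs_nonneg _)
      refine (abs_add_le _ _).trans (add_le_add ?_ ?_)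
      · rw [abs_mul]
        refine mul_le_of_le_one_right (abs_nonneg _) ?_
        rw [cut, abs_of_nonneg (step_nonneg _)]
        exact step_le_one _
      · by_cases hx : x ∈ tsupport ψ
        · rw [indicator_of_mem hx]; exact hC k x
        · rw [indicator_of_notMem hx, image_eq_zero_of_notMem_tsupport hx]; simp
    · refine (ae_restrict_iff' hDm).2 (Eventually.of_forall fun x hx => ?_)
      refine tendsto_const_nhds.congr' ?_
      filter_upwards [cut_eventually hx.2.2] with k hk
      rw [hpd, hk.1, hk.2]; ring
  have hlimR : Tendsto (fun k : ℕ => ∫ x in D, d x * (ψ x * cut b k x.2)) atTop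
      (𝓝 (∫ x in D, d x * ψ x)) := by
    refine tendsto_integral_of_dominated_convergence (fun x => |d x| * |ψ x|) ?_ ?_ ?_ ?_
    · intro k
      exact h.memLp_pd.1.mul (hψ.mul_cut k (b := b)).continuous.aestronglyMeasurable
    · exact h.memLp_pd.abs.integrable_mul (q := 2) (hψ.memLp D).abs
    · intro k
      refine Eventually.of_forall fun x => ?_
      rw [Real.norm_eq_abs, abs_mul, abs_mul]
      refine mul_le_mul_of_nonneg_left ?_ (abs_nonneg _)
      refine mul_le_of_le_one_right (abs_nonneg _) ?_
      rw [cut, abs_of_nonneg (step_nonneg _)]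
      exact step_le_one _
    · refine (ae_restrict_iff' hDm).2 (Eventually.of_forall fun x hx => ?_)
      refine tendsto_const_nhds.congr' ?_
      filter_upwards [cut_eventually hx.2.2] with k hk
      rw [hk.1, mul_one]
  refine tendsto_nhds_unique hlimL (hlimR.neg.congr fun k => ?_)
  exact (h.integral_eq _ (hψ.mul_cut k)).symm

/-! ### Traces -/

theorem pd_mul_fst_snd {κ : R2 → ℝ} {η : ℝ → ℝ} (hκ : Differentiable ℝ κ) (hη : Differentiable ℝ η)
    (i : Fin 3) (x : R3) : pd i (fun x => κ x.1 * η x.2) x =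
      fderiv ℝ κ x.1 (dir i).1 * η x.2 + κ x.1 * ((dir i).2 * deriv η x.2) := by
  rw [pd_mul (ψ := fun x : R3 => κ x.1) (χ := fun x : R3 => η x.2) (hκ.comp differentiable_fst)
    (hη.comp differentiable_snd), pd_comp_fst hκ, pd_comp_snd hη]

/-- A smooth bump, `1` for `|t| ≤ 1/2` and `0` for `|t| ≥ 3/4`. -/
def bump (t : ℝ) : ℝ := step t * step (-t)

theorem contDiff_bump : ContDiff ℝ ((⊤ : ℕ∞) : WithTop ℕ∞) bump :=
  contDiff_step.mul (contDiff_step.comp contDiff_neg)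

theorem tsupport_bump : tsupport bump ⊆ Icc (-3 / 4) (3 / 4) := by
  refine closure_minimal ?_ isClosed_Icc
  intro t ht
  obtain ⟨h1, h2⟩ := mul_ne_zero_iff.1 ht
  constructor
  · by_contra h; exact h1 (step_eq_zero (by linarith))
  · by_contra h; exact h2 (step_eq_zero (by linarith))

theorem bump_eq_one {t : ℝ} (h : |t| ≤ 1 / 2) : bump t = 1 := by
  have := abs_le.1 h
  rw [bump, step_eq_one (by linarith), step_eq_one (by linarith), mul_one]

/-- The bump rescaled to the interval `(b - l, b + l)`. -/
def bumpAt (b l t : ℝ) : ℝ := bump ((t - b) / l)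

theorem contDiff_bumpAt (b l : ℝ) : ContDiff ℝ ((⊤ : ℕ∞) : WithTop ℕ∞) (bumpAt b l) :=
  contDiff_bump.comp ((contDiff_id.sub contDiff_const).div_const l)

theorem tsupport_bumpAt (b : ℝ) {l : ℝ} (hl : 0 < l) :
    tsupport (bumpAt b l) ⊆ Icc (b - 3 / 4 * l) (b + 3 / 4 * l) := by
  refine closure_minimal ?_ isClosed_Icc
  intro t ht
  have h := tsupport_bump (subset_tsupport _ (show bump ((t - b) / l) ≠ 0 from ht))
  rw [mem_Icc, div_le_iff₀ hl, le_div_iff₀ hl] at h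
  constructor <;> linarith [h.1, h.2]

theorem hasCompactSupport_bumpAt (b : ℝ) {l : ℝ} (hl : 0 < l) : HasCompactSupport (bumpAt b l) :=
  isCompact_Icc.of_isClosed_subset (isClosed_tsupport _) (tsupport_bumpAt b hl)

theorem bumpAt_self (b l : ℝ) : bumpAt b l b = 1 := by
  rw [bumpAt, sub_self, zero_div, bump_eq_one (by simp)]

theorem volume_restrict_prod (S : Set R2) (J : Set ℝ) :
    (volume : Measure R3).restrict (S ×ˢ J) = (volume.restrict S).prod (volume.restrict J) := by
  rw [Measure.prod_restrict]; rfl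

/-- Cauchy–Schwarz against the constant 1 on each fibre, which has finite measure. -/
theorem memLp_integral_right {X Z : Type*} [MeasurableSpace X] [MeasurableSpace Z] {μ : Measure X}
    {ν : Measure Z} [SFinite μ] [IsFiniteMeasure ν] {F : X × Z → ℝ} (hF : MemLp F 2 (μ.prod ν)) :
    MemLp (fun x => ∫ z, F (x, z) ∂ν) 2 μ := by
  have hm : AEStronglyMeasurable (fun x => ∫ z, F (x, z) ∂ν) μ := hF.1.integral_prod_right'
  rw [memLp_two_iff_integrable_sq hm]
  have hsq := hF.integrable_sq
  refine Integrable.mono' ((hsq.integral_prod_left).const_mul (ν.real univ)) (hm.pow 2) ?_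
  have h1 : ∀ᵐ x ∂μ, AEStronglyMeasurable (fun z => F (x, z)) ν := hF.1.prodMk_left
  filter_upwards [hsq.prod_right_ae, h1] with x hx hx'
  have hL : MemLp (fun z => F (x, z)) 2 ν := (memLp_two_iff_integrable_sq hx').2 hx
  have h2 := sq_integral_mul_le (f := fun _ : Z => (1 : ℝ)) (memLp_const 1) hL
  simp only [one_mul, one_pow, integral_const, smul_eq_mul, mul_one] at h2
  rw [Real.norm_eq_abs, abs_of_nonneg (sq_nonneg _)]
  exact h2

theorem IsTest.comp_face {S : Set R2} {J : Set ℝ} {ψ : R3 → ℝ} (hψ : IsTest (S ×ˢ J) ψ) (b : ℝ) :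
    IsTest2 S (fun z => ψ (z, b)) := by
  have hc : Continuous (fun z : R2 => ((z, b) : R3)) := by fun_prop
  have hsub : tsupport (fun z => ψ (z, b)) ⊆ (fun z : R2 => ((z, b) : R3)) ⁻¹' tsupport ψ :=
    closure_minimal (fun z hz => subset_tsupport _ hz) ((isClosed_tsupport ψ).preimage hc)
  refine ⟨hψ.1.comp (contDiff_id.prodMk contDiff_const), ?_, fun z hz => (hψ.2.2 (hsub hz)).1⟩
  refine (hψ.2.1.isCompact.image continuous_fst).of_isClosed_subset (isClosed_tsupport _) ?_
  intro z hz
  exact ⟨(z, b), hsub hz, rfl⟩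

theorem memLp_mul_bdd {X : Type*} [MeasurableSpace X] [TopologicalSpace X]
    [OpensMeasurableSpace X] {μ : Measure X} {f g : X → ℝ} (hf : MemLp f 2 μ)
    (hg : Continuous g) {C : ℝ} (hC : ∀ x, |g x| ≤ C) : MemLp (fun x => f x * g x) 2 μ := by
  refine MemLp.of_le_mul (c := C) hf (hf.1.mul hg.aestronglyMeasurable)
    (Eventually.of_forall fun x => ?_)
  rw [norm_mul, mul_comm]
  exact mul_le_mul_of_nonneg_right (hC x) (norm_nonneg _)

/-- A function of `S × (a, b)` with a weak derivative in `L²` in the direction `e₃` has a trace on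
the face `x₃ = b`. -/
theorem HasWeakPd.exists_trace {S : Set R2} (hS : MeasurableSet S) {a b : ℝ} (hab : a < b)
    {f d : R3 → ℝ} (h : HasWeakPd (S ×ˢ Ioo a b) 2 f d) :
    ∃ g : R2 → ℝ, MemLp g 2 (volume.restrict S) ∧ ∀ ψ : R3 → ℝ, IsTest (S ×ˢ Ioi a) ψ →
      ∫ x in S ×ˢ Ioo a b, (f x * pd 2 ψ x + d x * ψ x) = ∫ z in S, g z * ψ (z, b) := by
  have hl : 0 < b - a := sub_pos.2 hab
  set η := bumpAt b (b - a) with hη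
  have hηd : Differentiable ℝ η := (contDiff_bumpAt b (b - a)).differentiable (by simp)
  have hηc : Continuous (deriv η) :=
    (contDiff_infty_iff_deriv.1 (contDiff_bumpAt b (b - a))).2.continuous
  obtain ⟨C1, hC1⟩ := (hasCompactSupport_bumpAt b hl).exists_bound_of_continuous
    hηd.continuous
  obtain ⟨C2, hC2⟩ := (hasCompactSupport_bumpAt b hl).deriv.exists_bound_of_continuous hηc
  -- `F` is formally `∂₃(f η)`, where `η` is 1 at `b` and vanishes near `a`. Its integral along the
  -- vertical fibres is therefore the boundary value of `f` at `b`, and it serves as the trace.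
  set F : R3 → ℝ := fun x => f x * deriv η x.2 + d x * η x.2 with hF
  have hFL : MemLp F 2 ((volume.restrict S).prod (volume.restrict (Ioo a b))) := by
    rw [← volume_restrict_prod]
    exact (memLp_mul_bdd h.memLp (hηc.comp continuous_snd) fun x => hC2 _).add
      (memLp_mul_bdd h.memLp_pd (hηd.continuous.comp continuous_snd) fun x => hC1 _)
  have : IsFiniteMeasure ((volume : Measure ℝ).restrict (Ioo a b)) := ⟨by simp⟩
  refine ⟨fun z => ∫ t in Ioo a b, F (z, t), memLp_integral_right hFL, fun ψ hψ => ?_⟩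
  have hκ := hψ.comp_face b
  set κ : R2 → ℝ := fun z => ψ (z, b) with hκd
  have hχ0 : IsTest (S ×ˢ Ioi a) (fun x => κ x.1 * η x.2) :=
    hκ.mul_snd (contDiff_bumpAt b (b - a)) (hasCompactSupport_bumpAt b hl) fun t ht => by
      have := (tsupport_bumpAt b hl ht).1
      simp only [mem_Ioi]; linarith
  -- The difference `ψ - κ η` vanishes on the face, so its Green integral is zero; the Green
  -- integral of `ψ` equals that of `κ η`, which depends only on the values of `ψ` on the face.
  have hχ := hψ.add (hχ0.const_mul (-1))
  have h0 := h.integral_eq_of_face hS hχ (Or.inr fun z => by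
    simp only [hη, bumpAt_self, hκd]; ring)
  have hpdχ0 : ∀ x : R3, pd 2 (fun x => κ x.1 * η x.2) x = κ x.1 * deriv η x.2 := fun x => by
    rw [pd_mul_fst_snd hκ.differentiable hηd, show (dir 2) = ((0 : R2), (1 : ℝ)) from rfl,
      map_zero]
    ring
  have i1 := h.integrable_mul hψ 2
  have i2 := h.integrable_mul hχ0 2
  have e1 : ∫ x in S ×ˢ Ioo a b, f x * pd 2 (fun x => ψ x + -1 * (κ x.1 * η x.2)) x =
      (∫ x in S ×ˢ Ioo a b, f x * pd 2 ψ x) -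
        ∫ x in S ×ˢ Ioo a b, f x * pd 2 (fun x => κ x.1 * η x.2) x := by
    rw [← integral_sub i1.1 i2.1]
    congr 1 with x
    rw [pd_add hψ.differentiable (hχ0.const_mul (-1)).differentiable,
      pd_const_mul hχ0.differentiable]
    ring
  have e2 : ∫ x in S ×ˢ Ioo a b, d x * (ψ x + -1 * (κ x.1 * η x.2)) =
      (∫ x in S ×ˢ Ioo a b, d x * ψ x) - ∫ x in S ×ˢ Ioo a b, d x * (κ x.1 * η x.2) := by
    rw [← integral_sub i1.2 i2.2]
    congr 1 with x
    ring
  rw [e1, e2] at h0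
  rw [integral_add i1.1 i1.2]
  have e3 : ∫ x in S ×ˢ Ioo a b, F x * κ x.1 =
      (∫ x in S ×ˢ Ioo a b, f x * pd 2 (fun x => κ x.1 * η x.2) x) +
        ∫ x in S ×ˢ Ioo a b, d x * (κ x.1 * η x.2) := by
    rw [← integral_add i2.1 i2.2]
    congr 1 with x
    rw [hpdχ0]
    simp only [hF]; ring
  have i3 : Integrable (fun x : R3 => F x * κ x.1)
      ((volume.restrict S).prod (volume.restrict (Ioo a b))) := by
    rw [← volume_restrict_prod]
    refine (i2.1.add i2.2).congr (Eventually.of_forall fun x => ?_)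
    simp only [Pi.add_apply, hpdχ0, hF]; ring
  have e4 : ∫ x in S ×ˢ Ioo a b, F x * κ x.1 = ∫ z in S, (∫ t in Ioo a b, F (z, t)) * κ z := by
    rw [volume_restrict_prod, integral_prod _ i3]
    congr 1 with z
    exact integral_mul_const (κ z) fun t => F (z, t)
  linarith

/-- Existence of traces on flat faces, in any coordinates in which the domain is a cylinder. -/
theorem exists_isFaceTrace {e : R3 ≃ₜ R3} {σ : ℝ} {i : Fin 3} {U W : Set R3} {S : Set R2}
    (hS : MeasurableSet S) {a b : ℝ} (hab : a < b)
    (he : ContDiff ℝ ((⊤ : ℕ∞) : WithTop ℕ∞) e)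
    (he' : ContDiff ℝ ((⊤ : ℕ∞) : WithTop ℕ∞) e.symm) (hm : Measure.map e volume = volume)
    (hd : ∀ x, fderiv ℝ e x (dir 2) = σ • dir i) (hσ : σ * σ = 1)
    (hU : e ⁻¹' U = S ×ˢ Ioo a b) (hW : e ⁻¹' W = S ×ˢ Ioi a) (u : H1 U) :
    ∃ g : R2 → ℝ, IsFaceTrace W i σ S (fun z => e (z, b)) u g := by
  have hk : Measure.map e volume = ENNReal.ofReal 1 • volume := by simpa using hm
  have h := (hasWeakPd u i).comp_homeomorph he he' hk one_pos hd hU.ge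
  obtain ⟨g, hg, hgr⟩ := h.exists_trace hS hab
  refine ⟨g, hg, fun ψ hψ => ?_⟩
  rw [← hgr _ (hψ.comp_homeomorph he hW.le), ← one_mul (∫ x in U, _),
    ← setIntegral_comp_homeomorph hk one_pos, hU, ← integral_const_mul]
  congr 1 with x
  rw [pd_comp hψ.differentiable he hd]
  linear_combination (-(fn u (e x) * pd i ψ (e x) + grad u i (e x) * ψ (e x))) * hσ

/-! ### Cutting a cylinder by a plane -/

theorem restrict_prod_Ioo_add {S : Set R2} {a b c : ℝ} (hab : a < b) (hbc : b < c) :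
    (volume : Measure R3).restrict (S ×ˢ Ioo a c) =
      volume.restrict (S ×ˢ Ioo a b) + volume.restrict (S ×ˢ Ioo b c) := by
  rw [volume_restrict_prod, volume_restrict_prod, volume_restrict_prod, ← Measure.prod_add]
  congr 1
  rw [Measure.restrict_congr_set (Ioo_ae_eq_Ioc (a := a) (b := b)),
    ← Measure.restrict_union (by
      rw [Set.disjoint_left]; rintro x ⟨-, h1⟩ ⟨h2, -⟩; linarith) measurableSet_Ioo,
    Ioc_union_Ioo_eq_Ioo hab.le hbc]

theorem memLp_add_measure {X : Type*} [MeasurableSpace X] {μ ν : Measure X} {f : X → ℝ}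
    (h1 : MemLp f 2 μ) (h2 : MemLp f 2 ν) : MemLp f 2 (μ + ν) := by
  have hm : AEStronglyMeasurable f (μ + ν) := h1.1.add_measure h2.1
  rw [memLp_two_iff_integrable_sq hm]
  exact h1.integrable_sq.add_measure h2.integrable_sq

theorem setIntegral_prod_Ioo_add {S : Set R2} {a b c : ℝ} (hab : a < b) (hbc : b < c) {G : R3 → ℝ}
    (hG : Integrable G (volume.restrict (S ×ˢ Ioo a c))) :
    ∫ x in S ×ˢ Ioo a c, G x = (∫ x in S ×ˢ Ioo a b, G x) + ∫ x in S ×ˢ Ioo b c, G x := by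
  rw [restrict_prod_Ioo_add hab hbc] at hG ⊢
  rw [integrable_add_measure] at hG
  exact integral_add_measure hG.1 hG.2

/-! ### Extension by reflection -/

/-- The sign of the `i`-th derivative under the reflection `x₃ ↦ 2b - x₃`. -/
def mirrorSign : Fin 3 → ℝ := ![1, 1, -1]

theorem mirrorSign_ne (i : Fin 3) : mirrorSign i ≠ 0 := by
  fin_cases i <;> simp [mirrorSign]

theorem mirrorSign_sq (i : Fin 3) : mirrorSign i * mirrorSign i = 1 := by
  fin_cases i <;> simp [mirrorSign]

/-- The reflection `x₃ ↦ c - x₃`. -/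
def mirror (c : ℝ) : R3 ≃ₜ R3 := aff ![0, 0, c] mirrorSign mirrorSign_ne

theorem mirror_apply (c : ℝ) (x : R3) : mirror c x = (x.1, c - x.2) := by
  simp [mirror, aff_apply, mirrorSign, sub_eq_add_neg]

theorem mirror_mirror (c : ℝ) (x : R3) : mirror c (mirror c x) = x := by
  simp [mirror_apply]

theorem map_mirror (c : ℝ) : Measure.map (mirror c) volume = ENNReal.ofReal 1 • volume := by
  rw [mirror, map_aff]; simp [mirrorSign]

theorem preimage_mirror (c : ℝ) (S : Set R2) (a b : ℝ) :
    mirror c ⁻¹' (S ×ˢ Ioo a b) = S ×ˢ Ioo (c - b) (c - a) := by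
  ext x
  simp only [mirror_apply, mem_preimage, mem_prod, mem_Ioo]
  constructor <;> rintro ⟨h1, h2, h3⟩ <;> refine ⟨h1, ?_, ?_⟩ <;> linarith

/-- The reflection of the `i`-th derivative of a function, across the plane `x₃ = b`. -/
def reflectPd (b : ℝ) (i : Fin 3) (d : R3 → ℝ) (x : R3) : ℝ :=
  if x.2 ≤ b then d x else mirrorSign i * d (x.1, 2 * b - x.2)

theorem ae_reflect {S : Set R2} (hS : MeasurableSet S) (s : ℝ) (a b c : ℝ) (d : R3 → ℝ) :
    (fun x : R3 => if x.2 ≤ b then d x else s * d (x.1, 2 * b - x.2))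
      =ᵐ[volume.restrict (S ×ˢ Ioo a b)] d ∧
    (fun x : R3 => if x.2 ≤ b then d x else s * d (x.1, 2 * b - x.2))
      =ᵐ[volume.restrict (S ×ˢ Ioo b c)] fun x => s * d (mirror (2 * b) x) := by
  constructor
  · filter_upwards [ae_restrict_mem (hS.prod measurableSet_Ioo)] with x hx
    rw [if_pos hx.2.2.le]
  · filter_upwards [ae_restrict_mem (hS.prod measurableSet_Ioo)] with x hx
    rw [if_neg (not_le.2 hx.2.1), mirror_apply]

theorem memLp_reflect {S : Set R2} (hS : MeasurableSet S) (s : ℝ) {a b : ℝ} (hab : a < b)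
    {d : R3 → ℝ} (hd : MemLp d 2 (volume.restrict (S ×ˢ Ioo a b))) :
    MemLp (fun x : R3 => if x.2 ≤ b then d x else s * d (x.1, 2 * b - x.2)) 2
      (volume.restrict (S ×ˢ Ioo a (2 * b - a))) := by
  rw [restrict_prod_Ioo_add hab (by linarith : b < 2 * b - a)]
  obtain ⟨h1, h2⟩ := ae_reflect hS s a b (2 * b - a) d
  refine memLp_add_measure (hd.ae_eq h1.symm) (MemLp.ae_eq h2.symm (MemLp.const_mul ?_ s))
  refine MemLp.comp_homeomorph (map_mirror (2 * b)) hd ?_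
  rw [preimage_mirror]
  apply prod_mono subset_rfl
  apply Ioo_subset_Ioo <;> linarith

/-- Folding the upper half back over `x₃ = b` transfers the reflection from `d` to the test
function. -/
theorem setIntegral_reflect {S : Set R2} (hS : MeasurableSet S) (s : ℝ) {a b : ℝ} (hab : a < b)
    {d h : R3 → ℝ} (hd : MemLp d 2 (volume.restrict (S ×ˢ Ioo a b)))
    (hh : ∀ U : Set R3, MemLp h 2 (volume.restrict U)) :
    ∫ x in S ×ˢ Ioo a (2 * b - a), (if x.2 ≤ b then d x else s * d (x.1, 2 * b - x.2)) * h x =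
      ∫ x in S ×ˢ Ioo a b, d x * (h x + s * h (mirror (2 * b) x)) := by
  have hbc : b < 2 * b - a := by linarith
  obtain ⟨h1, h2⟩ := ae_reflect hS s a b (2 * b - a) d
  have i0 : Integrable (fun x : R3 => (if x.2 ≤ b then d x else s * d (x.1, 2 * b - x.2)) * h x)
      (volume.restrict (S ×ˢ Ioo a (2 * b - a))) := (memLp_reflect hS s hab hd).integrable_mul (hh _)
  rw [setIntegral_prod_Ioo_add hab hbc i0]
  have e1 : ∫ x in S ×ˢ Ioo a b, (if x.2 ≤ b then d x else s * d (x.1, 2 * b - x.2)) * h x =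
      ∫ x in S ×ˢ Ioo a b, d x * h x := by
    apply integral_congr_ae
    filter_upwards [h1] with x hx
    rw [hx]
  have e2 : ∫ x in S ×ˢ Ioo b (2 * b - a),
      (if x.2 ≤ b then d x else s * d (x.1, 2 * b - x.2)) * h x =
      ∫ x in S ×ˢ Ioo a b, d x * (s * h (mirror (2 * b) x)) := by
    have := setIntegral_comp_homeomorph (U := S ×ˢ Ioo a b) (map_mirror (2 * b)) one_pos
      (fun x => d x * (s * h (mirror (2 * b) x)))
    rw [one_mul] at this
    rw [← this, preimage_mirror, show 2 * b - b = b by ring]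
    apply integral_congr_ae
    filter_upwards [h2] with x hx
    rw [hx, mirror_mirror]
    ring
  have i1 : Integrable (fun x => d x * h x) (volume.restrict (S ×ˢ Ioo a b)) :=
    hd.integrable_mul (hh _)
  have i2 : Integrable (fun x => d x * (s * h (mirror (2 * b) x)))
      (volume.restrict (S ×ˢ Ioo a b)) :=
    hd.integrable_mul ((MemLp.comp_homeomorph (U := univ) (map_mirror (2 * b)) (hh _)
      (subset_univ _)).const_mul s)
  rw [e1, e2, ← integral_add i1 i2]
  congr 1 with x
  ring

/-- The extension of an `H¹` function by reflection across the upper face is again `H¹`. -/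
theorem HasWeakPd.extend_reflect {S : Set R2} (hS : MeasurableSet S) {a b : ℝ} (hab : a < b) {i : Fin 3}
    {f d : R3 → ℝ} (h : HasWeakPd (S ×ˢ Ioo a b) i f d) :
    HasWeakPd (S ×ˢ Ioo a (2 * b - a)) i (reflect b f) (reflectPd b i d) := by
  have hf : reflect b f = fun x : R3 => if x.2 ≤ b then f x else 1 * f (x.1, 2 * b - x.2) := by
    funext x; simp [reflect]
  refine ⟨?_, memLp_reflect hS _ hab h.memLp_pd, fun ψ hψ => ?_⟩
  · rw [hf]; exact memLp_reflect hS 1 hab h.memLp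
  have hψm : IsTest (S ×ˢ Ioo a (2 * b - a)) (fun x => ψ (mirror (2 * b) x)) := by
    refine hψ.comp_homeomorph (contDiff_aff _ _ _) ?_
    rw [preimage_mirror]
    apply prod_mono subset_rfl
    apply Ioo_subset_Ioo <;> linarith
  -- The folded test function need not vanish near `x₃ = b`, so `integral_eq_of_face` is needed. In
  -- the direction `e₃` the sign is `-1` and the function vanishes on the face; in tangential
  -- directions nothing is required there.
  have hχ := (hψ.add (hψm.const_mul (mirrorSign i))).mono
    (prod_mono subset_rfl Ioo_subset_Ioi_self : S ×ˢ Ioo a (2 * b - a) ⊆ S ×ˢ Ioi a)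
  have hpd : ∀ x, pd i (fun x => ψ x + mirrorSign i * ψ (mirror (2 * b) x)) x =
      pd i ψ x + 1 * pd i ψ (mirror (2 * b) x) := fun x => by
    rw [pd_add hψ.differentiable (hψm.const_mul _).differentiable, pd_const_mul hψm.differentiable,
      pd_comp (e := mirror (2 * b)) hψ.differentiable (contDiff_aff _ _ _) (fderiv_aff _ _ _ i),
      ← mul_assoc, mirrorSign_sq]
  have hface : i ≠ 2 ∨ ∀ z, ψ (z, b) + mirrorSign i * ψ (mirror (2 * b) (z, b)) = 0 := by
    by_cases hi : i = 2
    · right; intro z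
      subst hi
      rw [mirror_apply]
      simp only [show 2 * b - b = b by ring]
      simp [mirrorSign]
    · exact Or.inl hi
  have key := h.integral_eq_of_face hS hχ hface
  have e1 := setIntegral_reflect hS 1 hab h.memLp (h := pd i ψ) (fun U => hψ.memLp_pd i U)
  have e2 := setIntegral_reflect hS (mirrorSign i) hab h.memLp_pd (h := ψ) (fun U => hψ.memLp U)
  rw [hf]
  unfold reflectPd
  rw [e1, e2, ← key]
  congr 1 with x
  rw [hpd]

/-! ### Traces on the faces of a cylinder and of the unit cell -/

theorem fderiv_eq_of_add_smul {e : R3 → R3} (he : Differentiable ℝ e) {v w : R3}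
    (h : ∀ x (t : ℝ), e (x + t • v) = e x + t • w) (x : R3) : fderiv ℝ e x v = w := by
  have h2 := (he x).hasFDerivAt.comp_hasDerivAt_of_eq (0 : ℝ)
    (((hasDerivAt_id (0 : ℝ)).smul_const v).const_add x) (by simp)
  have h1 : HasDerivAt (e ∘ fun t : ℝ => x + id t • v) w 0 := by
    have : (e ∘ fun t : ℝ => x + id t • v) = fun t : ℝ => e x + t • w := funext fun t => h x t
    rw [this]
    have := ((hasDerivAt_id (0 : ℝ)).smul_const w).const_add (e x)
    simpa using this
  simpa using h2.unique h1

/-- The permutation `(x₁, x₂, x₃) ↦ (x₃, x₁, x₂)` of the coordinates. -/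
def rotate : R3 ≃ₜ R3 := (Homeomorph.prodComm R2 ℝ).trans (Homeomorph.prodAssoc ℝ ℝ ℝ).symm

theorem rotate_apply (x : R3) : rotate x = ((x.2, x.1.1), x.1.2) := rfl

theorem contDiff_rotate_symm : ContDiff ℝ ((⊤ : ℕ∞) : WithTop ℕ∞) rotate.symm := by
  have : (rotate.symm : R3 → R3) = fun x => ((x.1.2, x.2), x.1.1) := rfl
  rw [this]; fun_prop

theorem map_rotate : Measure.map rotate volume = volume := by
  have h1 : MeasurePreserving (Prod.swap : R2 × ℝ → ℝ × R2) volume volume :=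
    Measure.measurePreserving_swap
  have h2 : MeasurePreserving (MeasurableEquiv.prodAssoc : (ℝ × ℝ) × ℝ ≃ᵐ ℝ × ℝ × ℝ) volume volume :=
    volume_preserving_prodAssoc
  exact ((h2.symm _).comp h1).map_eq

/-- The coordinates `(z, t)` near a face of the unit cell that is orthogonal to `eᵢ`: `z` runs
through the face, and the coordinate `xᵢ` equals `c + s t`. -/
def faceCoord (i : Fin 3) (c s : ℝ) (hs : s ≠ 0) : R3 ≃ₜ R3 :=
  (aff ![0, 0, c] ![1, 1, s] (by intro i; fin_cases i <;> simp [hs])).trans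
    (![rotate, rotate.trans ((Homeomorph.prodComm ℝ ℝ).prodCongr (Homeomorph.refl ℝ)),
      Homeomorph.refl R3] i)

theorem faceCoord_zero (c s : ℝ) (hs : s ≠ 0) (x : R3) :
    faceCoord 0 c s hs x = ((c + s * x.2, x.1.1), x.1.2) := by
  simp [faceCoord, aff_apply, rotate_apply]

theorem faceCoord_one (c s : ℝ) (hs : s ≠ 0) (x : R3) :
    faceCoord 1 c s hs x = ((x.1.1, c + s * x.2), x.1.2) := by
  simp [faceCoord, aff_apply, rotate_apply]

theorem faceCoord_two (c s : ℝ) (hs : s ≠ 0) (x : R3) :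
    faceCoord 2 c s hs x = (x.1, c + s * x.2) := by
  simp [faceCoord, aff_apply]

theorem contDiff_faceCoord (i : Fin 3) (c s : ℝ) (hs : s ≠ 0) :
    ContDiff ℝ ((⊤ : ℕ∞) : WithTop ℕ∞) (faceCoord i c s hs) := by
  have h1 : (faceCoord 0 c s hs : R3 → R3) = fun x => ((c + s * x.2, x.1.1), x.1.2) :=
    funext (faceCoord_zero c s hs)
  have h2 : (faceCoord 1 c s hs : R3 → R3) = fun x => ((x.1.1, c + s * x.2), x.1.2) :=
    funext (faceCoord_one c s hs)
  have h3 : (faceCoord 2 c s hs : R3 → R3) = fun x => (x.1, c + s * x.2) :=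
    funext (faceCoord_two c s hs)
  fin_cases i
  · change ContDiff ℝ _ (faceCoord 0 c s hs); rw [h1]; fun_prop
  · change ContDiff ℝ _ (faceCoord 1 c s hs); rw [h2]; fun_prop
  · change ContDiff ℝ _ (faceCoord 2 c s hs); rw [h3]; fun_prop

theorem contDiff_faceCoord_symm (i : Fin 3) (c s : ℝ) (hs : s ≠ 0) :
    ContDiff ℝ ((⊤ : ℕ∞) : WithTop ℕ∞) (faceCoord i c s hs).symm := by
  have hswap : ContDiff ℝ ((⊤ : ℕ∞) : WithTop ℕ∞) (fun x : R3 => ((x.1.2, x.1.1), x.2)) := by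
    fun_prop
  have key : ∀ (g : R3 ≃ₜ R3) h, ContDiff ℝ ((⊤ : ℕ∞) : WithTop ℕ∞) g.symm →
      ContDiff ℝ ((⊤ : ℕ∞) : WithTop ℕ∞) ((aff ![0, 0, c] ![1, 1, s] h).trans g).symm := by
    intro g h hg
    exact (contDiff_aff_symm _ _ h).comp hg
  fin_cases i
  · exact key _ _ contDiff_rotate_symm
  · exact key _ _ (contDiff_rotate_symm.comp hswap)
  · exact key _ _ contDiff_id

theorem map_faceCoord (i : Fin 3) (c s : ℝ) (hs : s * s = 1) :
    Measure.map (faceCoord i c s (left_ne_zero_of_mul_eq_one hs)) volume = volume := by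
  have hs' : |s⁻¹| = 1 := by
    rw [inv_eq_of_mul_eq_one_right hs]
    rcases mul_self_eq_one_iff.1 hs with rfl | rfl <;> simp
  have h1 : ∀ h, Measure.map (aff ![0, 0, c] ![1, 1, s] h) volume = volume := by
    intro h
    rw [map_aff]
    simp [hs']
  have h2 : Measure.map (fun x : R3 => ((x.1.2, x.1.1), x.2)) volume = volume :=
    ((Measure.measurePreserving_swap (μ := (volume : Measure ℝ)) (ν := (volume : Measure ℝ))).prod
      (MeasurePreserving.id (volume : Measure ℝ))).map_eq
  have h3 : Measurable (fun x : R3 => ((x.1.2, x.1.1), x.2)) := by fun_prop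
  have key : ∀ (g : R3 ≃ₜ R3) h, Measure.map g volume = volume →
      Measure.map ((aff ![0, 0, c] ![1, 1, s] h).trans g) volume = volume := by
    intro g h hg
    rw [show ⇑((aff ![0, 0, c] ![1, 1, s] h).trans g) = g ∘ aff ![0, 0, c] ![1, 1, s] h from rfl,
      ← Measure.map_map g.measurable (Homeomorph.measurable _), h1, hg]
  fin_cases i
  · exact key _ _ map_rotate
  · refine key _ _ ?_
    change Measure.map ((fun x : R3 => ((x.1.2, x.1.1), x.2)) ∘ rotate) volume = volume
    rw [← Measure.map_map h3 rotate.measurable, map_rotate]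
    exact h2
  · refine key _ _ ?_
    exact Measure.map_id

theorem fderiv_faceCoord (i : Fin 3) (c s : ℝ) (hs : s ≠ 0) (x : R3) :
    fderiv ℝ (faceCoord i c s hs) x (dir 2) = s • dir i := by
  refine fderiv_eq_of_add_smul ((contDiff_faceCoord i c s hs).differentiable (by simp)) ?_ x
  intro x t
  fin_cases i
  · change faceCoord 0 c s hs _ = faceCoord 0 c s hs _ + _
    simp [faceCoord_zero, dir]; ring
  · change faceCoord 1 c s hs _ = faceCoord 1 c s hs _ + _
    simp [faceCoord_one, dir]; ring
  · change faceCoord 2 c s hs _ = faceCoord 2 c s hs _ + _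
    simp [faceCoord_two, dir]; ring

theorem exists_isFaceTrace_faceCoord (i : Fin 3) (c : ℝ) {σ : ℝ} (hσ : σ * σ = 1) {U W : Set R3}
    {S : Set R2} (hS : MeasurableSet S) {a b : ℝ} (hab : a < b)
    (hU : faceCoord i c σ (left_ne_zero_of_mul_eq_one hσ) ⁻¹' U = S ×ˢ Ioo a b)
    (hW : faceCoord i c σ (left_ne_zero_of_mul_eq_one hσ) ⁻¹' W = S ×ˢ Ioi a) (u : H1 U) :
    ∃ g : R2 → ℝ, IsFaceTrace W i σ S
      (fun z => faceCoord i c σ (left_ne_zero_of_mul_eq_one hσ) (z, b)) u g :=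
  exists_isFaceTrace hS hab (contDiff_faceCoord i c σ _) (contDiff_faceCoord_symm i c σ _)
    (map_faceCoord i c σ hσ) (fderiv_faceCoord i c σ _) hσ hU hW u

theorem exists_isTopTrace {S : Set R2} (hS : MeasurableSet S) {a b : ℝ} (hab : a < b)
    (u : H1 (S ×ˢ Ioo a b)) : ∃ g, IsTopTrace S a b u g := by
  have := exists_isFaceTrace_faceCoord 2 0 (one_mul (1 : ℝ)) (U := S ×ˢ Ioo a b)
    (W := S ×ˢ Ioi a) hS hab (by ext x; simp [faceCoord_two]) (by ext x; simp [faceCoord_two]) u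
  simpa [faceCoord_two, IsTopTrace] using this

theorem exists_isBottomTrace {S : Set R2} (hS : MeasurableSet S) {a b : ℝ} (hab : a < b)
    (u : H1 (S ×ˢ Ioo a b)) : ∃ g, IsBottomTrace S a b u g := by
  -- The coordinate `x₃ = a + b - t` exchanges the two ends, so the lower face becomes the upper one
  -- and `σ = -1` is the sign of the outward normal.
  have := exists_isFaceTrace_faceCoord 2 (a + b) (σ := -1) (by norm_num) (U := S ×ˢ Ioo a b)
    (W := S ×ˢ Iio b) hS hab
    (by
      ext x
      simp only [faceCoord_two, mem_preimage, mem_prod, mem_Ioo]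
      constructor <;> rintro ⟨h1, h2, h3⟩ <;> refine ⟨h1, ?_, ?_⟩ <;> linarith)
    (by
      ext x
      simp only [faceCoord_two, mem_preimage, mem_prod, mem_Iio, mem_Ioi]
      constructor <;> rintro ⟨h1, h2⟩ <;> refine ⟨h1, ?_⟩ <;> linarith) u
  simpa [faceCoord_two, IsBottomTrace] using this

theorem measurableSet_YPlane : MeasurableSet YPlane := measurableSet_Ioo.prod measurableSet_Ioo

theorem exists_isFaceTrace_zero_low (v : H1 Y) : ∃ g, IsFaceTrace ((Iio 1 ×ˢ Ioo 0 1) ×ˢ Ioo 0 1)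
    0 (-1) YPlane (fun z => ((0, z.1), z.2)) v g := by
  -- Here `x₁ = 1 - t`, so the face `x₁ = 0` is `t = 1`. The remaining lateral faces are treated by
  -- the same device.
  have := exists_isFaceTrace_faceCoord 0 1 (σ := -1) (by norm_num) (U := Y)
    (W := (Iio 1 ×ˢ Ioo 0 1) ×ˢ Ioo 0 1) measurableSet_YPlane zero_lt_one
    (by ext x; simp only [faceCoord_zero, mem_preimage, mem_prod, mem_Ioo]; grind)
    (by ext x; simp only [faceCoord_zero, mem_preimage, mem_prod, mem_Ioo, mem_Iio, mem_Ioi]; grind) v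
  simpa [faceCoord_zero] using this

theorem exists_isFaceTrace_zero_high (v : H1 Y) : ∃ g, IsFaceTrace ((Ioi 0 ×ˢ Ioo 0 1) ×ˢ Ioo 0 1)
    0 1 YPlane (fun z => ((1, z.1), z.2)) v g := by
  have := exists_isFaceTrace_faceCoord 0 0 (σ := 1) (by norm_num) (U := Y)
    (W := (Ioi 0 ×ˢ Ioo 0 1) ×ˢ Ioo 0 1) measurableSet_YPlane zero_lt_one
    (by ext x; simp only [faceCoord_zero, mem_preimage, mem_prod, mem_Ioo]; grind)
    (by ext x; simp only [faceCoord_zero, mem_preimage, mem_prod, mem_Ioo, mem_Ioi]; grind) v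
  simpa [faceCoord_zero] using this

theorem exists_isFaceTrace_one_low (v : H1 Y) : ∃ g, IsFaceTrace ((Ioo 0 1 ×ˢ Iio 1) ×ˢ Ioo 0 1)
    1 (-1) YPlane (fun z => ((z.1, 0), z.2)) v g := by
  have := exists_isFaceTrace_faceCoord 1 1 (σ := -1) (by norm_num) (U := Y)
    (W := (Ioo 0 1 ×ˢ Iio 1) ×ˢ Ioo 0 1) measurableSet_YPlane zero_lt_one
    (by ext x; simp only [faceCoord_one, mem_preimage, mem_prod, mem_Ioo]; grind)
    (by ext x; simp only [faceCoord_one, mem_preimage, mem_prod, mem_Ioo, mem_Iio, mem_Ioi]; grind) v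
  simpa [faceCoord_one] using this

theorem exists_isFaceTrace_one_high (v : H1 Y) : ∃ g, IsFaceTrace ((Ioo 0 1 ×ˢ Ioi 0) ×ˢ Ioo 0 1)
    1 1 YPlane (fun z => ((z.1, 1), z.2)) v g := by
  have := exists_isFaceTrace_faceCoord 1 0 (σ := 1) (by norm_num) (U := Y)
    (W := (Ioo 0 1 ×ˢ Ioi 0) ×ˢ Ioo 0 1) measurableSet_YPlane zero_lt_one
    (by ext x; simp only [faceCoord_one, mem_preimage, mem_prod, mem_Ioo]; grind)
    (by ext x; simp only [faceCoord_one, mem_preimage, mem_prod, mem_Ioo, mem_Ioi]; grind) v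
  simpa [faceCoord_one] using this

theorem IsFaceTrace.congr {U W : Set R3} {i : Fin 3} {σ : ℝ} {S : Set R2} {p : R2 → R3} {u : H1 U}
    {g g' : R2 → ℝ} (h : IsFaceTrace W i σ S p u g) (hg : g =ᵐ[volume.restrict S] g') :
    IsFaceTrace W i σ S p u g' := by
  refine ⟨h.1.ae_eq hg, fun ψ hψ => ?_⟩
  rw [h.2 ψ hψ]
  congr 1
  apply integral_congr_ae
  filter_upwards [hg] with z hz
  rw [hz]

/-! ### Criteria for periodicity and for constant traces -/

theorem HasWeakPd.integrable_green {U W : Set R3} {i : Fin 3} {f d : R3 → ℝ}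
    (h : HasWeakPd U i f d) {ψ : R3 → ℝ} (hψ : IsTest W ψ) (j : Fin 3) :
    Integrable (fun x => f x * pd j ψ x + d x * ψ x) (volume.restrict U) :=
  (h.integrable_mul hψ j).1.add (h.integrable_mul hψ j).2

theorem isTest2_mul {I J : Set ℝ} {a b : ℝ → ℝ} (ha : ContDiff ℝ ((⊤ : ℕ∞) : WithTop ℕ∞) a)
    (hb : ContDiff ℝ ((⊤ : ℕ∞) : WithTop ℕ∞) b) (hac : HasCompactSupport a)
    (hbc : HasCompactSupport b) (hI : tsupport a ⊆ I) (hJ : tsupport b ⊆ J) :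
    IsTest2 (I ×ˢ J) (fun z => a z.1 * b z.2) := by
  have hsub : tsupport (fun z : R2 => a z.1 * b z.2) ⊆ tsupport a ×ˢ tsupport b := by
    refine closure_minimal ?_ ((isClosed_tsupport a).prod (isClosed_tsupport b))
    intro z hz
    have := mul_ne_zero_iff.1 hz
    exact ⟨subset_tsupport _ this.1, subset_tsupport _ this.2⟩
  exact ⟨(ha.comp contDiff_fst).mul (hb.comp contDiff_snd),
    (hac.isCompact.prod hbc.isCompact).of_isClosed_subset (isClosed_tsupport _) hsub,
    hsub.trans (prod_mono hI hJ)⟩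

theorem fderiv_mul_fst_snd {a b : ℝ → ℝ} (ha : Differentiable ℝ a) (hb : Differentiable ℝ b)
    (z v : R2) : fderiv ℝ (fun z : R2 => a z.1 * b z.2) z v =
      v.1 * deriv a z.1 * b z.2 + v.2 * a z.1 * deriv b z.2 := by
  have h1 : HasFDerivAt (fun z : R2 => a z.1) (deriv a z.1 • ContinuousLinearMap.fst ℝ ℝ ℝ) z :=
    (ha z.1).hasDerivAt.comp_hasFDerivAt z hasFDerivAt_fst
  have h2 : HasFDerivAt (fun z : R2 => b z.2) (deriv b z.2 • ContinuousLinearMap.snd ℝ ℝ ℝ) z :=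
    (hb z.2).hasDerivAt.comp_hasFDerivAt z hasFDerivAt_snd
  rw [show (fun z : R2 => a z.1 * b z.2) = (fun z : R2 => a z.1) * fun z => b z.2 from rfl,
    (h1.mul h2).fderiv]
  simp
  ring

theorem pd_mul_mul {a b c : ℝ → ℝ} (ha : Differentiable ℝ a) (hb : Differentiable ℝ b)
    (hc : Differentiable ℝ c) (i : Fin 3) (x : R3) :
    pd i (fun x => a x.1.1 * b x.1.2 * c x.2) x =
      (dir i).1.1 * deriv a x.1.1 * b x.1.2 * c x.2 + (dir i).1.2 * a x.1.1 * deriv b x.1.2 * c x.2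
        + (dir i).2 * a x.1.1 * b x.1.2 * deriv c x.2 := by
  have hab : Differentiable ℝ (fun z : R2 => a z.1 * b z.2) :=
    (ha.comp differentiable_fst).mul (hb.comp differentiable_snd)
  rw [pd_mul_fst_snd (κ := fun z : R2 => a z.1 * b z.2) hab hc, fderiv_mul_fst_snd ha hb]
  ring

theorem IsTest01.differentiable {α : ℝ → ℝ} (h : IsTest01 α) : Differentiable ℝ α :=
  h.1.differentiable (by simp)

/-- Smooth functions `η₀` and `η₁` of compact support, with `η₀ + η₁ = 1` on `(0, 1)`, such that
`η₀ = 1` at `0` and vanishes near `1`, and `η₁ = 1` at `1` and vanishes near `0`. -/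
theorem exists_face_partition : ∃ η₀ η₁ : ℝ → ℝ, ContDiff ℝ ((⊤ : ℕ∞) : WithTop ℕ∞) η₀ ∧
    ContDiff ℝ ((⊤ : ℕ∞) : WithTop ℕ∞) η₁ ∧ HasCompactSupport η₀ ∧ HasCompactSupport η₁ ∧
    tsupport η₀ ⊆ Iio 1 ∧ tsupport η₁ ⊆ Ioi 0 ∧ η₀ 0 = 1 ∧ η₁ 1 = 1 ∧
    (∀ t ∈ Ioo (0 : ℝ) 1, η₀ t + η₁ t = 1) ∧
    ∀ t ∈ Ioo (0 : ℝ) 1, deriv η₀ t + deriv η₁ t = 0 := by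
  set η₀ : ℝ → ℝ := fun t => (1 - step (t - 1)) * step t with h0
  set η₁ : ℝ → ℝ := fun t => step (t - 1) * step (1 - t) with h1
  have c0 : ContDiff ℝ ((⊤ : ℕ∞) : WithTop ℕ∞) η₀ :=
    (contDiff_const.sub (contDiff_step.comp (contDiff_id.sub contDiff_const))).mul contDiff_step
  have c1 : ContDiff ℝ ((⊤ : ℕ∞) : WithTop ℕ∞) η₁ :=
    (contDiff_step.comp (contDiff_id.sub contDiff_const)).mul
      (contDiff_step.comp (contDiff_const.sub contDiff_id))
  have s0 : tsupport η₀ ⊆ Icc (-3 / 4) (1 / 2) := by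
    refine closure_minimal ?_ isClosed_Icc
    intro t ht
    obtain ⟨g1, g2⟩ := mul_ne_zero_iff.1 ht
    constructor
    · by_contra h; exact g2 (step_eq_zero (by linarith))
    · by_contra h; exact g1 (by rw [step_eq_one (by linarith), sub_self])
  have s1 : tsupport η₁ ⊆ Icc (1 / 4) (7 / 4) := by
    refine closure_minimal ?_ isClosed_Icc
    intro t ht
    obtain ⟨g1, g2⟩ := mul_ne_zero_iff.1 ht
    constructor
    · by_contra h; exact g1 (step_eq_zero (by linarith))
    · by_contra h; exact g2 (step_eq_zero (by linarith))
  have hsum : ∀ t ∈ Ioo (0 : ℝ) 1, η₀ t + η₁ t = 1 := by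
    intro t ht
    simp only [h0, h1]
    rw [step_eq_one (t := t) (by linarith [ht.1]), step_eq_one (t := 1 - t) (by linarith [ht.2])]
    ring
  refine ⟨η₀, η₁, c0, c1, isCompact_Icc.of_isClosed_subset (isClosed_tsupport _) s0,
    isCompact_Icc.of_isClosed_subset (isClosed_tsupport _) s1, fun t ht => ?_, fun t ht => ?_, ?_, ?_,
    hsum, fun t ht => ?_⟩
  · have := (s0 ht).2
    simp only [mem_Iio]; linarith
  · have := (s1 ht).1
    simp only [mem_Ioi]; linarith
  · simp only [h0]
    rw [step_eq_zero (by norm_num), step_eq_one (by norm_num)]; norm_num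
  · simp only [h1]
    rw [sub_self, step_eq_one (by norm_num), one_mul]
  · have e : (fun t => η₀ t + η₁ t) =ᶠ[𝓝 t] fun _ => 1 := by
      filter_upwards [Ioo_mem_nhds ht.1 ht.2] with s hs using hsum s hs
    have := e.deriv_eq
    rw [deriv_const, deriv_fun_add (c0.differentiable (by simp) t)
      (c1.differentiable (by simp) t)] at this
    exact this

/-- Each `ψⱼ` sees only one of two opposite faces, while `ψ₀ + ψ₁` does not vary in the direction
`i`. Adding the two Green formulas leaves `∫ (g₁ - g₀) α β` on one side and zero on the other;
products `α β` separate `L²` of the face. -/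
theorem IsFaceTrace.ae_eq_of_test {U W₀ W₁ : Set R3} (hU : MeasurableSet U) {i : Fin 3}
    {p₀ p₁ : R2 → R3} {v : H1 U} {g₀ g₁ : R2 → ℝ} (h₀ : IsFaceTrace W₀ i (-1) YPlane p₀ v g₀)
    (h₁ : IsFaceTrace W₁ i 1 YPlane p₁ v g₁)
    (h : ∀ α β, IsTest01 α → IsTest01 β → ∃ (ψ₀ ψ₁ : R3 → ℝ), IsTest W₀ ψ₀ ∧ IsTest W₁ ψ₁ ∧
      (∀ x ∈ U, pd i ψ₀ x + pd i ψ₁ x = 0) ∧ (∀ z ∈ YPlane, ψ₀ (p₀ z) = α z.1 * β z.2) ∧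
      (∀ z ∈ YPlane, ψ₁ (p₁ z) = α z.1 * β z.2) ∧
      ∫ x in U, grad v i x * (ψ₀ x + ψ₁ x) = 0) :
    g₁ =ᵐ[volume.restrict YPlane] g₀ := by
  have hfin := ae_eq_zero_of_forall_test_prod (h₁.1.sub h₀.1) fun α β hα hβ => by
    obtain ⟨ψ₀, ψ₁, t₀, t₁, hpd, e₀, e₁, hz⟩ := h α β hα hβ
    have r₀ := h₀.2 ψ₀ t₀
    have r₁ := h₁.2 ψ₁ t₁
    rw [setIntegral_congr_fun (g := fun z => g₀ z * (α z.1 * β z.2)) measurableSet_YPlane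
      (fun z hz => by simp only [e₀ z hz])] at r₀
    rw [setIntegral_congr_fun (g := fun z => g₁ z * (α z.1 * β z.2)) measurableSet_YPlane
      (fun z hz => by simp only [e₁ z hz])] at r₁
    have hαβ := (isTest2_mul hα.1 hβ.1 hα.2.1 hβ.2.1 hα.2.2 hβ.2.2)
    have hL : MemLp (fun z : R2 => α z.1 * β z.2) 2 (volume.restrict YPlane) :=
      hαβ.1.continuous.memLp_of_hasCompactSupport hαβ.2.1
    have i₀ : Integrable (fun z : R2 => g₀ z * (α z.1 * β z.2)) (volume.restrict YPlane) :=
      h₀.1.integrable_mul hL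
    have i₁ : Integrable (fun z : R2 => g₁ z * (α z.1 * β z.2)) (volume.restrict YPlane) :=
      h₁.1.integrable_mul hL
    have w := hasWeakPd v i
    have j₀ := w.integrable_green t₀ i
    have j₁ := w.integrable_green t₁ i
    have e3 : (∫ x in U, (fn v x * pd i ψ₀ x + grad v i x * ψ₀ x)) +
        ∫ x in U, (fn v x * pd i ψ₁ x + grad v i x * ψ₁ x) = 0 := by
      rw [← integral_add j₀ j₁, ← hz]
      apply setIntegral_congr_fun hU
      intro x hx
      have := hpd x hx
      linear_combination fn v x * this
    rw [r₀, r₁] at e3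
    have e4 : ∫ z in YPlane, (g₁ - g₀) z * (α z.1 * β z.2) =
        (∫ z in YPlane, g₁ z * (α z.1 * β z.2)) - ∫ z in YPlane, g₀ z * (α z.1 * β z.2) := by
      rw [← integral_sub i₁ i₀]
      congr 1 with z
      simp only [Pi.sub_apply]; ring
    rw [e4]; linarith
  filter_upwards [hfin] with z hz
  simpa [sub_eq_zero] using hz

theorem measurableSet_Y : MeasurableSet Y := measurableSet_YPlane.prod measurableSet_Ioo

/-- A test function independent of `yᵢ` is split by the partition `η₀ + η₁ = 1` into a part for each
of the two faces orthogonal to `eᵢ`. The hypothesis then states that the difference of the two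
traces has zero pairing with every `α β`. -/
theorem isPer_of_forall_test {v : H1 Y}
    (h0 : ∀ α β, IsTest01 α → IsTest01 β → ∫ x in Y, grad v 0 x * (α x.1.2 * β x.2) = 0)
    (h1 : ∀ α β, IsTest01 α → IsTest01 β → ∫ x in Y, grad v 1 x * (α x.1.1 * β x.2) = 0) :
    IsPer v := by
  obtain ⟨η₀, η₁, c0, c1, k0, k1, s0, s1, e0, e1, hsum, hder⟩ := exists_face_partition
  have d0 := c0.differentiable (n := ((⊤ : ℕ∞) : WithTop ℕ∞)) (by simp)
  have d1 := c1.differentiable (n := ((⊤ : ℕ∞) : WithTop ℕ∞)) (by simp)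
  constructor
  · obtain ⟨g₀, hg₀⟩ := exists_isFaceTrace_zero_low v
    obtain ⟨g₁, hg₁⟩ := exists_isFaceTrace_zero_high v
    have hae := hg₀.ae_eq_of_test measurableSet_Y hg₁ fun α β hα hβ => by
      refine ⟨fun x => η₀ x.1.1 * α x.1.2 * β x.2, fun x => η₁ x.1.1 * α x.1.2 * β x.2,
        (isTest2_mul c0 hα.1 k0 hα.2.1 s0 hα.2.2).mul_snd hβ.1 hβ.2.1 hβ.2.2,
        (isTest2_mul c1 hα.1 k1 hα.2.1 s1 hα.2.2).mul_snd hβ.1 hβ.2.1 hβ.2.2, ?_, ?_, ?_, ?_⟩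
      · intro x hx
        rw [pd_mul_mul d0 hα.differentiable hβ.differentiable,
          pd_mul_mul d1 hα.differentiable hβ.differentiable]
        simp only [dir, Matrix.cons_val_zero]
        linear_combination α x.1.2 * β x.2 * hder x.1.1 hx.1.1
      · intro z _
        simp only [e0, one_mul]
      · intro z _
        simp only [e1, one_mul]
      · rw [← h0 α β hα hβ]
        apply setIntegral_congr_fun measurableSet_Y
        intro x hx
        linear_combination grad v 0 x * α x.1.2 * β x.2 * hsum x.1.1 hx.1.1
    exact ⟨g₀, hg₀, hg₁.congr hae⟩
  · obtain ⟨g₀, hg₀⟩ := exists_isFaceTrace_one_low v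
    obtain ⟨g₁, hg₁⟩ := exists_isFaceTrace_one_high v
    have hae := hg₀.ae_eq_of_test measurableSet_Y hg₁ fun α β hα hβ => by
      refine ⟨fun x => α x.1.1 * η₀ x.1.2 * β x.2, fun x => α x.1.1 * η₁ x.1.2 * β x.2,
        (isTest2_mul hα.1 c0 hα.2.1 k0 hα.2.2 s0).mul_snd hβ.1 hβ.2.1 hβ.2.2,
        (isTest2_mul hα.1 c1 hα.2.1 k1 hα.2.2 s1).mul_snd hβ.1 hβ.2.1 hβ.2.2, ?_, ?_, ?_, ?_⟩
      · intro x hx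
        rw [pd_mul_mul hα.differentiable d0 hβ.differentiable,
          pd_mul_mul hα.differentiable d1 hβ.differentiable]
        simp only [dir, Matrix.cons_val_one, Matrix.cons_val_zero]
        linear_combination α x.1.1 * β x.2 * hder x.1.2 hx.1.2
      · intro z _
        simp only [e0, mul_one]
      · intro z _
        simp only [e1, mul_one]
      · rw [← h1 α β hα hβ]
        apply setIntegral_congr_fun measurableSet_Y
        intro x hx
        linear_combination grad v 1 x * α x.1.1 * β x.2 * hsum x.1.2 hx.1.2
    exact ⟨g₀, hg₀, hg₁.congr hae⟩

theorem setIntegral_YPlane_mul (α β : ℝ → ℝ) :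
    ∫ z in YPlane, α z.1 * β z.2 = mean α * mean β := by
  rw [volume_restrict_YPlane]
  exact integral_prod_mul α β

/-- A trace is determined by its pairings with products `α β`, so one extension `ψ` of each product
suffices; `c * (mean α * mean β)` is the pairing of the constant `c`. -/
theorem IsFaceTrace.congr_const {U W : Set R3} {i : Fin 3} {σ : ℝ} (hσ : σ ≠ 0) {p : R2 → R3}
    {v : H1 U} {g : R2 → ℝ} {c : ℝ} (h : IsFaceTrace W i σ YPlane p v g)
    (hc : ∀ α β, IsTest01 α → IsTest01 β → ∃ ψ : R3 → ℝ, IsTest W ψ ∧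
      (∀ z, ψ (p z) = α z.1 * β z.2) ∧
      ∫ x in U, (fn v x * pd i ψ x + grad v i x * ψ x) = σ * (c * (mean α * mean β))) :
    IsFaceTrace W i σ YPlane p v (fun _ => c) := by
  have hcL : MemLp (fun _ : R2 => c) 2 (volume.restrict YPlane) := memLp_const c
  have hz := ae_eq_zero_of_forall_test_prod (h.1.sub hcL) fun α β hα hβ => by
    obtain ⟨ψ, hψ, he, hi⟩ := hc α β hα hβ
    have hr := h.2 ψ hψ
    rw [hi] at hr
    have hr' := mul_left_cancel₀ hσ hr
    simp only [he] at hr'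
    have hαβ := (isTest2_mul hα.1 hβ.1 hα.2.1 hβ.2.1 hα.2.2 hβ.2.2)
    have hL : MemLp (fun z : R2 => α z.1 * β z.2) 2 (volume.restrict YPlane) :=
      hαβ.1.continuous.memLp_of_hasCompactSupport hαβ.2.1
    have i₀ : Integrable (fun z : R2 => g z * (α z.1 * β z.2)) (volume.restrict YPlane) :=
      h.1.integrable_mul hL
    have i₁ : Integrable (fun z : R2 => c * (α z.1 * β z.2)) (volume.restrict YPlane) :=
      (hL.integrable one_le_two).const_mul c
    have e4 : ∫ z in YPlane, (g - fun _ : R2 => c) z * (α z.1 * β z.2) =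
        (∫ z in YPlane, g z * (α z.1 * β z.2)) - ∫ z in YPlane, c * (α z.1 * β z.2) := by
      rw [← integral_sub i₀ i₁]
      congr 1 with z
      simp only [Pi.sub_apply]; ring
    rw [e4, ← hr', integral_const_mul, setIntegral_YPlane_mul, sub_self]
  refine h.congr ?_
  filter_upwards [hz] with z hz
  simpa [sub_eq_zero] using hz

/-- The test function `α(x₁) β(x₂) γ(x₃ - b)`, with `γ` a bump. -/
def faceTest (α β : ℝ → ℝ) (b : ℝ) (x : R3) : ℝ := α x.1.1 * β x.1.2 * bumpAt b 1 x.2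

theorem isTest_faceTest {α β : ℝ → ℝ} (hα : IsTest01 α) (hβ : IsTest01 β) {b : ℝ} {J : Set ℝ}
    (hJ : Icc (b - 3 / 4) (b + 3 / 4) ⊆ J) : IsTest (YPlane ×ˢ J) (faceTest α β b) := by
  refine (isTest2_mul hα.1 hβ.1 hα.2.1 hβ.2.1 hα.2.2 hβ.2.2).mul_snd
    (contDiff_bumpAt b 1) (hasCompactSupport_bumpAt b one_pos) ?_
  refine (tsupport_bumpAt b one_pos).trans ?_
  simpa using hJ

theorem isBottomTrace_const_of_forall_test {v : H1 Y} {c : ℝ}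
    (h : ∀ α β, IsTest01 α → IsTest01 β →
      ∫ x in Y, (fn v x * pd 2 (faceTest α β 0) x + grad v 2 x * faceTest α β 0 x) =
        -(c * (mean α * mean β))) : IsBottomTrace YPlane 0 1 v (fun _ => c) := by
  obtain ⟨g, hg⟩ := exists_isBottomTrace measurableSet_YPlane zero_lt_one v
  refine IsFaceTrace.congr_const (by norm_num) hg fun α β hα hβ => ⟨faceTest α β 0, ?_, ?_, ?_⟩
  · refine isTest_faceTest hα hβ fun t ht => ?_
    have := ht.2
    simp only [mem_Iio]; linarith
  · intro z; simp [faceTest, bumpAt_self]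
  · rw [h α β hα hβ]; ring

theorem isTopTrace_const_of_forall_test {v : H1 Y} {c : ℝ}
    (h : ∀ α β, IsTest01 α → IsTest01 β →
      ∫ x in Y, (fn v x * pd 2 (faceTest α β 1) x + grad v 2 x * faceTest α β 1 x) =
        c * (mean α * mean β)) : IsTopTrace YPlane 0 1 v (fun _ => c) := by
  obtain ⟨g, hg⟩ := exists_isTopTrace measurableSet_YPlane zero_lt_one v
  refine IsFaceTrace.congr_const (by norm_num) hg fun α β hα hβ => ⟨faceTest α β 1, ?_, ?_, ?_⟩
  · refine isTest_faceTest hα hβ fun t ht => ?_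
    have := ht.1
    simp only [mem_Ioi]; linarith
  · intro z; simp [faceTest, bumpAt_self]
  · rw [h α β hα hβ]; ring

/-! ### Cells and the unfolding map -/

theorem cell_eq {ε : ℝ} (hε : 0 < ε) (ξ : ℤ × ℤ) : cell ε ξ =
    Ioo (ε * ξ.1) (ε * ξ.1 + ε) ×ˢ Ioo (ε * ξ.2) (ε * ξ.2 + ε) := by
  ext x
  simp only [cell, mem_image, mem_prod, mem_Ioo]
  constructor
  · rintro ⟨z, ⟨⟨h1, h2⟩, h3, h4⟩, rfl⟩
    refine ⟨⟨?_, ?_⟩, ?_, ?_⟩ <;> nlinarith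
  · rintro ⟨⟨h1, h2⟩, h3, h4⟩
    refine ⟨(x.1 / ε - ξ.1, x.2 / ε - ξ.2), ⟨⟨?_, ?_⟩, ?_, ?_⟩, ?_⟩
    · rw [sub_pos, lt_div_iff₀ hε]; linarith
    · rw [sub_lt_iff_lt_add, div_lt_iff₀ hε]; linarith
    · rw [sub_pos, lt_div_iff₀ hε]; linarith
    · rw [sub_lt_iff_lt_add, div_lt_iff₀ hε]; linarith
    · ext <;> simp <;> field_simp

theorem isOpen_cell {ε : ℝ} (hε : 0 < ε) (ξ : ℤ × ℤ) : IsOpen (cell ε ξ) := by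
  rw [cell_eq hε]; exact isOpen_Ioo.prod isOpen_Ioo

theorem cellIndex_of_mem {ε : ℝ} (hε : 0 < ε) {ξ : ℤ × ℤ} {x : R2} (hx : x ∈ cell ε ξ) :
    cellIndex ε x = ξ := by
  rw [cell_eq hε] at hx
  obtain ⟨⟨h1, h2⟩, h3, h4⟩ := hx
  ext
  · simp only [cellIndex]
    rw [Int.floor_eq_iff, le_div_iff₀ hε, div_lt_iff₀ hε]
    constructor <;> linarith
  · simp only [cellIndex]
    rw [Int.floor_eq_iff, le_div_iff₀ hε, div_lt_iff₀ hε]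
    constructor <;> linarith

/-- The only exceptions lie on the countably many grid lines. -/
theorem ae_mem_cell {ε : ℝ} (hε : 0 < ε) : ∀ᵐ x : R2, x ∈ cell ε (cellIndex ε x) := by
  have h1 : ∀ᵐ t : ℝ, t / ε ≠ ⌊t / ε⌋ := by
    have hc : (range fun m : ℤ => ε * m).Countable := countable_range _
    filter_upwards [hc.ae_notMem volume] with t ht h
    exact ht ⟨⌊t / ε⌋, by simp only [← h]; field_simp⟩
  have h2 : ∀ᵐ x : R2, x.1 / ε ≠ ⌊x.1 / ε⌋ := Measure.quasiMeasurePreserving_fst.ae h1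
  have h3 : ∀ᵐ x : R2, x.2 / ε ≠ ⌊x.2 / ε⌋ := Measure.quasiMeasurePreserving_snd.ae h1
  have key : ∀ t : ℝ, t / ε ≠ ⌊t / ε⌋ → t ∈ Ioo (ε * ⌊t / ε⌋) (ε * ⌊t / ε⌋ + ε) := by
    intro t ht
    have e1 := lt_of_le_of_ne (Int.floor_le (t / ε)) (Ne.symm ht)
    have e2 := Int.lt_floor_add_one (t / ε)
    rw [lt_div_iff₀ hε] at e1
    rw [div_lt_iff₀ hε] at e2
    constructor <;> linarith
  filter_upwards [h2, h3] with x h2 h3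
  rw [cell_eq hε]
  exact ⟨key _ h2, key _ h3⟩

/-- The union of the cells that are contained in `ω`. -/
def cellUnion (ε : ℝ) (ω : Set R2) : Set R2 := ⋃ ξ : cellsIn ε ω, cell ε ξ

theorem cellUnion_subset (ε : ℝ) (ω : Set R2) : cellUnion ε ω ⊆ ω :=
  iUnion_subset fun ξ => ξ.2

theorem measurableSet_cellUnion {ε : ℝ} (hε : 0 < ε) (ω : Set R2) :
    MeasurableSet (cellUnion ε ω) :=
  (isOpen_iUnion fun ξ : cellsIn ε ω => isOpen_cell hε ξ).measurableSet

theorem mem_cellUnion_iff {ε : ℝ} (hε : 0 < ε) {ω : Set R2} {x : R2}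
    (hx : x ∈ cell ε (cellIndex ε x)) : x ∈ cellUnion ε ω ↔ cellIndex ε x ∈ cellsIn ε ω := by
  constructor
  · intro h
    obtain ⟨ξ, hξ⟩ := mem_iUnion.1 h
    rw [cellIndex_of_mem hε hξ]
    exact ξ.2
  · intro h
    exact mem_iUnion.2 ⟨⟨_, h⟩, hx⟩

theorem volume_cell {ε : ℝ} (hε : 0 < ε) (ξ : ℤ × ℤ) :
    volume (cell ε ξ) = ENNReal.ofReal (ε * ε) := by
  rw [cell_eq hε, Measure.volume_eq_prod, Measure.prod_prod, Real.volume_Ioo, Real.volume_Ioo,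
    ENNReal.ofReal_mul hε.le]
  congr 2 <;> ring

/-- The map `y ↦ ε(ξ + y)`. -/
def cellMap (ε : ℝ) (hε : ε ≠ 0) (ξ : ℤ × ℤ) : R3 ≃ₜ R3 :=
  aff ![ε * ξ.1, ε * ξ.2, 0] (fun _ => ε) (fun _ => hε)

theorem cellMap_apply (ε : ℝ) (hε : ε ≠ 0) (ξ : ℤ × ℤ) (y : R3) : cellMap ε hε ξ y =
    ((ε * (ξ.1 + y.1.1), ε * (ξ.2 + y.1.2)), ε * y.2) := by
  simp [cellMap, aff_apply, mul_add]

theorem map_cellMap {ε : ℝ} (hε : 0 < ε) (ξ : ℤ × ℤ) : Measure.map (cellMap ε hε.ne' ξ) volume =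
    ENNReal.ofReal (ε⁻¹ * ε⁻¹ * ε⁻¹) • volume := by
  rw [cellMap, map_aff, abs_of_pos (inv_pos.2 hε)]

theorem preimage_cellMap {ε : ℝ} (hε : 0 < ε) (ξ : ℤ × ℤ) :
    cellMap ε hε.ne' ξ ⁻¹' (cell ε ξ ×ˢ Ioo 0 ε) = Y := by
  ext y
  simp only [cell_eq hε, mem_preimage, cellMap_apply, mem_prod, mem_Ioo]
  have key : ∀ m t : ℝ, (ε * m < ε * (m + t) ∧ ε * (m + t) < ε * m + ε) ↔ (0 < t ∧ t < 1) := by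
    intro m t
    constructor
    · rintro ⟨h1, h2⟩
      constructor <;> nlinarith
    · rintro ⟨h1, h2⟩
      constructor <;> nlinarith
  have key2 := key 0 y.2
  simp only [mul_zero, zero_add] at key2
  rw [key, key, key2]

/-- The map `(x', y) ↦ ε([x'/ε] + y)`. -/
def unfoldMap (ε : ℝ) (p : R2 × R3) : R3 :=
  ((ε * ((cellIndex ε p.1).1 + p.2.1.1), ε * ((cellIndex ε p.1).2 + p.2.1.2)), ε * p.2.2)

theorem measurable_cellIndex (ε : ℝ) : Measurable (cellIndex ε) := by
  unfold cellIndex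
  exact (Int.measurable_floor.comp (measurable_fst.div_const ε)).prodMk
    (Int.measurable_floor.comp (measurable_snd.div_const ε))

theorem measurable_unfoldMap (ε : ℝ) : Measurable (unfoldMap ε) := by
  have h1 : Measurable fun p : R2 × R3 => ((cellIndex ε p.1).1 : ℝ) :=
    (Measurable.of_discrete (f := fun ξ : ℤ × ℤ => (ξ.1 : ℝ))).comp
      ((measurable_cellIndex ε).comp measurable_fst)
  have h2 : Measurable fun p : R2 × R3 => ((cellIndex ε p.1).2 : ℝ) :=
    (Measurable.of_discrete (f := fun ξ : ℤ × ℤ => (ξ.2 : ℝ))).comp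
      ((measurable_cellIndex ε).comp measurable_fst)
  unfold unfoldMap
  fun_prop

/-- Over one cell the map ignores `x'`, which contributes the area `ε²`, and is a dilation in `y`
from `Y` onto `cell × (0, ε)`, which contributes the density `ε⁻³`. The product `ε⁻¹` is the same
for all cells, so the identity can be summed over them. -/
theorem map_unfoldMap {ε : ℝ} (hε : 0 < ε) (ω : Set R2) :
    Measure.map (unfoldMap ε) ((volume.restrict (cellUnion ε ω)).prod (volume.restrict Y)) =
      ENNReal.ofReal ε⁻¹ • volume.restrict (cellUnion ε ω ×ˢ Ioo 0 ε) := by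
  have hdisj : Pairwise (Function.onFun Disjoint fun ξ : cellsIn ε ω => cell ε ξ) := by
    intro ξ ζ hne
    rw [Function.onFun, Set.disjoint_left]
    intro x h1 h2
    exact hne (Subtype.ext ((cellIndex_of_mem hε h1).symm.trans (cellIndex_of_mem hε h2)))
  have h1 : (volume : Measure R2).restrict (cellUnion ε ω) =
      Measure.sum fun ξ : cellsIn ε ω => volume.restrict (cell ε ξ) :=
    Measure.restrict_iUnion hdisj fun ξ => (isOpen_cell hε ξ).measurableSet
  have h2 : (volume : Measure R3).restrict (cellUnion ε ω ×ˢ Ioo 0 ε) =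
      Measure.sum fun ξ : cellsIn ε ω => volume.restrict (cell ε ξ ×ˢ Ioo 0 ε) := by
    rw [cellUnion, iUnion_prod_const]
    refine Measure.restrict_iUnion ?_ fun ξ => (isOpen_cell hε ξ).measurableSet.prod measurableSet_Ioo
    intro ξ ζ hne
    exact Set.disjoint_prod.2 (Or.inl (hdisj hne))
  have h3 : ∀ ξ : ℤ × ℤ, Measure.map (unfoldMap ε)
      ((volume.restrict (cell ε ξ)).prod (volume.restrict Y)) =
        ENNReal.ofReal ε⁻¹ • volume.restrict (cell ε ξ ×ˢ Ioo 0 ε) := by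
    intro ξ
    have e1 : unfoldMap ε =ᵐ[(volume.restrict (cell ε ξ)).prod (volume.restrict Y)]
        (cellMap ε hε.ne' ξ) ∘ Prod.snd := by
      have : ∀ᵐ p ∂((volume.restrict (cell ε ξ)).prod (volume.restrict Y)), p.1 ∈ cell ε ξ :=
        Measure.quasiMeasurePreserving_fst.ae (ae_restrict_mem (isOpen_cell hε ξ).measurableSet)
      filter_upwards [this] with p hp
      rw [unfoldMap, cellIndex_of_mem hε hp, Function.comp_apply, cellMap_apply]
    rw [Measure.map_congr e1, ← Measure.map_map (Homeomorph.measurable _) measurable_snd,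
      Measure.map_snd_prod, Measure.map_smul, Measure.restrict_apply_univ, volume_cell hε,
      ← preimage_cellMap hε ξ, ← (cellMap ε hε.ne' ξ).measurableEmbedding.restrict_map,
      map_cellMap hε, Measure.restrict_smul, smul_smul, ← ENNReal.ofReal_mul (by positivity)]
    congr 2
    field_simp
  rw [h1, Measure.prod_sum_left, Measure.map_sum (measurable_unfoldMap ε).aemeasurable, h2]
  ext s hs
  rw [Measure.smul_apply, Measure.sum_apply _ hs, Measure.sum_apply _ hs, smul_eq_mul,
    ← ENNReal.tsum_mul_left]
  refine tsum_congr fun ξ => ?_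
  rw [h3 ξ, Measure.smul_apply, smul_eq_mul]

theorem integrable_comp_unfoldMap {ε : ℝ} (hε : 0 < ε) {ω : Set R2} {H : R3 → ℝ}
    (hH : Integrable H (volume.restrict (cellUnion ε ω ×ˢ Ioo 0 ε))) :
    Integrable (fun p => H (unfoldMap ε p))
      ((volume.restrict (cellUnion ε ω)).prod (volume.restrict Y)) := by
  have h1 : Integrable H (Measure.map (unfoldMap ε)
      ((volume.restrict (cellUnion ε ω)).prod (volume.restrict Y))) := by
    rw [map_unfoldMap hε]
    exact hH.smul_measure ENNReal.ofReal_ne_top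
  exact h1.comp_measurable (measurable_unfoldMap ε)

theorem integral_comp_unfoldMap {ε : ℝ} (hε : 0 < ε) {ω : Set R2} {H : R3 → ℝ}
    (hH : Integrable H (volume.restrict (cellUnion ε ω ×ˢ Ioo 0 ε))) :
    ∫ p, H (unfoldMap ε p) ∂((volume.restrict (cellUnion ε ω)).prod (volume.restrict Y)) =
      ε⁻¹ * ∫ x in cellUnion ε ω ×ˢ Ioo 0 ε, H x := by
  have h1 : AEStronglyMeasurable H (Measure.map (unfoldMap ε)
      ((volume.restrict (cellUnion ε ω)).prod (volume.restrict Y))) := by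
    rw [map_unfoldMap hε]
    exact (hH.smul_measure ENNReal.ofReal_ne_top).1
  rw [← integral_map (measurable_unfoldMap ε).aemeasurable h1, map_unfoldMap hε,
    integral_smul_measure, ENNReal.toReal_ofReal (inv_pos.2 hε).le, smul_eq_mul]

/-! ### The unfolded functions as elements of `L²(ω; H¹(Y))` -/

section Unfold
variable {ω : Set R2} {L ε : ℝ}

theorem layer_subset (hL : ε < L) (hL0 : 0 < L) : OmM ω ε ⊆ Om ω L :=
  prod_mono subset_rfl (Ioo_subset_Ioo (by linarith) hL.le)

theorem hasWeakPd_cell {U : Set R3} (hε : 0 < ε) (φ : H1 U) (hU : OmM ω ε ⊆ U)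
    {ξ : ℤ × ℤ} (hξ : ξ ∈ cellsIn ε ω) (i : Fin 3) :
    HasWeakPd Y i (fun y => fn φ (cellMap ε hε.ne' ξ y))
      (fun y => ε * grad φ i (cellMap ε hε.ne' ξ y)) := by
  refine (hasWeakPd φ i).comp_aff _ _ _ ?_
  have : cell ε ξ ×ˢ Ioo 0 ε ⊆ U := (prod_mono hξ subset_rfl).trans hU
  exact (preimage_cellMap hε ξ).ge.trans (preimage_mono this)

open Classical in
/-- The unfolded function on the cell with index `ξ`. -/
def unfoldCell {U : Set R3} (hε : 0 < ε) (φ : H1 U) (hU : OmM ω ε ⊆ U) (ξ : ℤ × ℤ) : H1 Y :=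
  if hξ : ξ ∈ cellsIn ε ω then ofFun (hasWeakPd_cell hε φ hU hξ) else 0

/-- `φ² + ε² |∇φ|²`. -/
def energy {U : Set R3} (φ : H1 U) (ε : ℝ) (x : R3) : ℝ :=
  fn φ x ^ 2 + ∑ i, ε ^ 2 * grad φ i x ^ 2

theorem integrable_energy {U U' : Set R3} (φ : H1 U) (ε : ℝ) (hU : U' ⊆ U) :
    Integrable (energy φ ε) (volume.restrict U') := by
  have h : ∀ i, HasWeakPd U' i (fn φ) (grad φ i) := fun i => (hasWeakPd φ i).mono hU
  exact (h 0).memLp.integrable_sq.add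
    (integrable_finsetSum _ fun i _ => (h i).memLp_pd.integrable_sq.const_mul _)

/-- The `y`-gradient of `φ(ε(ξ + y))` is `ε ∇φ`, whence the weight `ε²` in `energy`. -/
theorem norm_sq_unfoldCell {U : Set R3} (hε : 0 < ε) (φ : H1 U) (hU : OmM ω ε ⊆ U)
    {x : R2} (hx : cellIndex ε x ∈ cellsIn ε ω) :
    ‖unfoldCell hε φ hU (cellIndex ε x)‖ ^ 2 = ∫ y in Y, energy φ ε (unfoldMap ε (x, y)) := by
  have h := hasWeakPd_cell hε φ hU hx
  rw [unfoldCell, dif_pos hx, norm_sq_ofFun, ← integral_finsetSum, ← integral_add]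
  · congr 1 with y
    simp only [energy, unfoldMap, cellMap_apply, mul_pow]
  · exact (h 0).memLp.integrable_sq
  · exact integrable_finsetSum _ fun i _ => (h i).memLp_pd.integrable_sq
  · exact fun i _ => (h i).memLp_pd.integrable_sq

theorem unfoldCell_of_notMem {U : Set R3} (hε : 0 < ε) (φ : H1 U) (hU : OmM ω ε ⊆ U)
    {ξ : ℤ × ℤ} (hx : ξ ∉ cellsIn ε ω) : unfoldCell hε φ hU ξ = 0 := by
  rw [unfoldCell, dif_neg hx]

theorem cellUnion_prod_subset (ω : Set R2) (ε : ℝ) : cellUnion ε ω ×ˢ Ioo 0 ε ⊆ OmM ω ε :=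
  prod_mono (cellUnion_subset ε ω) subset_rfl

theorem norm_sq_unfoldCell_ae {U : Set R3} (hε : 0 < ε) (φ : H1 U) (hU : OmM ω ε ⊆ U) :
    (fun x => ‖unfoldCell hε φ hU (cellIndex ε x)‖ ^ 2) =ᵐ[volume.restrict ω]
      (cellUnion ε ω).indicator fun x => ∫ y in Y, energy φ ε (unfoldMap ε (x, y)) := by
  filter_upwards [ae_restrict_of_ae (ae_mem_cell hε)] with x hx
  by_cases h : x ∈ cellUnion ε ω
  · rw [indicator_of_mem h, norm_sq_unfoldCell hε φ hU ((mem_cellUnion_iff hε hx).1 h)]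
  · rw [indicator_of_notMem h,
      unfoldCell_of_notMem hε φ hU fun h' => h ((mem_cellUnion_iff hε hx).2 h')]
    simp

theorem integrable_energy_comp {U : Set R3} (hε : 0 < ε) (φ : H1 U) (hU : OmM ω ε ⊆ U) :
    Integrable (fun p => energy φ ε (unfoldMap ε p))
      ((volume.restrict (cellUnion ε ω)).prod (volume.restrict Y)) :=
  integrable_comp_unfoldMap hε (integrable_energy φ ε ((cellUnion_prod_subset ω ε).trans hU))

theorem restrict_restrict_cellUnion (hε : 0 < ε) :
    ((volume : Measure R2).restrict ω).restrict (cellUnion ε ω) =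
      volume.restrict (cellUnion ε ω) := by
  rw [Measure.restrict_restrict (measurableSet_cellUnion hε ω),
    inter_eq_left.2 (cellUnion_subset ε ω)]

theorem memLp_unfoldCell {U : Set R3} (hε : 0 < ε) (φ : H1 U) (hU : OmM ω ε ⊆ U) :
    MemLp (fun x => unfoldCell hε φ hU (cellIndex ε x)) 2 (volume.restrict ω) := by
  -- The map factors through the countable discrete set of cell indices, so measurability into `H1
  -- Y` is automatic.
  have hm : StronglyMeasurable fun x => unfoldCell hε φ hU (cellIndex ε x) :=
    (StronglyMeasurable.of_discrete (f := unfoldCell hε φ hU)).comp_measurable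
      (measurable_cellIndex ε)
  rw [memLp_two_iff_integrable_sq_norm hm.aestronglyMeasurable]
  refine Integrable.congr ?_ (norm_sq_unfoldCell_ae hε φ hU).symm
  rw [integrable_indicator_iff (measurableSet_cellUnion hε ω), IntegrableOn,
    restrict_restrict_cellUnion hε]
  exact (integrable_energy_comp hε φ hU).integral_prod_left

/-- The unfolded function `T_ε(φ) ∈ L²(ω; H¹(Y))`. -/
def unfoldH1 {U : Set R3} (hε : 0 < ε) (φ : H1 U) (hU : OmM ω ε ⊆ U) : L2H1 ω :=
  (memLp_unfoldCell hε φ hU).toLp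

theorem unfoldH1_ae {U : Set R3} (hε : 0 < ε) (φ : H1 U) (hU : OmM ω ε ⊆ U) :
    ∀ᵐ x ∂(volume.restrict ω),
      unfoldH1 hε φ hU x = unfoldCell hε φ hU (cellIndex ε x) :=
  (memLp_unfoldCell hε φ hU).coeFn_toLp

theorem fn_unfoldH1 {U : Set R3} (hε : 0 < ε) (φ : H1 U) (hU : OmM ω ε ⊆ U) :
    ∀ᵐ x ∂(volume.restrict ω),
      fn (unfoldH1 hε φ hU x) =ᵐ[volume.restrict Y] unfold ω ε (fn φ) x := by
  filter_upwards [unfoldH1_ae hε φ hU] with x hx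
  rw [hx]
  by_cases h : cellIndex ε x ∈ cellsIn ε ω
  · rw [unfoldCell, dif_pos h]
    refine (fn_ofFun _).trans (Eventually.of_forall fun y => ?_)
    simp only [unfold, if_pos h, cellMap_apply]
  · rw [unfoldCell_of_notMem hε φ hU h]
    have : fn (0 : H1 Y) =ᵐ[volume.restrict Y] 0 := Lp.coeFn_zero ℝ 2 _
    filter_upwards [this] with y hy
    simp only [hy, unfold, if_neg h, Pi.zero_apply]

/-- On the complete cells the change of variables is an equality with factor `ε⁻¹`; the inequality
comes from adding the part of the layer over the incomplete cells, where the unfolded function is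
zero. -/
theorem norm_sq_unfoldH1_le {U : Set R3} (hε : 0 < ε) (φ : H1 U) (hU : OmM ω ε ⊆ U) :
    ‖unfoldH1 hε φ hU‖ ^ 2 ≤ ε⁻¹ * ∫ x in OmM ω ε, energy φ ε x := by
  have h1 : ‖unfoldH1 hε φ hU‖ ^ 2 =
      ∫ x in ω, ‖unfoldCell hε φ hU (cellIndex ε x)‖ ^ 2 := by
    rw [← real_inner_self_eq_norm_sq (unfoldH1 hε φ hU), L2.inner_def]
    apply integral_congr_ae
    filter_upwards [unfoldH1_ae hε φ hU] with x hx
    rw [hx, real_inner_self_eq_norm_sq]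
  rw [h1, integral_congr_ae (norm_sq_unfoldCell_ae hε φ hU),
    integral_indicator (measurableSet_cellUnion hε ω), restrict_restrict_cellUnion hε,
    ← integral_prod _ (integrable_energy_comp hε φ hU), integral_comp_unfoldMap hε
      (integrable_energy φ ε ((cellUnion_prod_subset ω ε).trans hU))]
  refine mul_le_mul_of_nonneg_left ?_ (inv_pos.2 hε).le
  refine setIntegral_mono_set (integrable_energy φ ε hU) (Eventually.of_forall fun x => ?_)
    (cellUnion_prod_subset ω ε).eventuallyLE
  exact add_nonneg (sq_nonneg _) (Finset.sum_nonneg fun i _ => by positivity)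

end Unfold

/-! ### Pairing the unfolded functions with test functions -/

theorem MemLp.comp_unfoldMap {ε : ℝ} (hε : 0 < ε) {ω : Set R2} {H : R3 → ℝ}
    (hH : MemLp H 2 (volume.restrict (cellUnion ε ω ×ˢ Ioo 0 ε))) :
    MemLp (fun p => H (unfoldMap ε p)) 2
      ((volume.restrict (cellUnion ε ω)).prod (volume.restrict Y)) := by
  have h1 : MemLp H 2 (Measure.map (unfoldMap ε)
      ((volume.restrict (cellUnion ε ω)).prod (volume.restrict Y))) := by
    rw [map_unfoldMap hε]
    exact hH.smul_measure ENNReal.ofReal_ne_top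
  exact (memLp_map_measure_iff h1.1 (measurable_unfoldMap ε).aemeasurable).1 h1

theorem dist_unfoldMap_le {ε : ℝ} (hε : 0 < ε) {x : R2} {y : R3}
    (hx : x ∈ cell ε (cellIndex ε x)) (hy : y ∈ Y) : dist x (unfoldMap ε (x, y)).1 ≤ ε := by
  rw [cell_eq hε] at hx
  obtain ⟨⟨h1, h2⟩, h3, h4⟩ := hx
  obtain ⟨⟨⟨k1, k2⟩, k3, k4⟩, -⟩ := hy
  rw [Prod.dist_eq, max_le_iff, Real.dist_eq, Real.dist_eq, abs_le, abs_le]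
  simp only [unfoldMap]
  refine ⟨⟨?_, ?_⟩, ?_, ?_⟩ <;> nlinarith

theorem cell_subset_closedBall {ε : ℝ} (hε : 0 < ε) {x : R2} (hx : x ∈ cell ε (cellIndex ε x)) :
    cell ε (cellIndex ε x) ⊆ Metric.closedBall x ε := by
  intro z hz
  rw [cell_eq hε] at hx hz
  obtain ⟨⟨h1, h2⟩, h3, h4⟩ := hx
  obtain ⟨⟨k1, k2⟩, k3, k4⟩ := hz
  rw [Metric.mem_closedBall, Prod.dist_eq, max_le_iff, Real.dist_eq, Real.dist_eq, abs_le, abs_le]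
  refine ⟨⟨?_, ?_⟩, ?_, ?_⟩ <;> linarith

theorem volume_real_Y : (volume : Measure R3).real Y = 1 := by
  have : (volume : Measure R3) Y = 1 := by
    rw [Measure.volume_eq_prod R2 ℝ, Measure.prod_prod, Measure.volume_eq_prod, Measure.prod_prod]
    simp
  rw [measureReal_def, this, ENNReal.toReal_one]

/-- A function on the layer that pairs `φ` and `ε ∂ᵢφ` with oscillating coefficients. -/
def oscPair {U : Set R3} (φ : H1 U) (i : Fin 3) (h k : R3 → ℝ) (ε : ℝ) (x : R3) : ℝ :=
  fn φ x * h (ε⁻¹ • x) + ε * grad φ i x * k (ε⁻¹ • x)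

section Osc
variable {U : Set R3} {φ : H1 U} {i : Fin 3} {h k : R3 → ℝ} {ε B : ℝ} {ω : Set R2}

theorem memLp_oscPair {U' : Set R3} (hU : U' ⊆ U) (hh : Continuous h) (hk : Continuous k)
    (hhB : ∀ x, |h x| ≤ B) (hkB : ∀ x, |k x| ≤ B) :
    MemLp (oscPair φ i h k ε) 2 (volume.restrict U') := by
  have w := (hasWeakPd φ i).mono hU
  exact (memLp_mul_bdd w.memLp (hh.comp (continuous_const_smul ε⁻¹)) fun x => hhB _).add
    (memLp_mul_bdd (w.memLp_pd.const_mul ε) (hk.comp (continuous_const_smul ε⁻¹)) fun x => hkB _)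

theorem oscPair_sq_le (hhB : ∀ x, |h x| ≤ B) (hkB : ∀ x, |k x| ≤ B) (x : R3) :
    oscPair φ i h k ε x ^ 2 ≤ 2 * B ^ 2 * energy φ ε x := by
  have h1 : h (ε⁻¹ • x) ^ 2 ≤ B ^ 2 := sq_le_sq' (by linarith [abs_le.1 (hhB (ε⁻¹ • x))])
    (abs_le.1 (hhB (ε⁻¹ • x))).2
  have h2 : k (ε⁻¹ • x) ^ 2 ≤ B ^ 2 := sq_le_sq' (by linarith [abs_le.1 (hkB (ε⁻¹ • x))])
    (abs_le.1 (hkB (ε⁻¹ • x))).2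
  have h3 : ε ^ 2 * grad φ i x ^ 2 ≤ ∑ j, ε ^ 2 * grad φ j x ^ 2 :=
    Finset.single_le_sum (f := fun j => ε ^ 2 * grad φ j x ^ 2) (fun j _ => by positivity)
      (Finset.mem_univ i)
  have h4 := mul_le_mul_of_nonneg_left h1 (sq_nonneg (fn φ x))
  have h5 := mul_le_mul_of_nonneg_left h2 (sq_nonneg (ε * grad φ i x))
  have h6 := mul_le_mul_of_nonneg_left h3 (sq_nonneg B)
  have h7 := two_mul_le_add_sq (fn φ x * h (ε⁻¹ • x)) (ε * grad φ i x * k (ε⁻¹ • x))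
  simp only [oscPair, energy]
  nlinarith

/-- At the point `x = ε(ξ + y)` periodicity gives `h(x/ε) = h(y)`, so the coefficients can be
written as functions on the layer that do not depend on the cell. -/
theorem greenL_unfoldCell (hε : 0 < ε) (hU : OmM ω ε ⊆ U)
    (hper : ∀ (m : ℤ × ℤ), ∀ y ∈ Y, h ((m.1 + y.1.1, m.2 + y.1.2), y.2) = h y)
    (kper : ∀ (m : ℤ × ℤ), ∀ y ∈ Y, k ((m.1 + y.1.1, m.2 + y.1.2), y.2) = k y)
    (hhL : MemLp h 2 (volume.restrict Y)) (hkL : MemLp k 2 (volume.restrict Y)) {x : R2}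
    (hx : cellIndex ε x ∈ cellsIn ε ω) :
    greenL i hhL hkL (unfoldCell hε φ hU (cellIndex ε x)) =
      ∫ y in Y, oscPair φ i h k ε (unfoldMap ε (x, y)) := by
  rw [greenL_apply, unfoldCell, dif_pos hx]
  apply integral_congr_ae
  filter_upwards [fn_ofFun (hasWeakPd_cell hε φ hU hx), grad_ofFun (hasWeakPd_cell hε φ hU hx) i,
    ae_restrict_mem measurableSet_Y] with y h1 h2 hy
  have e : ε⁻¹ • unfoldMap ε (x, y) =
      (((cellIndex ε x).1 + y.1.1, (cellIndex ε x).2 + y.1.2), y.2) := by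
    ext <;> simp [unfoldMap] <;> field_simp
  rw [h1, h2, oscPair, e, hper _ _ hy, kper _ _ hy, cellMap_apply]
  rfl

/-- The pairing of the unfolded function with a test function is asymptotically the pairing of
the original function with an oscillating test function. -/
theorem exists_unfold_pairing_error (hω : IsOpen ω) {κ : R2 → ℝ} (hκ : IsTest2 ω κ)
    (i : Fin 3) (hh : Continuous h) (hk : Continuous k)
    (hhB : ∀ x, |h x| ≤ B) (hkB : ∀ x, |k x| ≤ B)
    (hper : ∀ (m : ℤ × ℤ), ∀ y ∈ Y, h ((m.1 + y.1.1, m.2 + y.1.2), y.2) = h y)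
    (kper : ∀ (m : ℤ × ℤ), ∀ y ∈ Y, k ((m.1 + y.1.1, m.2 + y.1.2), y.2) = k y)
    (hhL : MemLp h 2 (volume.restrict Y)) (hkL : MemLp k 2 (volume.restrict Y)) (M : ℝ) :
    ∃ C ε₀ : ℝ, 0 < ε₀ ∧ ∀ (ε : ℝ) (hε : 0 < ε) (_ : ε < ε₀) (U : Set R3) (φ : H1 U)
      (hU : OmM ω ε ⊆ U), ε⁻¹ * ∫ x in OmM ω ε, energy φ ε x ≤ M →
        |(∫ x in ω, κ x * greenL i hhL hkL (unfoldH1 hε φ hU x)) -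
          ε⁻¹ * ∫ x in OmM ω ε, κ x.1 * oscPair φ i h k ε x| ≤ C * ε := by
  -- For `ε < δ` every cell that meets the support of `κ` lies in `ω` (up to null sets), so the
  -- incomplete cells contribute nothing.
  obtain ⟨δ, hδ, hδω⟩ := hκ.2.1.isCompact.exists_cthickening_subset_open hω hκ.2.2
  obtain ⟨Lc, hLc⟩ := hκ.1.lipschitzWith_of_hasCompactSupport hκ.2.1 (by simp)
  obtain ⟨Cκ, hCκ⟩ := hκ.2.1.exists_bound_of_continuous hκ.1.continuous
  -- Since `ε < 1`, the difference of `κ` at `x'` and at the unfolded point can be nonzero only for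
  -- `x'` in this compact set.
  set K' := Metric.cthickening 1 (tsupport κ) with hK'
  have hK'c : IsCompact K' := hκ.2.1.isCompact.cthickening
  set V := (volume : Measure R2).real K' with hV
  -- The constant comes from Cauchy–Schwarz: the increments of `κ` have squared norm at most `Lc² ε²
  -- V`, and the unfolded integrand at most `2 B² M`.
  refine ⟨√(Lc ^ 2 * V * (2 * B ^ 2 * M)), min δ 1, lt_min hδ one_pos, ?_⟩
  intro ε hε hεδ U φ hU hM
  set D := cellUnion ε ω with hD
  have hDm : MeasurableSet D := measurableSet_cellUnion hε ω
  set P := ((volume : Measure R2).restrict D).prod ((volume : Measure R3).restrict Y) with hP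
  set J := oscPair φ i h k ε with hJ
  have hDU : D ×ˢ Ioo 0 ε ⊆ U := (cellUnion_prod_subset ω ε).trans hU
  have hJL : MemLp J 2 (volume.restrict (D ×ˢ Ioo 0 ε)) := memLp_oscPair hDU hh hk hhB hkB
  have hJS : MemLp (fun p => J (unfoldMap ε p)) 2 P := MemLp.comp_unfoldMap hε hJL
  have hκfst : MemLp (fun p : R2 × R3 => κ p.1) 2 P := by
    refine MemLp.comp_fst (f := κ) ?_ _
    exact hκ.1.continuous.memLp_of_hasCompactSupport hκ.2.1
  have hκx : ∀ U' : Set R2, MemLp (fun x : R3 => κ x.1) 2 (volume.restrict (U' ×ˢ Ioo 0 ε)) := by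
    intro U'
    rw [volume_restrict_prod]
    have : IsFiniteMeasure ((volume : Measure ℝ).restrict (Ioo 0 ε)) := ⟨by simp⟩
    refine MemLp.comp_fst (f := κ) ?_ _
    exact hκ.1.continuous.memLp_of_hasCompactSupport hκ.2.1
  have hκS : MemLp (fun p : R2 × R3 => κ (unfoldMap ε p).1) 2 P :=
    MemLp.comp_unfoldMap hε (H := fun x : R3 => κ x.1) (hκx D)
  -- the left-hand side as an integral over `D × Y`
  have hleft : ∫ x in ω, κ x * greenL i hhL hkL (unfoldH1 hε φ hU x) =
      ∫ p, κ p.1 * J (unfoldMap ε p) ∂P := by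
    have e1 : (fun x => κ x * greenL i hhL hkL (unfoldH1 hε φ hU x)) =ᵐ[volume.restrict ω]
        D.indicator fun x => κ x * ∫ y in Y, J (unfoldMap ε (x, y)) := by
      filter_upwards [unfoldH1_ae hε φ hU, ae_restrict_of_ae (ae_mem_cell hε)] with x h1 h2
      rw [h1]
      by_cases hx : x ∈ D
      · rw [indicator_of_mem hx, greenL_unfoldCell hε hU hper kper hhL hkL
          ((mem_cellUnion_iff hε h2).1 hx)]
      · rw [indicator_of_notMem hx, unfoldCell_of_notMem hε φ hU fun h' =>
          hx ((mem_cellUnion_iff hε h2).2 h'), map_zero, mul_zero]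
    have i1 : Integrable (fun p : R2 × R3 => κ p.1 * J (unfoldMap ε p)) P :=
      hκfst.integrable_mul hJS
    rw [integral_congr_ae e1, integral_indicator hDm, restrict_restrict_cellUnion hε,
      integral_prod _ i1]
    congr 1 with x
    exact (integral_const_mul (κ x) fun y => J (unfoldMap ε (x, y))).symm
  -- the right-hand side as an integral over `D × Y`
  have hright : ε⁻¹ * ∫ x in OmM ω ε, κ x.1 * J x =
      ∫ p, κ (unfoldMap ε p).1 * J (unfoldMap ε p) ∂P := by
    have i1 : Integrable (fun x : R3 => κ x.1 * J x) (volume.restrict (D ×ˢ Ioo 0 ε)) :=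
      (hκx D).integrable_mul hJL
    have e1 := integral_comp_unfoldMap hε i1
    rw [e1]
    congr 1
    refine setIntegral_eq_of_subset_of_ae_sdiff_eq_zero ?_ (cellUnion_prod_subset ω ε) ?_
    · exact (hω.measurableSet.prod measurableSet_Ioo).nullMeasurableSet
    · have h1 : ∀ᵐ x : R3, x.1 ∈ cell ε (cellIndex ε x.1) :=
        Measure.quasiMeasurePreserving_fst.ae (ae_mem_cell hε)
      filter_upwards [h1] with x hx hx'
      have hκ0 : κ x.1 = 0 := by
        by_contra hne
        apply hx'.2
        refine ⟨(mem_cellUnion_iff hε hx).2 ?_, hx'.1.2⟩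
        refine (cell_subset_closedBall hε hx).trans (Subset.trans ?_ hδω)
        refine (Metric.closedBall_subset_cthickening (subset_tsupport _ hne) ε).trans ?_
        exact Metric.cthickening_mono (hεδ.le.trans (min_le_left _ _)) _
      rw [hκ0, zero_mul]
  have i1 : Integrable (fun p : R2 × R3 => κ p.1 * J (unfoldMap ε p)) P :=
    hκfst.integrable_mul hJS
  have i2 : Integrable (fun p : R2 × R3 => κ (unfoldMap ε p).1 * J (unfoldMap ε p)) P :=
    hκS.integrable_mul hJS
  rw [hleft, hright, ← integral_sub i1 i2]
  have hdiffL : MemLp (fun p : R2 × R3 => κ p.1 - κ (unfoldMap ε p).1) 2 P := hκfst.sub hκS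
  have hae : ∀ᵐ p ∂P, p.1 ∈ cell ε (cellIndex ε p.1) ∧ p.2 ∈ Y := by
    have a1 : ∀ᵐ p ∂P, p.1 ∈ cell ε (cellIndex ε p.1) :=
      Measure.quasiMeasurePreserving_fst.ae (ae_restrict_of_ae (ae_mem_cell hε))
    have a2 : ∀ᵐ p ∂P, p.2 ∈ Y :=
      Measure.quasiMeasurePreserving_snd.ae (ae_restrict_mem measurableSet_Y)
    filter_upwards [a1, a2] with p h1 h2 using ⟨h1, h2⟩
  have hA : ∫ p, (κ p.1 - κ (unfoldMap ε p).1) ^ 2 ∂P ≤ Lc ^ 2 * ε ^ 2 * V := by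
    have iInd : Integrable (fun p : R2 × R3 => K'.indicator (fun _ => (Lc : ℝ) ^ 2 * ε ^ 2) p.1) P := by
      refine Integrable.comp_fst (f := K'.indicator (fun _ => (Lc : ℝ) ^ 2 * ε ^ 2)) ?_ _
      rw [integrable_indicator_iff hK'c.measurableSet]
      refine integrableOn_const ?_
      exact ((Measure.restrict_apply_le _ _).trans_lt hK'c.measure_lt_top).ne
    calc ∫ p, (κ p.1 - κ (unfoldMap ε p).1) ^ 2 ∂P
        ≤ ∫ p, K'.indicator (fun _ => (Lc : ℝ) ^ 2 * ε ^ 2) p.1 ∂P := by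
          refine integral_mono_ae hdiffL.integrable_sq iInd ?_
          filter_upwards [hae] with p hp
          have hd := dist_unfoldMap_le hε hp.1 hp.2
          by_cases hpK : p.1 ∈ K'
          · rw [indicator_of_mem hpK, ← mul_pow]
            have h1 := hLc.dist_le_mul p.1 (unfoldMap ε p).1
            rw [Real.dist_eq] at h1
            have h2 : |κ p.1 - κ (unfoldMap ε p).1| ≤ Lc * ε :=
              h1.trans (mul_le_mul_of_nonneg_left hd (NNReal.coe_nonneg _))
            exact sq_le_sq' (by linarith [abs_le.1 h2]) (abs_le.1 h2).2
          · rw [indicator_of_notMem hpK]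
            have z1 : κ p.1 = 0 := by
              by_contra hne
              exact hpK (Metric.self_subset_cthickening _ (subset_tsupport _ hne))
            have z2 : κ (unfoldMap ε p).1 = 0 := by
              by_contra hne
              apply hpK
              refine Metric.mem_cthickening_of_dist_le _ _ _ _ (subset_tsupport _ hne) ?_
              exact hd.trans (hεδ.le.trans (min_le_right _ _))
            rw [z1, z2]; simp
      _ = ∫ x in D, K'.indicator (fun _ => (Lc : ℝ) ^ 2 * ε ^ 2) x := by
          rw [hP, integral_fun_fst (f := K'.indicator (fun _ => (Lc : ℝ) ^ 2 * ε ^ 2))]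
          rw [measureReal_restrict_apply_univ, volume_real_Y, one_smul]
      _ ≤ Lc ^ 2 * ε ^ 2 * V := by
          rw [integral_indicator hK'c.measurableSet, setIntegral_const, smul_eq_mul, mul_comm]
          refine mul_le_mul_of_nonneg_left ?_ (by positivity)
          refine ENNReal.toReal_mono hK'c.measure_lt_top.ne (Measure.restrict_apply_le _ _)
  have hB : ∫ p, J (unfoldMap ε p) ^ 2 ∂P ≤ 2 * B ^ 2 * M := by
    rw [integral_comp_unfoldMap (H := fun x => J x ^ 2) hε hJL.integrable_sq]
    have iE := integrable_energy φ ε hU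
    have hE0 : ∀ x, 0 ≤ 2 * B ^ 2 * energy φ ε x := fun x =>
      mul_nonneg (by positivity)
        (add_nonneg (sq_nonneg _) (Finset.sum_nonneg fun i _ => by positivity))
    calc ε⁻¹ * ∫ x in D ×ˢ Ioo 0 ε, J x ^ 2
        ≤ ε⁻¹ * ∫ x in D ×ˢ Ioo 0 ε, 2 * B ^ 2 * energy φ ε x := by
          refine mul_le_mul_of_nonneg_left ?_ (inv_pos.2 hε).le
          exact integral_mono hJL.integrable_sq ((integrable_energy φ ε hDU).const_mul _)
            fun x => oscPair_sq_le hhB hkB x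
      _ ≤ ε⁻¹ * ∫ x in OmM ω ε, 2 * B ^ 2 * energy φ ε x := by
          refine mul_le_mul_of_nonneg_left ?_ (inv_pos.2 hε).le
          exact setIntegral_mono_set (iE.const_mul _) (Eventually.of_forall hE0)
            (cellUnion_prod_subset ω ε).eventuallyLE
      _ = 2 * B ^ 2 * (ε⁻¹ * ∫ x in OmM ω ε, energy φ ε x) := by
          rw [integral_const_mul]; ring
      _ ≤ 2 * B ^ 2 * M := mul_le_mul_of_nonneg_left hM (by positivity)
  have hfin := abs_integral_mul_le hdiffL hJS hA hB
  have e1 : ∫ p, (κ p.1 * J (unfoldMap ε p) - κ (unfoldMap ε p).1 * J (unfoldMap ε p)) ∂P =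
      ∫ p, (κ p.1 - κ (unfoldMap ε p).1) * J (unfoldMap ε p) ∂P := by
    congr 1 with p
    ring
  rw [e1]
  refine hfin.trans (le_of_eq ?_)
  rw [show (Lc : ℝ) ^ 2 * ε ^ 2 * V * (2 * B ^ 2 * M) = Lc ^ 2 * V * (2 * B ^ 2 * M) * ε ^ 2 by ring,
    Real.sqrt_mul' _ (sq_nonneg ε), Real.sqrt_sq hε.le]

end Osc

/-! ### Integrals over thin slabs -/

/-- Cauchy–Schwarz: a bounded function supported in a slab of thickness `d - c` over a compact set
has `L²` norm of order `√(d - c)`. This is the source of the powers of `ε` in the estimates below.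
-/
theorem abs_setIntegral_mul_le_slab {U : Set R3} {f G : R3 → ℝ} {K : Set R2} {c d M B : ℝ}
    (hf : MemLp f 2 (volume.restrict U)) (hM : ∫ x in U, f x ^ 2 ≤ M) (hK : IsCompact K)
    (hG : Continuous G) (hB : ∀ x, |G x| ≤ B) (hcd : c ≤ d)
    (h0 : ∀ x ∈ U, G x ≠ 0 → x.1 ∈ K ∧ x.2 ∈ Icc c d) (hU : MeasurableSet U) :
    |∫ x in U, f x * G x| ≤ √(M * (B ^ 2 * ((volume : Measure R2).real K * (d - c)))) := by
  have hKc : IsCompact (K ×ˢ Icc c d) := hK.prod isCompact_Icc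
  have hvol : (volume : Measure R3).real (K ×ˢ Icc c d) = (volume : Measure R2).real K * (d - c) := by
    rw [Measure.volume_eq_prod, measureReal_prod_prod, Real.volume_real_Icc_of_le hcd]
  have hle : ∀ᵐ x ∂(volume.restrict U), G x ^ 2 ≤ (K ×ˢ Icc c d).indicator (fun _ => B ^ 2) x := by
    filter_upwards [ae_restrict_mem hU] with x hxU
    by_cases hx : x ∈ K ×ˢ Icc c d
    · rw [indicator_of_mem hx]
      exact sq_le_sq' (by linarith [abs_le.1 (hB x)]) (abs_le.1 (hB x)).2
    · rw [indicator_of_notMem hx]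
      have : G x = 0 := by
        by_contra hne
        exact hx (h0 x hxU hne)
      rw [this]; simp
  have iInd : Integrable ((K ×ˢ Icc c d).indicator (fun _ => B ^ 2)) (volume.restrict U) := by
    rw [integrable_indicator_iff hKc.measurableSet]
    refine integrableOn_const ?_
    exact ((Measure.restrict_apply_le _ _).trans_lt hKc.measure_lt_top).ne
  have hGL : MemLp G 2 (volume.restrict U) := by
    rw [memLp_two_iff_integrable_sq hG.aestronglyMeasurable]
    refine iInd.mono' (hG.pow 2).aestronglyMeasurable ?_
    filter_upwards [hle] with x hx
    rwa [Real.norm_eq_abs, abs_of_nonneg (sq_nonneg _)]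
  refine abs_integral_mul_le hf hGL hM ?_
  refine (integral_mono_ae hGL.integrable_sq iInd hle).trans ?_
  rw [integral_indicator hKc.measurableSet, setIntegral_const, smul_eq_mul, mul_comm]
  refine mul_le_mul_of_nonneg_left ?_ (sq_nonneg B)
  rw [← hvol]
  exact ENNReal.toReal_mono hKc.measure_lt_top.ne (Measure.restrict_apply_le _ _)

/-! ### Oscillating test functions -/

theorem IsTest2.mul_smooth {ω : Set R2} {κ F : R2 → ℝ} (h : IsTest2 ω κ)
    (hF : ContDiff ℝ ((⊤ : ℕ∞) : WithTop ℕ∞) F) : IsTest2 ω (fun z => κ z * F z) :=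
  ⟨h.1.mul hF, h.2.1.mul_right, tsupport_mul_subset_left.trans h.2.2⟩

theorem contDiff_mul_fst_snd {a b : ℝ → ℝ} (ha : ContDiff ℝ ((⊤ : ℕ∞) : WithTop ℕ∞) a)
    (hb : ContDiff ℝ ((⊤ : ℕ∞) : WithTop ℕ∞) b) :
    ContDiff ℝ ((⊤ : ℕ∞) : WithTop ℕ∞) (fun z : R2 => a z.1 * b z.2) :=
  (ha.comp contDiff_fst).mul (hb.comp contDiff_snd)

theorem fderiv_mul_mul {κ : R2 → ℝ} {a b : ℝ → ℝ} (hκ : Differentiable ℝ κ)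
    (ha : Differentiable ℝ a) (hb : Differentiable ℝ b) (z v : R2) :
    fderiv ℝ (fun z : R2 => κ z * (a z.1 * b z.2)) z v = fderiv ℝ κ z v * (a z.1 * b z.2) +
      κ z * (v.1 * deriv a z.1 * b z.2 + v.2 * a z.1 * deriv b z.2) := by
  have h2 : Differentiable ℝ (fun z : R2 => a z.1 * b z.2) :=
    (ha.comp differentiable_fst).mul (hb.comp differentiable_snd)
  rw [fderiv_fun_mul (hκ z) (h2 z), ← fderiv_mul_fst_snd ha hb]
  simp only [add_apply, smul_apply, smul_eq_mul]
  ring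

theorem contDiff_rescale {a : ℝ → ℝ} (ha : ContDiff ℝ ((⊤ : ℕ∞) : WithTop ℕ∞) a) (s : ℝ) :
    ContDiff ℝ ((⊤ : ℕ∞) : WithTop ℕ∞) (fun t => a (s * t)) :=
  ha.comp (contDiff_const.mul contDiff_id)

theorem deriv_rescale {a : ℝ → ℝ} (ha : Differentiable ℝ a) (s t : ℝ) :
    deriv (fun t => a (s * t)) t = s * deriv a (s * t) := by
  have h := (ha (s * t)).hasDerivAt.comp t ((hasDerivAt_id t).const_mul s)
  refine h.deriv.trans ?_
  ring

theorem tsupport_rescale {a : ℝ → ℝ} {p q ε : ℝ} (hε : 0 < ε) (h : tsupport a ⊆ Icc p q) :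
    tsupport (fun t => a (ε⁻¹ * t)) ⊆ Icc (ε * p) (ε * q) := by
  refine closure_minimal ?_ isClosed_Icc
  intro t ht
  have := h (subset_tsupport a (show a (ε⁻¹ * t) ≠ 0 from ht))
  rw [mem_Icc, inv_mul_eq_div, le_div_iff₀ hε, div_le_iff₀ hε] at this
  constructor <;> linarith [this.1, this.2]

/-- A test function whose planar factor oscillates at the scale `ε`. -/
def oscTest (κ : R2 → ℝ) (a b c : ℝ → ℝ) (ε : ℝ) (x : R3) : ℝ :=
  κ x.1 * (a (ε⁻¹ * x.1.1) * b (ε⁻¹ * x.1.2)) * c (ε⁻¹ * x.2)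

section OscTest
variable {ω : Set R2} {κ : R2 → ℝ} {a b c : ℝ → ℝ} {ε p q : ℝ}

theorem isTest_oscTest (hκ : IsTest2 ω κ) (ha : ContDiff ℝ ((⊤ : ℕ∞) : WithTop ℕ∞) a)
    (hb : ContDiff ℝ ((⊤ : ℕ∞) : WithTop ℕ∞) b) (hc : ContDiff ℝ ((⊤ : ℕ∞) : WithTop ℕ∞) c)
    (hε : 0 < ε) (hs : tsupport c ⊆ Icc p q) {J : Set ℝ} (hJ : Icc (ε * p) (ε * q) ⊆ J) :
    IsTest (ω ×ˢ J) (oscTest κ a b c ε) :=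
  (hκ.mul_smooth (contDiff_mul_fst_snd (contDiff_rescale ha ε⁻¹)
    (contDiff_rescale hb ε⁻¹))).mul_snd (contDiff_rescale hc ε⁻¹)
    (isCompact_Icc.of_isClosed_subset (isClosed_tsupport _) (tsupport_rescale hε hs))
    ((tsupport_rescale hε hs).trans hJ)

theorem pd_oscTest (hκ : Differentiable ℝ κ) (ha : Differentiable ℝ a) (hb : Differentiable ℝ b)
    (hc : Differentiable ℝ c) (ε : ℝ) (i : Fin 3) (x : R3) : pd i (oscTest κ a b c ε) x =
      (fderiv ℝ κ x.1 (dir i).1 * (a (ε⁻¹ * x.1.1) * b (ε⁻¹ * x.1.2)) +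
        κ x.1 * ((dir i).1.1 * (ε⁻¹ * deriv a (ε⁻¹ * x.1.1)) * b (ε⁻¹ * x.1.2) +
          (dir i).1.2 * a (ε⁻¹ * x.1.1) * (ε⁻¹ * deriv b (ε⁻¹ * x.1.2)))) * c (ε⁻¹ * x.2) +
      κ x.1 * (a (ε⁻¹ * x.1.1) * b (ε⁻¹ * x.1.2)) * ((dir i).2 * (ε⁻¹ * deriv c (ε⁻¹ * x.2))) := by
  have r : ∀ {a : ℝ → ℝ}, Differentiable ℝ a → Differentiable ℝ fun t => a (ε⁻¹ * t) :=
    fun h => h.comp (differentiable_id.const_mul ε⁻¹)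
  have h2 : Differentiable ℝ (fun z : R2 => κ z * (a (ε⁻¹ * z.1) * b (ε⁻¹ * z.2))) :=
    hκ.mul (((r ha).comp differentiable_fst).mul ((r hb).comp differentiable_snd))
  have := pd_mul_fst_snd h2 (r hc) i x
  rw [fderiv_mul_mul hκ (r ha) (r hb), deriv_rescale ha, deriv_rescale hb, deriv_rescale hc] at this
  exact this

end OscTest

/-! ### Oscillating traces -/

theorem exists_bound_per {α : ℝ → ℝ} (h : IsTest01 α) : ∃ M, 0 ≤ M ∧ ∀ t, |per α t| ≤ M :=
  exists_bound_of_periodic (contDiff_per h).continuous (per_add_one α)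

theorem IsTest2.exists_bound {ω : Set R2} {κ : R2 → ℝ} (h : IsTest2 ω κ) :
    ∃ M, 0 ≤ M ∧ ∀ z, |κ z| ≤ M := by
  obtain ⟨M, hM⟩ := h.2.1.exists_bound_of_continuous h.1.continuous
  exact ⟨M, (norm_nonneg _).trans (hM 0), hM⟩

theorem IsTest2.continuous_fderiv {ω : Set R2} {κ : R2 → ℝ} (h : IsTest2 ω κ) (v : R2) :
    Continuous fun z => fderiv ℝ κ z v :=
  (h.1.continuous_fderiv (by simp)).clm_apply continuous_const

theorem IsTest2.exists_bound_fderiv {ω : Set R2} {κ : R2 → ℝ} (h : IsTest2 ω κ) (v : R2) :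
    ∃ M, 0 ≤ M ∧ ∀ z, |fderiv ℝ κ z v| ≤ M := by
  obtain ⟨M, hM⟩ := (h.2.1.fderiv_apply ℝ v).exists_bound_of_continuous (h.continuous_fderiv v)
  exact ⟨M, (norm_nonneg _).trans (hM 0), hM⟩

theorem fderiv_ne_zero_mem {κ : R2 → ℝ} {z v : R2} (h : fderiv ℝ κ z v ≠ 0) : z ∈ tsupport κ :=
  tsupport_fderiv_apply_subset ℝ v (subset_tsupport _ h)

/-- Green's formula with boundary values `g` on the face `x₃ = b` of `S × (a, b)`. -/
def HasUpperTrace (S : Set R2) (a b : ℝ) (f d : R3 → ℝ) (g : R2 → ℝ) : Prop :=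
  ∀ ψ : R3 → ℝ, IsTest (S ×ˢ Ioi a) ψ →
    ∫ x in S ×ˢ Ioo a b, (f x * pd 2 ψ x + d x * ψ x) = ∫ z in S, g z * ψ (z, b)

theorem deriv_bump_of_neg {t : ℝ} (ht : t < 0) : deriv bump t = deriv step t := by
  refine Filter.EventuallyEq.deriv_eq ?_
  filter_upwards [Iio_mem_nhds ht] with s hs
  rw [bump, step_eq_one (t := -s) (by have : s < 0 := hs; linarith), mul_one]

/-- The trace of a function with bounded `H¹` norm, tested against an oscillating function of mean
zero. -/
theorem exists_oscillating_trace_bound {ω : Set R2} (hω : IsOpen ω) (L : ℝ)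
    {κ : R2 → ℝ} (hκ : IsTest2 ω κ) {α β : ℝ → ℝ} (hα : IsTest01 α) (hβ : IsTest01 β) (M : ℝ) :
    ∃ C : ℝ, ∀ ε, 0 < ε → ε < L → ∀ (f : R3 → ℝ) (d : Fin 3 → R3 → ℝ) (g : R2 → ℝ),
      (∀ i, HasWeakPd (OmB ω L) i f (d i)) → (∫ x in OmB ω L, f x ^ 2 ≤ M) →
      (∀ i, ∫ x in OmB ω L, d i x ^ 2 ≤ M) → HasUpperTrace ω (-L) 0 f (d 2) g →
      |∫ z in ω, g z * (κ z * (per α (ε⁻¹ * z.1) * per β (ε⁻¹ * z.2) - mean α * mean β))| ≤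
        C * √ε := by
  -- The mean-zero function is a divergence: `per α * per β - mean α * mean β = A'(t₁) per β(t₂) +
  -- mean α * Bf'(t₂)`. After rescaling, each term is `ε` times a derivative of a bounded function,
  -- apart from derivatives of `κ`.
  obtain ⟨A, hA, ⟨MA, hMA0, hMA⟩, hdA⟩ := exists_periodic_primitive hα
  obtain ⟨Bf, hB, ⟨MB, hMB0, hMB⟩, hdB⟩ := exists_periodic_primitive hβ
  obtain ⟨Ma, hMa0, hMa⟩ := exists_bound_per hα
  obtain ⟨Mb, hMb0, hMb⟩ := exists_bound_per hβ
  obtain ⟨k0, hk00, hk0⟩ := hκ.exists_bound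
  obtain ⟨k1, hk10, hk1⟩ := hκ.exists_bound_fderiv (1, 0)
  obtain ⟨k2, hk20, hk2⟩ := hκ.exists_bound_fderiv (0, 1)
  obtain ⟨Ms, hMs0, hMs⟩ := exists_bound_deriv_step
  set K := tsupport κ with hK
  have hKc : IsCompact K := hκ.2.1
  set V := (volume : Measure R2).real K with hV
  -- `B1`, `B2`, `B3`, `B4` bound the functions that multiply `∂₃f`, `∂₁f`, `∂₂f` and `f`
  -- respectively.
  set B1 := k0 * (Ma * Mb + |mean α * mean β|) with hB1
  set B2 := k0 * (MA * Mb) * Ms with hB2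
  set B3 := k0 * (|mean α| * MB) * Ms with hB3
  set B4 := (k1 * (MA * Mb) + k2 * (|mean α| * MB)) * Ms with hB4
  refine ⟨√(M * (B1 ^ 2 * V)) + √(M * (B2 ^ 2 * V)) + √(M * (B3 ^ 2 * V)) + √(M * (B4 ^ 2 * V)), ?_⟩
  intro ε hε hεL f d g hw hf hd hg
  have hUm : MeasurableSet (OmB ω L) := hω.measurableSet.prod measurableSet_Ioo
  have hsdA : Differentiable ℝ A := hA.differentiable (by simp)
  have hsdB : Differentiable ℝ Bf := hB.differentiable (by simp)
  have hdAe : ∀ t, deriv A t = per α t - mean α := fun t => (hdA t).deriv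
  have hdBe : ∀ t, deriv Bf t = per β t - mean β := fun t => (hdB t).deriv
  have hpa := contDiff_per hα
  have hpb := contDiff_per hβ
  have hbump_diff : Differentiable ℝ bump := contDiff_bump.differentiable (by simp)
  -- the tested trace as an integral over the cylinder
  set h : R2 → ℝ := fun z =>
    κ z * (per α (ε⁻¹ * z.1) * per β (ε⁻¹ * z.2) - mean α * mean β) with hh
  have hhT : IsTest2 ω h := hκ.mul_smooth
    ((contDiff_mul_fst_snd (contDiff_rescale hpa ε⁻¹) (contDiff_rescale hpb ε⁻¹)).sub contDiff_const)
  have hηs := tsupport_rescale hε tsupport_bump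
  have hηc : ContDiff ℝ ((⊤ : ℕ∞) : WithTop ℕ∞) (fun t => bump (ε⁻¹ * t)) :=
    contDiff_rescale contDiff_bump ε⁻¹
  have hψ : IsTest (ω ×ˢ Ioi (-L)) (fun x => h x.1 * bump (ε⁻¹ * x.2)) := by
    refine hhT.mul_snd hηc (isCompact_Icc.of_isClosed_subset (isClosed_tsupport _) hηs) ?_
    intro t ht
    have := (hηs ht).1
    simp only [mem_Ioi]; linarith
  have hG := hg _ hψ
  simp only [mul_zero, bump_eq_one (show |(0 : ℝ)| ≤ 1 / 2 by simp), mul_one] at hG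
  -- the four test functions
  have hst := contDiff_deriv_step
  -- For `x₃ < 0` the derivative of `bump` is that of `step`, supported in `[-3/4, -1/2]`. The
  -- rescaled factor thus vanishes near the face, and tangential integration by parts produces no
  -- boundary term.
  have hsts : tsupport (deriv step) ⊆ Icc (-3 / 4) (-1 / 2) := by
    refine closure_minimal ?_ isClosed_Icc
    intro t ht
    constructor
    · by_contra hlt; exact ht (deriv_step_eq_zero_of_lt (by linarith))
    · by_contra hlt; exact ht (deriv_step_eq_zero_of_gt (by linarith))
  have hJ : Icc (ε * (-3 / 4)) (ε * (-1 / 2)) ⊆ Ioo (-L) 0 := by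
    intro t ht
    constructor
    · have := ht.1; linarith
    · have := ht.2; linarith
  have hψ1 : IsTest (OmB ω L) (oscTest κ A (per β) (deriv step) ε) :=
    isTest_oscTest hκ hA hpb hst hε hsts hJ
  have hψ2 : IsTest (OmB ω L) (oscTest κ (fun _ => mean α) Bf (deriv step) ε) :=
    isTest_oscTest hκ contDiff_const hB hst hε hsts hJ
  set r : R3 → ℝ := fun x => (fderiv ℝ κ x.1 (1, 0) * (A (ε⁻¹ * x.1.1) * per β (ε⁻¹ * x.1.2)) +
    fderiv ℝ κ x.1 (0, 1) * (mean α * Bf (ε⁻¹ * x.1.2))) * deriv step (ε⁻¹ * x.2) with hr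
  have hrc : Continuous r := by
    have c1 := (hκ.continuous_fderiv (1, 0)).comp (continuous_fst (X := R2) (Y := ℝ))
    have c2 := (hκ.continuous_fderiv (0, 1)).comp (continuous_fst (X := R2) (Y := ℝ))
    have c3 := hA.continuous
    have c4 := hB.continuous
    have c5 := hpb.continuous
    have c6 := hst.continuous
    simp only [Function.comp_def] at c1 c2
    fun_prop
  have hz : ∀ t, t < 0 → deriv step (ε⁻¹ * t) ≠ 0 → t ∈ Icc (-ε) 0 := by
    intro t ht hne
    have := tsupport_rescale hε hsts (subset_tsupport _ hne)
    exact ⟨by linarith [this.1], ht.le⟩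
  have hzb : ∀ t, t < 0 → bump (ε⁻¹ * t) ≠ 0 → t ∈ Icc (-ε) 0 := by
    intro t ht hne
    have := hηs (subset_tsupport _ hne)
    exact ⟨by linarith [this.1], ht.le⟩
  -- The factor `ε⁻¹` produced by `∂₃` of the rescaled bump is the one needed to write the
  -- oscillating factor as tangential derivatives of `A(x₁/ε)` and `Bf(x₂/ε)`; `r` collects the
  -- terms in which the derivative falls on `κ`.
  have hident : ∀ x ∈ OmB ω L, f x * pd 2 (fun x => h x.1 * bump (ε⁻¹ * x.2)) x =
      f x * pd 0 (oscTest κ A (per β) (deriv step) ε) x +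
      f x * pd 1 (oscTest κ (fun _ => mean α) Bf (deriv step) ε) x - f x * r x := by
    intro x hx
    have hneg : ε⁻¹ * x.2 < 0 := mul_neg_of_pos_of_neg (inv_pos.2 hε) hx.2.2
    rw [pd_mul_fst_snd hhT.differentiable (hηc.differentiable (by simp)),
      deriv_rescale hbump_diff, deriv_bump_of_neg hneg,
      pd_oscTest hκ.differentiable hsdA (hpb.differentiable (by simp)) (hst.differentiable (by simp)),
      pd_oscTest hκ.differentiable (differentiable_const _) hsdB (hst.differentiable (by simp)),
      hdAe, hdBe, show dir 2 = ((0 : R2), (1 : ℝ)) from rfl, show dir 0 = (((1, 0) : R2), (0 : ℝ)) from rfl,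
      show dir 1 = (((0, 1) : R2), (0 : ℝ)) from rfl]
    simp only [map_zero, hh, hr]
    ring
  have i1 := (hw 0).integrable_mul hψ1 0
  have i2 := (hw 1).integrable_mul hψ2 1
  have iψ := (hw 2).integrable_mul hψ 2
  have ir : Integrable (fun x => f x * r x) (volume.restrict (OmB ω L)) := by
    have : Integrable (fun x => f x * pd 0 (oscTest κ A (per β) (deriv step) ε) x +
        f x * pd 1 (oscTest κ (fun _ => mean α) Bf (deriv step) ε) x -
        f x * pd 2 (fun x => h x.1 * bump (ε⁻¹ * x.2)) x) (volume.restrict (OmB ω L)) :=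
      (i1.1.add i2.1).sub iψ.1
    refine this.congr ?_
    filter_upwards [ae_restrict_mem hUm] with x hx
    rw [hident x hx]; ring
  have hsplit : ∫ x in OmB ω L, f x * pd 2 (fun x => h x.1 * bump (ε⁻¹ * x.2)) x =
      -(∫ x in OmB ω L, d 0 x * oscTest κ A (per β) (deriv step) ε x) -
      (∫ x in OmB ω L, d 1 x * oscTest κ (fun _ => mean α) Bf (deriv step) ε x) -
      ∫ x in OmB ω L, f x * r x := by
    have i12 : Integrable (fun x => f x * pd 0 (oscTest κ A (per β) (deriv step) ε) x +
        f x * pd 1 (oscTest κ (fun _ => mean α) Bf (deriv step) ε) x) (volume.restrict (OmB ω L)) :=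
      i1.1.add i2.1
    rw [setIntegral_congr_fun hUm hident, integral_sub i12 ir, integral_add i1.1 i2.1, (hw 0).integral_eq _ hψ1, (hw 1).integral_eq _ hψ2]
    ring
  rw [integral_add iψ.1 iψ.2, hsplit] at hG
  -- estimates
  have scale : ∀ B : ℝ, √(M * (B ^ 2 * (V * (0 - -ε)))) = √(M * (B ^ 2 * V)) * √ε := by
    intro B
    rw [← Real.sqrt_mul' _ hε.le]
    congr 1
    ring
  have hb1 : ∀ x : R3, |h x.1 * bump (ε⁻¹ * x.2)| ≤ B1 := by
    intro x
    rw [abs_mul, hh, abs_mul]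
    have e1 : |bump (ε⁻¹ * x.2)| ≤ 1 := by
      rw [bump, abs_mul, abs_of_nonneg (step_nonneg _), abs_of_nonneg (step_nonneg _)]
      exact mul_le_one₀ (step_le_one _) (step_nonneg _) (step_le_one _)
    have e2 : |per α (ε⁻¹ * x.1.1) * per β (ε⁻¹ * x.1.2) - mean α * mean β| ≤
        Ma * Mb + |mean α * mean β| := by
      refine (abs_sub _ _).trans (add_le_add ?_ le_rfl)
      rw [abs_mul]
      exact mul_le_mul (hMa _) (hMb _) (abs_nonneg _) hMa0
    refine (mul_le_of_le_one_right (by positivity) e1).trans ?_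
    exact mul_le_mul (hk0 _) e2 (abs_nonneg _) hk00
  have hb2 : ∀ x : R3, |oscTest κ A (per β) (deriv step) ε x| ≤ B2 := by
    intro x
    rw [oscTest, abs_mul, abs_mul, abs_mul]
    have := hk0 x.1; have := hMA (ε⁻¹ * x.1.1); have := hMb (ε⁻¹ * x.1.2); have := hMs (ε⁻¹ * x.2)
    simp only [hB2]
    gcongr
  have hb3 : ∀ x : R3, |oscTest κ (fun _ => mean α) Bf (deriv step) ε x| ≤ B3 := by
    intro x
    rw [oscTest, abs_mul, abs_mul, abs_mul]
    have := hk0 x.1; have := hMB (ε⁻¹ * x.1.2); have := hMs (ε⁻¹ * x.2)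
    simp only [hB3]
    gcongr
  have hb4 : ∀ x : R3, |r x| ≤ B4 := by
    intro x
    simp only [hr, hB4]
    rw [abs_mul]
    have := hk1 x.1; have := hk2 x.1
    have := hMA (ε⁻¹ * x.1.1); have := hMb (ε⁻¹ * x.1.2); have := hMB (ε⁻¹ * x.1.2)
    have := hMs (ε⁻¹ * x.2)
    refine mul_le_mul ((abs_add_le _ _).trans ?_) (hMs _) (abs_nonneg _) (by positivity)
    rw [abs_mul, abs_mul, abs_mul, abs_mul]
    gcongr
  have t1 := abs_setIntegral_mul_le_slab (hw 2).memLp_pd (hd 2) hKc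
    hψ.continuous hb1 (c := -ε) (d := 0) (by linarith) (fun x hx hne => by
      obtain ⟨n1, n2⟩ := mul_ne_zero_iff.1 hne
      exact ⟨subset_tsupport _ (left_ne_zero_of_mul n1), hzb _ hx.2.2 n2⟩) hUm
  have t2 := abs_setIntegral_mul_le_slab (hw 0).memLp_pd (hd 0) hKc
    hψ1.continuous hb2 (c := -ε) (d := 0) (by linarith) (fun x hx hne => by
      obtain ⟨n1, n2⟩ := mul_ne_zero_iff.1 hne
      exact ⟨subset_tsupport _ (left_ne_zero_of_mul n1), hz _ hx.2.2 n2⟩) hUm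
  have t3 := abs_setIntegral_mul_le_slab (hw 1).memLp_pd (hd 1) hKc
    hψ2.continuous hb3 (c := -ε) (d := 0) (by linarith) (fun x hx hne => by
      obtain ⟨n1, n2⟩ := mul_ne_zero_iff.1 hne
      exact ⟨subset_tsupport _ (left_ne_zero_of_mul n1), hz _ hx.2.2 n2⟩) hUm
  have t4 := abs_setIntegral_mul_le_slab (hw 0).memLp hf hKc
    hrc hb4 (c := -ε) (d := 0) (by linarith) (fun x hx hne => by
      obtain ⟨n1, n2⟩ := mul_ne_zero_iff.1 hne
      refine ⟨?_, hz _ hx.2.2 n2⟩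
      by_contra hxK
      apply n1
      have z1 : fderiv ℝ κ x.1 (1, 0) = 0 := by
        by_contra hn; exact hxK (fderiv_ne_zero_mem hn)
      have z2 : fderiv ℝ κ x.1 (0, 1) = 0 := by
        by_contra hn; exact hxK (fderiv_ne_zero_mem hn)
      rw [z1, z2]; ring) hUm
  rw [scale] at t1 t2 t3 t4
  rw [← hG]
  rw [abs_le] at t1 t2 t3 t4 ⊢
  constructor <;> linarith [t1.1, t1.2, t2.1, t2.2, t3.1, t3.2, t4.1, t4.2]

/-! ### Green's formula in the layer -/

/-- A product of three functions of one variable. -/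
def cellTest (a b c : ℝ → ℝ) (y : R3) : ℝ := a y.1.1 * b y.1.2 * c y.2

theorem setIntegral_green_eq_zero {U W : Set R3} (hU : MeasurableSet U) {ψ : R3 → ℝ}
    (hψ : IsTest W ψ) (hW : ∀ x ∈ U, x ∉ W) (i : Fin 3) (f d : R3 → ℝ) :
    ∫ x in U, (f x * pd i ψ x + d x * ψ x) = 0 := by
  rw [setIntegral_congr_fun (g := fun _ => (0 : ℝ)) hU, integral_zero]
  intro x hx
  simp only [hψ.eq_zero (hW x hx), hψ.pd_eq_zero i (hW x hx)]
  ring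

section LayerGreen
variable {ω : Set R2} {L ε p q : ℝ} {κ : R2 → ℝ} {a b c : ℝ → ℝ}

/-- The derivative `∂₃` does not act on `κ` or on the planar oscillations, so multiplication by
`ε⁻¹` gives exactly a Green integrand, without error terms. -/
theorem mul_oscPair_two {U : Set R3} (φ : H1 U) (hκ : Differentiable ℝ κ)
    (ha : Differentiable ℝ a) (hb : Differentiable ℝ b) (hc : Differentiable ℝ c) (hε : 0 < ε)
    (x : R3) : ε⁻¹ * (κ x.1 * oscPair φ 2 (cellTest a b (deriv c)) (cellTest a b c) ε x) =
      fn φ x * pd 2 (oscTest κ a b c ε) x + grad φ 2 x * oscTest κ a b c ε x := by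
  rw [pd_oscTest hκ ha hb hc, show dir 2 = ((0 : R2), (1 : ℝ)) from rfl]
  simp only [oscPair, cellTest, oscTest, map_zero, Prod.fst_zero, Prod.snd_zero, Prod.smul_fst,
    Prod.smul_snd, smul_eq_mul]
  field_simp
  ring

/-- The Green integral of a test function compactly supported in `Ω` vanishes; cutting `Ω` at `x₃ =
0` and `x₃ = ε` expresses the layer through the two blocks. -/
theorem layer_green (φ : H1 (Om ω L)) (hκ : IsTest2 ω κ)
    (ha : ContDiff ℝ ((⊤ : ℕ∞) : WithTop ℕ∞) a) (hb : ContDiff ℝ ((⊤ : ℕ∞) : WithTop ℕ∞) b)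
    (hc : ContDiff ℝ ((⊤ : ℕ∞) : WithTop ℕ∞) c) (hε : 0 < ε) (hεL : ε < L)
    (hs : tsupport c ⊆ Icc p q) (hJ : Icc (ε * p) (ε * q) ⊆ Ioo (-L) L) :
    ε⁻¹ * ∫ x in OmM ω ε, κ x.1 * oscPair φ 2 (cellTest a b (deriv c)) (cellTest a b c) ε x =
      -(∫ x in OmB ω L, (fn φ x * pd 2 (oscTest κ a b c ε) x + grad φ 2 x * oscTest κ a b c ε x)) -
        ∫ x in OmAEps ω L ε,
          (fn φ x * pd 2 (oscTest κ a b c ε) x + grad φ 2 x * oscTest κ a b c ε x) := by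
  have hψ : IsTest (Om ω L) (oscTest κ a b c ε) := isTest_oscTest hκ ha hb hc hε hs hJ
  have w := hasWeakPd φ 2
  have i := w.integrable_mul hψ 2
  have hG := w.integrable_green hψ 2
  have h0 : ∫ x in Om ω L, (fn φ x * pd 2 (oscTest κ a b c ε) x + grad φ 2 x * oscTest κ a b c ε x)
      = 0 := by
    rw [integral_add i.1 i.2, w.integral_eq _ hψ]
    ring
  rw [setIntegral_prod_Ioo_add (by linarith) (hε.trans hεL) hG, setIntegral_prod_Ioo_add hε hεL
    (hG.mono_measure (Measure.restrict_mono (Set.prod_mono le_rfl (Ioo_subset_Ioo (by linarith) le_rfl))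
      le_rfl))] at h0
  rw [← integral_const_mul, integral_congr_ae (Eventually.of_forall fun x =>
    mul_oscPair_two φ hκ.differentiable (ha.differentiable (by simp))
    (hb.differentiable (by simp)) (hc.differentiable (by simp)) hε x)]
  linarith

/-- The rescaled bump lives in `|x₃| ≤ 3ε/4`, so the upper block does not contribute and the lower
one gives the trace at `x₃ = 0`. -/
theorem layer_green_bottom (hω : MeasurableSet ω) (φ : H1 (Om ω L)) (hκ : IsTest2 ω κ)
    (ha : ContDiff ℝ ((⊤ : ℕ∞) : WithTop ℕ∞) a) (hb : ContDiff ℝ ((⊤ : ℕ∞) : WithTop ℕ∞) b)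
    (hε : 0 < ε) (hεL : ε < L) {u : H1 (OmB ω L)}
    (hu : fn u =ᵐ[volume.restrict (OmB ω L)] fn φ)
    (hu2 : grad u 2 =ᵐ[volume.restrict (OmB ω L)] grad φ 2) {g : R2 → ℝ}
    (hg : IsTopTrace ω (-L) 0 u g) :
    ε⁻¹ * ∫ x in OmM ω ε, κ x.1 *
        oscPair φ 2 (cellTest a b (deriv (bumpAt 0 1))) (cellTest a b (bumpAt 0 1)) ε x =
      -∫ z in ω, g z * (κ z * (a (ε⁻¹ * z.1) * b (ε⁻¹ * z.2))) := by
  have hs := tsupport_bumpAt 0 one_pos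
  rw [layer_green φ hκ ha hb (contDiff_bumpAt 0 1) hε hεL hs (by
    rintro t ⟨h1, h2⟩; constructor <;> linarith)]
  have hψ : IsTest (ω ×ˢ Ioo (-L) ε) (oscTest κ a b (bumpAt 0 1) ε) :=
    isTest_oscTest hκ ha hb (contDiff_bumpAt 0 1) hε hs (by
      rintro t ⟨h1, h2⟩; constructor <;> linarith)
  rw [setIntegral_green_eq_zero (U := OmAEps ω L ε) (hω.prod measurableSet_Ioo) hψ (fun x hx hx' => by
    have h1 : ε < x.2 := hx.2.1
    have h2 : x.2 < ε := hx'.2.2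
    linarith), sub_zero]
  have hT := hg.2 _ (hψ.mono (Set.prod_mono le_rfl fun t ht => ht.1))
  rw [one_mul] at hT
  congr 1
  simp only [oscTest, mul_zero, bumpAt_self, mul_one] at hT
  rw [← hT]
  refine integral_congr_ae ?_
  filter_upwards [hu, hu2] with x h1 h2
  rw [h1, h2]; rfl

/-- The translation by `ε e₃`. -/
def raise (ε : ℝ) : R3 ≃ₜ R3 := aff ![0, 0, ε] (fun _ => 1) (fun _ => one_ne_zero)

theorem raise_apply (ε : ℝ) (x : R3) : raise ε x = (x.1, x.2 + ε) := by
  rw [raise, aff_apply]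
  ext <;> simp [add_comm]

theorem map_raise (ε : ℝ) : Measure.map (raise ε) volume = ENNReal.ofReal 1 • volume := by
  rw [raise, map_aff]; simp

theorem preimage_raise (ε : ℝ) (S : Set R2) (a b : ℝ) :
    raise ε ⁻¹' (S ×ˢ Ioo a b) = S ×ˢ Ioo (a - ε) (b - ε) := by
  ext x
  simp only [raise_apply, mem_preimage, mem_prod, mem_Ioo]
  constructor <;> rintro ⟨h1, h2, h3⟩ <;> refine ⟨h1, ?_, ?_⟩ <;> linarith

/-- The rescaled bump lives in `ε/4 ≤ x₃ ≤ 7ε/4`, so only the upper block contributes. After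
translation the support lies below `3ε/4 < L - ε`, where the shifted function does not yet involve
reflected values; the sign changes because the outward normal is `-e₃`. -/
theorem layer_green_top (hω : MeasurableSet ω) (φ : H1 (Om ω L)) (hκ : IsTest2 ω κ)
    (ha : ContDiff ℝ ((⊤ : ℕ∞) : WithTop ℕ∞) a) (hb : ContDiff ℝ ((⊤ : ℕ∞) : WithTop ℕ∞) b)
    (hε : 0 < ε) (hεL : ε < L / 2) {v : H1 (OmA ω L)}
    (hv : fn v =ᵐ[volume.restrict (OmA ω L)] shift L ε (fn φ))
    (hv2 : grad v 2 =ᵐ[volume.restrict (OmA ω L)] fun x => reflectPd L 2 (grad φ 2) (raise ε x))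
    {g : R2 → ℝ} (hg : IsBottomTrace ω 0 L v g) :
    ε⁻¹ * ∫ x in OmM ω ε, κ x.1 *
        oscPair φ 2 (cellTest a b (deriv (bumpAt 1 1))) (cellTest a b (bumpAt 1 1)) ε x =
      ∫ z in ω, g z * (κ z * (a (ε⁻¹ * z.1) * b (ε⁻¹ * z.2))) := by
  have hs := tsupport_bumpAt 1 one_pos
  rw [layer_green φ hκ ha hb (contDiff_bumpAt 1 1) hε (by linarith) hs (by
    rintro t ⟨h1, h2⟩; constructor <;> linarith)]
  have hψ : IsTest (ω ×ˢ Ioo 0 L) (oscTest κ a b (bumpAt 1 1) ε) :=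
    isTest_oscTest hκ ha hb (contDiff_bumpAt 1 1) hε hs (by
      rintro t ⟨h1, h2⟩; constructor <;> linarith)
  rw [setIntegral_green_eq_zero (hω.prod measurableSet_Ioo) hψ (fun x hx hx' => by
    have h1 : x.2 < 0 := hx.2.2
    have h2 : 0 < x.2 := hx'.2.1
    linarith), neg_zero, zero_sub]
  have hψ' : IsTest (ω ×ˢ Ioo (-L) (L - ε)) (oscTest κ a b (bumpAt 0 1) ε) :=
    isTest_oscTest hκ ha hb (contDiff_bumpAt 0 1) hε (tsupport_bumpAt 0 one_pos) (by
      rintro t ⟨h1, h2⟩; constructor <;> linarith)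
  have hcomp : ∀ x, oscTest κ a b (bumpAt 1 1) ε (raise ε x) = oscTest κ a b (bumpAt 0 1) ε x := by
    intro x
    simp only [oscTest, raise_apply, bumpAt]
    congr 2
    field_simp
    ring
  have hpd : ∀ x, pd 2 (oscTest κ a b (bumpAt 1 1) ε) (raise ε x) =
      pd 2 (oscTest κ a b (bumpAt 0 1) ε) x := by
    intro x
    have := pd_comp (e := raise ε) (σ := 1) (i := 2) (j := 2) hψ.differentiable (contDiff_aff _ _ _)
      (fun x => fderiv_aff _ _ _ 2 x) x
    rw [one_mul] at this
    rw [← this]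
    congr 1
    funext y
    exact hcomp y
  have hT := hg.2 _ (hψ'.mono (Set.prod_mono le_rfl fun t ht => lt_trans ht.2 (by linarith)))
  simp only [oscTest, mul_zero, bumpAt_self, mul_one] at hT
  change ∫ x in OmA ω L, (fn v x * pd 2 (oscTest κ a b (bumpAt 0 1) ε) x +
    grad v 2 x * oscTest κ a b (bumpAt 0 1) ε x) = _ at hT
  rw [setIntegral_prod_Ioo_add (b := L - ε) (by linarith) (by linarith)
    ((hasWeakPd v 2).integrable_green hψ' 2), setIntegral_green_eq_zero
      (U := ω ×ˢ Ioo (L - ε) L) (hω.prod measurableSet_Ioo) hψ' (fun x hx hx' => by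
    have h1 : L - ε < x.2 := hx.2.1
    have h2 : x.2 < L - ε := hx'.2.2
    linarith), add_zero] at hT
  have hch := setIntegral_comp_homeomorph (U := OmAEps ω L ε) (map_raise ε) one_pos (fun x =>
    fn φ x * pd 2 (oscTest κ a b (bumpAt 1 1) ε) x + grad φ 2 x * oscTest κ a b (bumpAt 1 1) ε x)
  rw [one_mul, preimage_raise, sub_self] at hch
  rw [← hch]
  have hsub : (volume : Measure R3).restrict (ω ×ˢ Ioo 0 (L - ε)) ≤ volume.restrict (OmA ω L) :=
    Measure.restrict_mono (Set.prod_mono le_rfl (Ioo_subset_Ioo le_rfl (by linarith))) le_rfl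
  have hcongr : ∫ x in ω ×ˢ Ioo 0 (L - ε), (fn v x * pd 2 (oscTest κ a b (bumpAt 0 1) ε) x +
      grad v 2 x * oscTest κ a b (bumpAt 0 1) ε x) = ∫ x in ω ×ˢ Ioo 0 (L - ε),
      (fn φ (raise ε x) * pd 2 (oscTest κ a b (bumpAt 1 1) ε) (raise ε x) +
        grad φ 2 (raise ε x) * oscTest κ a b (bumpAt 1 1) ε (raise ε x)) := by
    refine integral_congr_ae ?_
    filter_upwards [ae_mono hsub hv, ae_mono hsub hv2, ae_restrict_mem (hω.prod measurableSet_Ioo)]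
      with x h1 h2 hx
    have hx2 : x.2 + ε ≤ L := by have := hx.2.2; linarith
    rw [h1, h2, hcomp, hpd, shift, reflect, reflectPd]
    simp only [raise_apply, if_pos hx2]
  rw [← hcongr, hT]
  ring

/-- By `hab` the oscillating profile is constant in the direction `i`, so `∂ᵢ` of the test function
hits only `κ` and costs no `ε⁻¹`. The factor `c` vanishes near both ends of the layer, so there is
no boundary term. One `√ε` comes from `φ` and one from the thickness. -/
theorem exists_lateral_bound (hω : MeasurableSet ω) (hκ : IsTest2 ω κ)
    (ha : ContDiff ℝ ((⊤ : ℕ∞) : WithTop ℕ∞) a) (hb : ContDiff ℝ ((⊤ : ℕ∞) : WithTop ℕ∞) b)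
    (hc : IsTest01 c) {A B : ℝ} (hA : ∀ t, |a t| ≤ A) (hB : ∀ t, |b t| ≤ B) {i : Fin 3}
    (hi : i ≠ 2) (hab : ∀ s t, (dir i).1.1 * deriv a s * b t + (dir i).1.2 * a s * deriv b t = 0)
    (M : ℝ) : ∃ C : ℝ, ∀ ε, 0 < ε → ∀ (U : Set R3) (φ : H1 U), OmM ω ε ⊆ U →
      (∫ x in OmM ω ε, fn φ x ^ 2 ≤ ε * M) →
      |ε⁻¹ * ∫ x in OmM ω ε, κ x.1 * oscPair φ i (fun _ => 0) (cellTest a b c) ε x| ≤ C * ε := by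
  obtain ⟨k, hk0, hk⟩ := hκ.exists_bound_fderiv (dir i).1
  obtain ⟨D, hD⟩ := hc.2.1.exists_bound_of_continuous hc.1.continuous
  have hA0 : 0 ≤ A := (abs_nonneg _).trans (hA 0)
  have hB0 : 0 ≤ B := (abs_nonneg _).trans (hB 0)
  have hD0 : 0 ≤ D := (norm_nonneg _).trans (hD 0)
  set V := (volume : Measure R2).real (tsupport κ)
  refine ⟨√(M * ((k * (A * B) * D) ^ 2 * V)), ?_⟩
  intro ε hε U φ hU hφ
  have w := (hasWeakPd φ i).mono hU
  have hψ : IsTest (OmM ω ε) (oscTest κ a b c ε) := by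
    have hsub : tsupport (fun t => c (ε⁻¹ * t)) ⊆ Ioo 0 ε := by
      intro t ht
      have := hc.2.2 (tsupport_comp_subset_preimage c (f := fun t => ε⁻¹ * t) (by fun_prop) ht)
      change ε⁻¹ * t ∈ Ioo (0 : ℝ) 1 at this
      rw [mem_Ioo, inv_mul_eq_div, lt_div_iff₀ hε, div_lt_iff₀ hε] at this
      constructor <;> linarith [this.1, this.2]
    exact (hκ.mul_smooth (contDiff_mul_fst_snd (contDiff_rescale ha ε⁻¹)
      (contDiff_rescale hb ε⁻¹))).mul_snd (contDiff_rescale hc.1 ε⁻¹)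
      (isCompact_Icc.of_isClosed_subset (isClosed_tsupport _) (hsub.trans Ioo_subset_Icc_self)) hsub
  have e1 : ε⁻¹ * ∫ x in OmM ω ε, κ x.1 * oscPair φ i (fun _ => 0) (cellTest a b c) ε x =
      -∫ x in OmM ω ε, fn φ x * pd i (oscTest κ a b c ε) x := by
    rw [w.integral_eq _ hψ, neg_neg, ← integral_const_mul]
    refine integral_congr_ae (Eventually.of_forall fun x => ?_)
    simp only [oscPair, cellTest, oscTest, Prod.smul_fst, Prod.smul_snd, smul_eq_mul]
    field_simp
    ring
  have hpd : ∀ x, pd i (oscTest κ a b c ε) x =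
      fderiv ℝ κ x.1 (dir i).1 * (a (ε⁻¹ * x.1.1) * b (ε⁻¹ * x.1.2)) * c (ε⁻¹ * x.2) := by
    intro x
    rw [pd_oscTest hκ.differentiable (ha.differentiable (by simp)) (hb.differentiable (by simp))
      hc.differentiable, dir_snd_eq_zero hi]
    linear_combination (κ x.1 * ε⁻¹ * c (ε⁻¹ * x.2)) * hab (ε⁻¹ * x.1.1) (ε⁻¹ * x.1.2)
  have hbd := abs_setIntegral_mul_le_slab w.memLp hφ (K := tsupport κ) hκ.2.1 (hψ.continuous_pd i)
    (B := k * (A * B) * D) (fun x => by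
      rw [hpd, abs_mul, abs_mul, abs_mul]
      have := hk x.1; have := hA (ε⁻¹ * x.1.1); have := hB (ε⁻¹ * x.1.2)
      have : |c (ε⁻¹ * x.2)| ≤ D := hD _
      gcongr) hε.le (fun x hx hne => by
      rw [hpd] at hne
      exact ⟨fderiv_ne_zero_mem (left_ne_zero_of_mul (left_ne_zero_of_mul hne)),
        Ioo_subset_Icc_self hx.2⟩) (hω.prod measurableSet_Ioo)
  rw [e1, abs_neg]
  refine hbd.trans (le_of_eq ?_)
  rw [show ε * M * ((k * (A * B) * D) ^ 2 * (V * (ε - 0))) =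
    M * ((k * (A * B) * D) ^ 2 * V) * (ε ^ 2) by ring, Real.sqrt_mul' _ (sq_nonneg ε),
    Real.sqrt_sq hε.le]

end LayerGreen

/-! ### The restrictions to the lower block and the shifted functions -/

theorem integral_sq_le_norm_sq {U : Set R3} (u : H1 U) :
    (∫ x in U, fn u x ^ 2) ≤ ‖u‖ ^ 2 ∧ ∀ i, ∫ x in U, grad u i x ^ 2 ≤ ‖u‖ ^ 2 := by
  have h0 : ∀ (f : R3 → ℝ), 0 ≤ ∫ x in U, f x ^ 2 := fun f => integral_nonneg fun x => sq_nonneg _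
  rw [norm_sq_H1]
  refine ⟨le_add_of_nonneg_right (Finset.sum_nonneg fun i _ => h0 _), fun i => ?_⟩
  exact (Finset.single_le_sum (f := fun i => ∫ x in U, grad u i x ^ 2) (fun i _ => h0 _)
    (Finset.mem_univ i)).trans (le_add_of_nonneg_left (h0 _))

/-- The restriction of a function in `H¹(U)` to a subset. -/
def restrictH1 {U V : Set R3} (hV : V ⊆ U) (u : H1 U) : H1 V :=
  ofFun fun i => (hasWeakPd u i).mono hV

theorem sqNormGradOn_eq {U V : Set R3} (hV : V ⊆ U) (u : H1 U) :
    sqNormGradOn u V = ∑ i, ∫ x in V, grad u i x ^ 2 :=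
  integral_finsetSum _ fun i _ => ((hasWeakPd u i).mono hV).memLp_pd.integrable_sq

theorem norm_sq_restrictH1 {U V : Set R3} (hV : V ⊆ U) (u : H1 U) :
    ‖restrictH1 hV u‖ ^ 2 = sqNormOn u V + sqNormGradOn u V := by
  rw [restrictH1, norm_sq_ofFun, sqNormGradOn_eq hV, sqNormOn]

theorem integral_energy_eq {U V : Set R3} (hV : V ⊆ U) (u : H1 U) (ε : ℝ) :
    ∫ x in V, energy u ε x = sqNormOn u V + ε ^ 2 * sqNormGradOn u V := by
  have h1 := ((hasWeakPd u 0).mono hV).memLp.integrable_sq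
  have h2 : Integrable (fun x => ∑ i : Fin 3, grad u i x ^ 2) (volume.restrict V) :=
    integrable_finsetSum _ fun i _ => ((hasWeakPd u i).mono hV).memLp_pd.integrable_sq
  rw [sqNormOn, sqNormGradOn, ← integral_const_mul, ← integral_add h1 (h2.const_mul _)]
  refine integral_congr_ae (Eventually.of_forall fun x => ?_)
  simp only [energy, Finset.mul_sum]

section Shift
variable {ω : Set R2} {L ε : ℝ}

theorem hasWeakPd_shift (hω : MeasurableSet ω) (hε : 0 < ε) (hεL : ε < L) (φ : H1 (Om ω L))
    (i : Fin 3) : HasWeakPd (OmA ω L) i (shift L ε (fn φ))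
      (fun x => reflectPd L i (grad φ i) (raise ε x)) := by
  have h := ((hasWeakPd φ i).extend_reflect hω (by linarith)).comp_aff (U' := OmA ω L) ![0, 0, ε]
    (fun _ => 1) (fun _ => one_ne_zero) (by
      change OmA ω L ⊆ raise ε ⁻¹' _
      rw [preimage_raise]
      exact Set.prod_mono le_rfl (Ioo_subset_Ioo (by linarith) (by linarith)))
  refine h.congr (Eventually.of_forall fun x => ?_) (Eventually.of_forall fun x => ?_)
  · change reflect L (fn φ) (raise ε x) = _
    rw [raise_apply]; rfl
  · exact one_mul _

/-- The function `φ(· + ε e₃)`, after reflection in the plane `x₃ = L`. -/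
def shiftH1 (hω : MeasurableSet ω) (hε : 0 < ε) (hεL : ε < L) (φ : H1 (Om ω L)) : H1 (OmA ω L) :=
  ofFun fun i => hasWeakPd_shift hω hε hεL φ i

/-- The shifted function samples heights in `(ε, L + ε)`. Since `ε < L / 2`, this lies in `(ε, 2L -
ε)`, on which the reflection exactly doubles the integral over `(ε, L)`; the values in the thin
layer never enter. -/
theorem setIntegral_sq_reflect_raise_le (hω : MeasurableSet ω) (hε : 0 < ε) (hεL : ε < L / 2)
    {d : R3 → ℝ} (hd : MemLp d 2 (volume.restrict (OmAEps ω L ε))) {s : ℝ} (hs : s * s = 1) :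
    ∫ x in OmA ω L, (if (raise ε x).2 ≤ L then d (raise ε x) else
      s * d ((raise ε x).1, 2 * L - (raise ε x).2)) ^ 2 ≤ 2 * ∫ x in OmAEps ω L ε, d x ^ 2 := by
  set F : R3 → ℝ := fun x => if x.2 ≤ L then d x else s * d (x.1, 2 * L - x.2) with hF
  have hFi : Integrable (fun x => F x ^ 2) (volume.restrict (ω ×ˢ Ioo ε (2 * L - ε))) :=
    (memLp_reflect hω s (by linarith) hd).integrable_sq
  have h1 := setIntegral_comp_homeomorph (U := ω ×ˢ Ioo ε (L + ε)) (map_raise ε) one_pos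
    (fun x => F x ^ 2)
  rw [one_mul, preimage_raise, sub_self, add_sub_cancel_right] at h1
  have h2 : ∫ x in ω ×ˢ Ioo ε (L + ε), F x ^ 2 ≤ ∫ x in ω ×ˢ Ioo ε (2 * L - ε), F x ^ 2 :=
    setIntegral_mono_set hFi (Eventually.of_forall fun x => sq_nonneg _)
      (Eventually.of_forall (Set.prod_mono le_rfl (Ioo_subset_Ioo le_rfl (by linarith))))
  have h3 := setIntegral_prod_Ioo_add (b := L) (by linarith) (by linarith) hFi
  obtain ⟨r1, r2⟩ := ae_reflect (b := L) hω s ε (2 * L - ε) d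
  have h4 : ∫ x in ω ×ˢ Ioo ε L, F x ^ 2 = ∫ x in OmAEps ω L ε, d x ^ 2 :=
    integral_congr_ae (r1.mono fun x hx => by simp only [hF, hx])
  have h5 : ∫ x in ω ×ˢ Ioo L (2 * L - ε), F x ^ 2 = ∫ x in OmAEps ω L ε, d x ^ 2 := by
    have h := setIntegral_comp_homeomorph (U := OmAEps ω L ε) (map_mirror (2 * L)) one_pos
      (fun x => d x ^ 2)
    rw [one_mul, preimage_mirror, show 2 * L - L = L by ring] at h
    rw [← h]
    refine integral_congr_ae (r2.mono fun x hx => ?_)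
    simp only [hF, hx]
    rw [mul_pow, sq s, hs, one_mul]
  calc _ = ∫ x in ω ×ˢ Ioo ε (L + ε), F x ^ 2 := h1
    _ ≤ _ := by rw [h3, h4, h5] at h2; linarith

theorem norm_sq_shiftH1_le (hω : MeasurableSet ω) (hε : 0 < ε) (hεL : ε < L) (hεL2 : ε < L / 2)
    (φ : H1 (Om ω L)) : ‖shiftH1 hω hε hεL φ‖ ^ 2 ≤
      2 * (sqNormOn φ (OmAEps ω L ε) + sqNormGradOn φ (OmAEps ω L ε)) := by
  have hsub : OmAEps ω L ε ⊆ Om ω L := Set.prod_mono le_rfl (Ioo_subset_Ioo (by linarith) le_rfl)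
  have w := fun i => (hasWeakPd φ i).mono hsub
  rw [shiftH1, norm_sq_ofFun, sqNormGradOn_eq hsub, sqNormOn, mul_add, Finset.mul_sum]
  refine add_le_add ?_ (Finset.sum_le_sum fun i _ => ?_)
  · have := setIntegral_sq_reflect_raise_le hω hε hεL2 (w 0).memLp (one_mul (1 : ℝ))
    simp only [one_mul, raise_apply] at this
    exact this
  · exact setIntegral_sq_reflect_raise_le hω hε hεL2 (w i).memLp_pd (mirrorSign_sq i)

end Shift

/-! ### Oscillating test functions against traces -/

section Oscillating
variable {ω : Set R2} {L : ℝ} {κ : R2 → ℝ} {α β : ℝ → ℝ}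

/-- Reflection in `x₃ = 0` carries the upper block to the lower one, so a single oscillation
estimate serves both interfaces. -/
theorem IsBottomTrace.hasUpperTrace_mirror {v : H1 (OmA ω L)} {g : R2 → ℝ}
    (hg : IsBottomTrace ω 0 L v g) : HasUpperTrace ω (-L) 0 (fun x => fn v (mirror 0 x))
      (fun x => mirrorSign 2 * grad v 2 (mirror 0 x)) g := by
  intro ψ hψ
  have hmc : ContDiff ℝ ((⊤ : ℕ∞) : WithTop ℕ∞) (mirror 0) := contDiff_aff _ _ _
  have hψ' : IsTest (ω ×ˢ Iio L) (fun x => ψ (mirror 0 x)) :=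
    hψ.comp_homeomorph hmc (by
      rintro x ⟨h1, h2⟩
      rw [mirror_apply] at h1 h2
      refine ⟨h1, ?_⟩
      simp only [mem_Ioi, mem_Iio] at h2 ⊢
      linarith)
  have hpd : ∀ x, pd 2 (fun x => ψ (mirror 0 x)) x = mirrorSign 2 * pd 2 ψ (mirror 0 x) :=
    pd_comp hψ.differentiable hmc fun x => fderiv_aff _ _ _ 2 x
  have h := hg.2 _ hψ'
  have hm : mirrorSign 2 = -1 := rfl
  have hz : ∀ z : R2, mirror 0 (z, 0) = (z, 0) := fun z => by rw [mirror_apply, sub_zero]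
  simp only [hpd, hm, hz] at h
  have hc := setIntegral_comp_homeomorph (U := OmA ω L) (map_mirror 0) one_pos
    (fun x => fn v x * pd 2 ψ (mirror 0 x) + mirrorSign 2 * grad v 2 x * ψ (mirror 0 x))
  rw [one_mul, preimage_mirror, sub_zero, zero_sub] at hc
  simp only [mirror_mirror] at hc
  rw [hc, ← neg_inj, ← integral_neg, ← neg_one_mul (∫ z in ω, g z * ψ (z, 0)), ← h]
  refine integral_congr_ae (Eventually.of_forall fun x => ?_)
  simp only [hm]
  ring

theorem exists_oscillating_topTrace_bound (hω : IsOpen ω) (L : ℝ) (hκ : IsTest2 ω κ)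
    (hα : IsTest01 α) (hβ : IsTest01 β) (M : ℝ) : ∃ C : ℝ, ∀ ε, 0 < ε → ε < L →
      ∀ (u : H1 (OmB ω L)) (g : R2 → ℝ), ‖u‖ ^ 2 ≤ M → IsTopTrace ω (-L) 0 u g →
      |∫ z in ω, g z * (κ z * (per α (ε⁻¹ * z.1) * per β (ε⁻¹ * z.2) - mean α * mean β))| ≤
        C * √ε := by
  obtain ⟨C, hC⟩ := exists_oscillating_trace_bound hω L hκ hα hβ M
  refine ⟨C, fun ε hε hεL u g hu hg => hC ε hε hεL (fn u) (grad u) g (hasWeakPd u)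
    ((integral_sq_le_norm_sq u).1.trans hu) (fun i => ((integral_sq_le_norm_sq u).2 i).trans hu)
    fun ψ hψ => ?_⟩
  rw [hg.2 ψ hψ, one_mul]

theorem exists_oscillating_bottomTrace_bound (hω : IsOpen ω) (L : ℝ) (hκ : IsTest2 ω κ)
    (hα : IsTest01 α) (hβ : IsTest01 β) (M : ℝ) : ∃ C : ℝ, ∀ ε, 0 < ε → ε < L →
      ∀ (v : H1 (OmA ω L)) (g : R2 → ℝ), ‖v‖ ^ 2 ≤ M → IsBottomTrace ω 0 L v g →
      |∫ z in ω, g z * (κ z * (per α (ε⁻¹ * z.1) * per β (ε⁻¹ * z.2) - mean α * mean β))| ≤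
        C * √ε := by
  obtain ⟨C, hC⟩ := exists_oscillating_trace_bound hω L hκ hα hβ M
  refine ⟨C, fun ε hε hεL v g hv hg => ?_⟩
  have hpre : mirror 0 ⁻¹' OmA ω L = OmB ω L := by rw [preimage_mirror, sub_zero, zero_sub]
  have hsq : ∀ (s : ℝ) (f : R3 → ℝ), s * s = 1 →
      ∫ x in OmB ω L, (s * f (mirror 0 x)) ^ 2 = ∫ x in OmA ω L, f x ^ 2 := by
    intro s f hs
    have hc := setIntegral_comp_homeomorph (U := OmA ω L) (map_mirror 0) one_pos (fun x => f x ^ 2)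
    rw [one_mul, hpre] at hc
    rw [← hc]
    refine integral_congr_ae (Eventually.of_forall fun x => ?_)
    simp only [mul_pow, sq s, hs, one_mul]
  refine hC ε hε hεL (fun x => fn v (mirror 0 x))
    (fun i x => mirrorSign i * grad v i (mirror 0 x)) g
    (fun i => (hasWeakPd v i).comp_aff _ _ _ hpre.ge) ?_ (fun i => ?_)
    hg.hasUpperTrace_mirror
  · have := hsq 1 (fn v) (one_mul 1)
    simp only [one_mul] at this
    rw [this]
    exact (integral_sq_le_norm_sq v).1.trans hv
  · rw [hsq _ (grad v i) (mirrorSign_sq i)]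
    exact ((integral_sq_le_norm_sq v).2 i).trans hv

/-- The bulk side of Green's formula is a continuous functional of `u`, so weak convergence in `H1`
passes to the tested traces without any bound on the traces themselves. -/
theorem IsFaceTrace.tendsto {U W : Set R3} {i : Fin 3} {σ : ℝ} {S : Set R2} {p : R2 → R3}
    (hσ : σ ≠ 0) {u : ℕ → H1 U} {u₀ : H1 U} {g : ℕ → R2 → ℝ} {g₀ : R2 → ℝ}
    (h : ∀ n, IsFaceTrace W i σ S p (u n) (g n)) (h₀ : IsFaceTrace W i σ S p u₀ g₀)
    (hu : WeakTendsto u u₀) {ψ : R3 → ℝ} (hψ : IsTest W ψ) :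
    Tendsto (fun n => ∫ z in S, g n z * ψ (p z)) atTop (𝓝 (∫ z in S, g₀ z * ψ (p z))) := by
  have := weakTendsto_iff.1 hu (greenL i (hψ.memLp_pd i U) (hψ.memLp U))
  simp only [greenL_apply, (h _).2 ψ hψ, h₀.2 ψ hψ] at this
  simpa [← mul_assoc, hσ] using this.const_mul σ⁻¹

end Oscillating

/-! ### Identification of weak limits -/

theorem IsTest2.memLp {ω : Set R2} {κ : R2 → ℝ} (h : IsTest2 ω κ) (S : Set R2) :
    MemLp κ 2 (volume.restrict S) := h.1.continuous.memLp_of_hasCompactSupport h.2.1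

/-- Applying `ℓ` pointwise is a bounded operator into `L²(ω)`, hence testing with `κ` is a
continuous functional of `w`. Its limit is computed in two ways, and the test functions `κ` separate
`L²(ω)`. -/
theorem ae_eq_of_weakTendsto {ω : Set R2} (hω : IsOpen ω) (ℓ : H1 Y →L[ℝ] ℝ) {w : ℕ → L2H1 ω}
    {W : L2H1 ω} (hw : WeakTendsto w W) {g : R2 → ℝ} (hg : MemLp g 2 (volume.restrict ω))
    (h : ∀ κ, IsTest2 ω κ → Tendsto (fun n => ∫ x in ω, κ x * ℓ (w n x)) atTop
      (𝓝 (∫ x in ω, g x * κ x))) : ∀ᵐ x ∂(volume.restrict ω), ℓ (W x) = g x := by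
  set T : L2H1 ω →L[ℝ] Lp ℝ 2 (volume.restrict ω) := ℓ.compLpL 2 (volume.restrict ω) with hT
  have hTa : ∀ v : L2H1 ω, T v =ᵐ[volume.restrict ω] fun x => ℓ (v x) :=
    fun v => ℓ.coeFn_compLpL v
  have hpair : ∀ κ (hκ : IsTest2 ω κ) (v : L2H1 ω),
      pairing (hκ.memLp ω) (T v) = ∫ x in ω, κ x * ℓ (v x) := by
    intro κ hκ v
    rw [pairing_apply]
    exact integral_congr_ae ((hTa v).mono fun x hx => by simp only [hx, mul_comm])
  have hf : MemLp (fun x => T W x - g x) 2 (volume.restrict ω) := (Lp.memLp (T W)).sub hg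
  have key := ae_eq_zero_of_forall_test hω (μ := volume) (f := fun x => T W x - g x)
    (locallyIntegrableOn_of_locallyIntegrable_restrict (hf.locallyIntegrable (by norm_num)))
    (fun κ h1 h2 h3 => by
      have hκ : IsTest2 ω κ := ⟨h1, h2, h3⟩
      have l1 := weakTendsto_iff.1 hw ((pairing (hκ.memLp ω)).comp T)
      simp only [ContinuousLinearMap.comp_apply, hpair κ hκ] at l1
      have e := tendsto_nhds_unique l1 (h κ hκ)
      rw [← hpair κ hκ, pairing_apply] at e
      have i1 : Integrable (fun x => T W x * κ x) (volume.restrict ω) :=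
        (Lp.memLp (T W)).integrable_mul (q := 2) (hκ.memLp ω)
      have i2 : Integrable (fun x => g x * κ x) (volume.restrict ω) :=
        hg.integrable_mul (q := 2) (hκ.memLp ω)
      simp only [sub_mul]
      rw [integral_sub i1 i2, e, sub_self])
  filter_upwards [key, hTa W] with x h1 h2
  rw [← h2]
  linarith

theorem ae_forall_dual_eq_zero {X H : Type*} [MeasurableSpace X] {μ : Measure X}
    [NormedAddCommGroup H] [InnerProductSpace ℝ H] [CompleteSpace H] [SecondCountableTopology H]
    (S : Set (StrongDual ℝ H)) (Φ : X → H) (h : ∀ ℓ ∈ S, ∀ᵐ x ∂μ, ℓ (Φ x) = 0) :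
    ∀ᵐ x ∂μ, ∀ ℓ ∈ S, ℓ (Φ x) = 0 := by
  have hr : ∀ (ℓ : StrongDual ℝ H) (v : H),
      inner ℝ ((InnerProductSpace.toDual ℝ H).symm ℓ) v = ℓ v := fun ℓ v =>
    InnerProductSpace.toDual_symm_apply
  have := ae_forall_inner_eq_zero ((InnerProductSpace.toDual ℝ H).symm '' S) Φ (μ := μ) (by
    rintro _ ⟨ℓ, hℓ, rfl⟩
    simpa only [hr] using h ℓ hℓ)
  filter_upwards [this] with x hx ℓ hℓ
  rw [← hr]
  exact hx _ ⟨ℓ, hℓ, rfl⟩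

/-! ### Oscillating coefficients -/

/-- Smooth bounded functions that are invariant under integer translations. -/
structure IsOsc (a : ℝ → ℝ) : Prop where
  contDiff : ContDiff ℝ ((⊤ : ℕ∞) : WithTop ℕ∞) a
  bounded : ∃ M, ∀ t, |a t| ≤ M
  int_add : ∀ (m : ℤ) (t : ℝ), a (m + t) = a t

theorem isOsc_const (r : ℝ) : IsOsc fun _ => r :=
  ⟨contDiff_const, ⟨|r|, fun _ => le_rfl⟩, fun _ _ => rfl⟩

theorem isOsc_per {α : ℝ → ℝ} (h : IsTest01 α) : IsOsc (per α) := by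
  obtain ⟨M, -, hM⟩ := exists_bound_per h
  exact ⟨contDiff_per h, ⟨M, hM⟩, fun m t => by rw [per, per, Int.fract_intCast_add]⟩

theorem per_of_mem (α : ℝ → ℝ) {t : ℝ} (ht : t ∈ Ioo (0 : ℝ) 1) : per α t = α t := by
  rw [per, Int.fract_eq_self.2 ⟨ht.1.le, ht.2⟩]

section CellTest
variable {a b c : ℝ → ℝ}

theorem continuous_cellTest (ha : IsOsc a) (hb : IsOsc b) (hc : Continuous c) :
    Continuous (cellTest a b c) := by
  have h1 := ha.contDiff.continuous
  have h2 := hb.contDiff.continuous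
  unfold cellTest
  fun_prop

theorem exists_bound_cellTest (ha : IsOsc a) (hb : IsOsc b) (hc : Continuous c)
    (hcc : HasCompactSupport c) : ∃ B, ∀ x, |cellTest a b c x| ≤ B := by
  obtain ⟨A, hA⟩ := ha.bounded
  obtain ⟨B, hB⟩ := hb.bounded
  obtain ⟨D, hD⟩ := hcc.exists_bound_of_continuous hc
  refine ⟨A * B * D, fun x => ?_⟩
  rw [cellTest, abs_mul, abs_mul]
  have h1 := hA x.1.1
  have h2 := hB x.1.2
  have h3 : |c x.2| ≤ D := hD x.2
  have hA0 := (abs_nonneg _).trans h1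
  have hB0 := (abs_nonneg _).trans h2
  gcongr

theorem memLp_cellTest (ha : IsOsc a) (hb : IsOsc b) (hc : Continuous c)
    (hcc : HasCompactSupport c) : MemLp (cellTest a b c) 2 (volume.restrict Y) := by
  obtain ⟨B, hB⟩ := exists_bound_cellTest ha hb hc hcc
  exact MemLp.of_bound (continuous_cellTest ha hb hc).aestronglyMeasurable B
    (Eventually.of_forall hB)

theorem cellTest_int_add (ha : IsOsc a) (hb : IsOsc b) (c : ℝ → ℝ) (m : ℤ × ℤ) (y : R3) :
    cellTest a b c ((m.1 + y.1.1, m.2 + y.1.2), y.2) = cellTest a b c y := by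
  simp only [cellTest, ha.int_add, hb.int_add]

end CellTest

/-! ### Limits of unfolded functions -/

section Limit
variable {ω : Set R2} {ε : ℕ → ℝ} {U : Set R3} {φ : ℕ → H1 U} {M : ℝ} {W : L2H1 ω}

/-- The `O(ε)` error of undoing the unfolding disappears in the limit, so properties of the limit
can be read from integrals of the original functions over the layer. -/
theorem ae_greenL_eq (hω : IsOpen ω) (hε : ∀ n, 0 < ε n) (hε0 : Tendsto ε atTop (𝓝 0))
    (hU : ∀ n, OmM ω (ε n) ⊆ U) (hM : ∀ n, (ε n)⁻¹ * ∫ x in OmM ω (ε n), energy (φ n) (ε n) x ≤ M)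
    (hw : WeakTendsto (fun n => unfoldH1 (hε n) (φ n) (hU n)) W) (i : Fin 3) {h k : R3 → ℝ} {B : ℝ}
    (hh : Continuous h) (hk : Continuous k) (hhB : ∀ x, |h x| ≤ B) (hkB : ∀ x, |k x| ≤ B)
    (hper : ∀ (m : ℤ × ℤ), ∀ y ∈ Y, h ((m.1 + y.1.1, m.2 + y.1.2), y.2) = h y)
    (kper : ∀ (m : ℤ × ℤ), ∀ y ∈ Y, k ((m.1 + y.1.1, m.2 + y.1.2), y.2) = k y)
    (hhL : MemLp h 2 (volume.restrict Y)) (hkL : MemLp k 2 (volume.restrict Y)) {g : R2 → ℝ}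
    (hg : MemLp g 2 (volume.restrict ω))
    (hlim : ∀ κ, IsTest2 ω κ → Tendsto (fun n => (ε n)⁻¹ * ∫ x in OmM ω (ε n),
      κ x.1 * oscPair (φ n) i h k (ε n) x) atTop (𝓝 (∫ x in ω, g x * κ x))) :
    ∀ᵐ x ∂(volume.restrict ω), greenL i hhL hkL (W x) = g x := by
  refine ae_eq_of_weakTendsto hω _ hw hg fun κ hκ => ?_
  obtain ⟨C, ε₀, hε₀, hC⟩ :=
    exists_unfold_pairing_error hω hκ i hh hk hhB hkB hper kper hhL hkL M
  have hd : Tendsto (fun n => (∫ x in ω, κ x * greenL i hhL hkL (unfoldH1 (hε n) (φ n) (hU n) x)) -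
      (ε n)⁻¹ * ∫ x in OmM ω (ε n), κ x.1 * oscPair (φ n) i h k (ε n) x) atTop (𝓝 0) := by
    refine squeeze_zero_norm' ?_ (by simpa using hε0.const_mul C)
    filter_upwards [hε0.eventually_lt_const hε₀] with n hn
    exact hC (ε n) (hε n) hn U (φ n) (hU n) (hM n)
  simpa using hd.add (hlim κ hκ)

theorem ae_greenL_lateral (hω : IsOpen ω) (hε : ∀ n, 0 < ε n) (hε0 : Tendsto ε atTop (𝓝 0))
    (hU : ∀ n, OmM ω (ε n) ⊆ U) (hM : ∀ n, (ε n)⁻¹ * ∫ x in OmM ω (ε n), energy (φ n) (ε n) x ≤ M)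
    (hw : WeakTendsto (fun n => unfoldH1 (hε n) (φ n) (hU n)) W) {i : Fin 3} (hi : i ≠ 2)
    {a b c : ℝ → ℝ} (ha : IsOsc a) (hb : IsOsc b) (hc : IsTest01 c)
    (hab : ∀ s t, (dir i).1.1 * deriv a s * b t + (dir i).1.2 * a s * deriv b t = 0) :
    ∀ᵐ x ∂(volume.restrict ω),
      greenL i MemLp.zero (memLp_cellTest ha hb hc.1.continuous hc.2.1) (W x) = 0 := by
  obtain ⟨B, hB⟩ := exists_bound_cellTest ha hb hc.1.continuous hc.2.1
  refine ae_greenL_eq hω hε hε0 hU hM hw i (g := fun _ => 0) continuous_const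
    (continuous_cellTest ha hb hc.1.continuous) (fun x => ?_) hB (fun _ _ _ => rfl)
    (fun m y _ => cellTest_int_add ha hb c m y) _ _ MemLp.zero fun κ hκ => ?_
  · change |(0 : ℝ)| ≤ B
    rw [abs_zero]
    exact (abs_nonneg _).trans (hB 0)
  · obtain ⟨A, hA⟩ := ha.bounded
    obtain ⟨D, hD⟩ := hb.bounded
    obtain ⟨C, hC⟩ := exists_lateral_bound hω.measurableSet hκ ha.contDiff hb.contDiff hc hA hD hi
      hab M
    simp only [zero_mul, integral_zero]
    refine squeeze_zero_norm (fun n => hC (ε n) (hε n) U (φ n) (hU n) ?_)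
      (by simpa using hε0.const_mul C)
    refine le_trans ?_ ((inv_mul_le_iff₀ (hε n)).1 (hM n))
    rw [integral_energy_eq (hU n)]
    exact le_add_of_nonneg_right (mul_nonneg (sq_nonneg _)
      (integral_nonneg fun x => Finset.sum_nonneg fun i _ => sq_nonneg _))

/-- The constant factor 1 stands in the variable `yᵢ` whose two faces are compared. All pairs `α, β`
are gathered into one set of functionals so that a single null set serves them all. -/
theorem ae_isPer (hω : IsOpen ω) (hε : ∀ n, 0 < ε n) (hε0 : Tendsto ε atTop (𝓝 0))
    (hU : ∀ n, OmM ω (ε n) ⊆ U) (hM : ∀ n, (ε n)⁻¹ * ∫ x in OmM ω (ε n), energy (φ n) (ε n) x ≤ M)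
    (hw : WeakTendsto (fun n => unfoldH1 (hε n) (φ n) (hU n)) W) :
    ∀ᵐ x ∂(volume.restrict ω), IsPer (W x) := by
  have s0 := ae_forall_dual_eq_zero (μ := volume.restrict ω) {ℓ : StrongDual ℝ (H1 Y) |
    ∃ (α β : ℝ → ℝ) (hα : IsTest01 α) (hβ : IsTest01 β), ℓ = greenL 0 MemLp.zero
      (memLp_cellTest (isOsc_const 1) (isOsc_per hα) hβ.1.continuous hβ.2.1)} W (by
    rintro _ ⟨α, β, hα, hβ, rfl⟩
    exact ae_greenL_lateral hω hε hε0 hU hM hw (by decide) (isOsc_const 1) (isOsc_per hα) hβ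
      fun s t => by simp [dir])
  have s1 := ae_forall_dual_eq_zero (μ := volume.restrict ω) {ℓ : StrongDual ℝ (H1 Y) |
    ∃ (α β : ℝ → ℝ) (hα : IsTest01 α) (hβ : IsTest01 β), ℓ = greenL 1 MemLp.zero
      (memLp_cellTest (isOsc_per hα) (isOsc_const 1) hβ.1.continuous hβ.2.1)} W (by
    rintro _ ⟨α, β, hα, hβ, rfl⟩
    exact ae_greenL_lateral hω hε hε0 hU hM hw (by decide) (isOsc_per hα) (isOsc_const 1) hβ
      fun s t => by simp [dir])
  filter_upwards [s0, s1] with x h0 h1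
  refine isPer_of_forall_test (fun α β hα hβ => ?_) fun α β hα hβ => ?_
  · have := h0 _ ⟨α, β, hα, hβ, rfl⟩
    rw [greenL_apply] at this
    rw [← this]
    refine setIntegral_congr_fun measurableSet_Y fun y hy => ?_
    simp only [cellTest, per_of_mem α hy.1.2, Pi.zero_apply]
    ring
  · have := h1 _ ⟨α, β, hα, hβ, rfl⟩
    rw [greenL_apply] at this
    rw [← this]
    refine setIntegral_congr_fun measurableSet_Y fun y hy => ?_
    simp only [cellTest, per_of_mem α hy.1.1, Pi.zero_apply]
    ring

theorem memLp_deriv_bumpAt_cellTest {α β : ℝ → ℝ} (hα : IsTest01 α) (hβ : IsTest01 β) (r : ℝ) :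
    MemLp (cellTest (per α) (per β) (deriv (bumpAt r 1))) 2 (volume.restrict Y) :=
  memLp_cellTest (isOsc_per hα) (isOsc_per hβ) ((contDiff_bumpAt r 1).continuous_deriv (by simp))
    (hasCompactSupport_bumpAt r one_pos).deriv

theorem memLp_bumpAt_cellTest {α β : ℝ → ℝ} (hα : IsTest01 α) (hβ : IsTest01 β) (r : ℝ) :
    MemLp (cellTest (per α) (per β) (bumpAt r 1)) 2 (volume.restrict Y) :=
  memLp_cellTest (isOsc_per hα) (isOsc_per hβ) (contDiff_bumpAt r 1).continuous
    (hasCompactSupport_bumpAt r one_pos)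

/-- The functional `v ↦ ∫_Y (v ∂₃χ + ∂₃v χ)` for a product test function `χ` near the face
`y₃ = r`. -/
def faceL {α β : ℝ → ℝ} (hα : IsTest01 α) (hβ : IsTest01 β) (r : ℝ) : H1 Y →L[ℝ] ℝ :=
  greenL 2 (memLp_deriv_bumpAt_cellTest hα hβ r) (memLp_bumpAt_cellTest hα hβ r)

theorem faceL_apply {α β : ℝ → ℝ} (hα : IsTest01 α) (hβ : IsTest01 β) (r : ℝ) (v : H1 Y) :
    faceL hα hβ r v =
      ∫ x in Y, (fn v x * pd 2 (faceTest α β r) x + grad v 2 x * faceTest α β r x) := by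
  rw [faceL, greenL_apply]
  refine setIntegral_congr_fun measurableSet_Y fun y hy => ?_
  have := pd_mul_mul hα.differentiable hβ.differentiable
    ((contDiff_bumpAt r 1).differentiable (by simp)) 2 y
  simp only [dir, Matrix.cons_val, zero_mul, one_mul, zero_add] at this
  simp only [cellTest, per_of_mem α hy.1.1, per_of_mem β hy.1.2]
  rw [← this]
  rfl

/-- If the layer integrals are given by boundary values `gₙ` with the sign `s`, then so are those of
the limit. -/
theorem ae_faceL_eq (hω : IsOpen ω) (hε : ∀ n, 0 < ε n) (hε0 : Tendsto ε atTop (𝓝 0))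
    (hU : ∀ n, OmM ω (ε n) ⊆ U) (hM : ∀ n, (ε n)⁻¹ * ∫ x in OmM ω (ε n), energy (φ n) (ε n) x ≤ M)
    (hw : WeakTendsto (fun n => unfoldH1 (hε n) (φ n) (hU n)) W) (s r : ℝ) {g : ℕ → R2 → ℝ}
    {g₀ : R2 → ℝ} (hg : ∀ n, MemLp (g n) 2 (volume.restrict ω))
    (hg₀ : MemLp g₀ 2 (volume.restrict ω))
    (hlim : ∀ κ, IsTest2 ω κ →
      Tendsto (fun n => ∫ z in ω, g n z * κ z) atTop (𝓝 (∫ z in ω, g₀ z * κ z)))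
    {α β : ℝ → ℝ} (hα : IsTest01 α) (hβ : IsTest01 β)
    (hosc : ∀ κ, IsTest2 ω κ → ∃ C : ℝ, ∀ᶠ n in atTop, |∫ z in ω, g n z *
      (κ z * (per α ((ε n)⁻¹ * z.1) * per β ((ε n)⁻¹ * z.2) - mean α * mean β))| ≤ C * √(ε n))
    (hlayer : ∀ κ, IsTest2 ω κ → ∀ᶠ n in atTop, (ε n)⁻¹ * ∫ x in OmM ω (ε n), κ x.1 *
        oscPair (φ n) 2 (cellTest (per α) (per β) (deriv (bumpAt r 1)))
          (cellTest (per α) (per β) (bumpAt r 1)) (ε n) x =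
      s * ∫ z in ω, g n z * (κ z * (per α ((ε n)⁻¹ * z.1) * per β ((ε n)⁻¹ * z.2)))) :
    ∀ᵐ x ∂(volume.restrict ω), faceL hα hβ r (W x) = s * (mean α * mean β) * g₀ x := by
  have oα := isOsc_per hα
  have oβ := isOsc_per hβ
  have hc := (contDiff_bumpAt r 1).continuous
  have hdc : Continuous (deriv (bumpAt r 1)) := (contDiff_bumpAt r 1).continuous_deriv (by simp)
  obtain ⟨B₁, hB₁⟩ := exists_bound_cellTest oα oβ hdc (hasCompactSupport_bumpAt r one_pos).deriv
  obtain ⟨B₂, hB₂⟩ := exists_bound_cellTest oα oβ hc (hasCompactSupport_bumpAt r one_pos)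
  refine ae_greenL_eq hω hε hε0 hU hM hw 2 (B := max B₁ B₂) (continuous_cellTest oα oβ hdc)
    (continuous_cellTest oα oβ hc) (fun x => (hB₁ x).trans (le_max_left _ _))
    (fun x => (hB₂ x).trans (le_max_right _ _)) (fun m y _ => cellTest_int_add oα oβ _ m y)
    (fun m y _ => cellTest_int_add oα oβ _ m y) _ _ (hg₀.const_mul _) fun κ hκ => ?_
  obtain ⟨C, hC⟩ := hosc κ hκ
  have hz : Tendsto (fun n => ∫ z in ω, g n z *
      (κ z * (per α ((ε n)⁻¹ * z.1) * per β ((ε n)⁻¹ * z.2) - mean α * mean β))) atTop (𝓝 0) := by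
    refine squeeze_zero_norm' hC ?_
    have h0 : Tendsto (fun n => √(ε n)) atTop (𝓝 0) := by
      have := (Real.continuous_sqrt.tendsto 0).comp hε0
      rwa [Real.sqrt_zero] at this
    simpa using h0.const_mul C
  -- The oscillating factor is its mean plus a mean-zero part; the former passes to the limit by
  -- weak convergence of the traces, the latter tends to zero by `hosc`.
  have ht := (hz.add ((hlim κ hκ).const_mul (mean α * mean β))).const_mul s
  have e : ∫ z in ω, s * (mean α * mean β) * g₀ z * κ z =
      s * (0 + mean α * mean β * ∫ z in ω, g₀ z * κ z) := by
    rw [zero_add, ← integral_const_mul, ← integral_const_mul]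
    simp only [mul_assoc]
  rw [e]
  refine ht.congr' ?_
  filter_upwards [hlayer κ hκ] with n hn
  rw [hn]
  congr 1
  have i1 : Integrable (fun z => g n z * (κ z *
      (per α ((ε n)⁻¹ * z.1) * per β ((ε n)⁻¹ * z.2) - mean α * mean β))) (volume.restrict ω) :=
    (hg n).integrable_mul (q := 2) ((hκ.mul_smooth ((contDiff_mul_fst_snd
      (contDiff_rescale oα.contDiff (ε n)⁻¹) (contDiff_rescale oβ.contDiff (ε n)⁻¹)).sub
        contDiff_const)).memLp ω)
  have i2 : Integrable (fun z => g n z * κ z) (volume.restrict ω) :=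
    (hg n).integrable_mul (q := 2) (hκ.memLp ω)
  rw [← integral_const_mul, ← integral_add i1 (i2.const_mul _)]
  refine integral_congr_ae (Eventually.of_forall fun z => ?_)
  simp only
  ring

instance : SecondCountableTopology (WithLp 2 (H1 Y × ℝ)) :=
  (WithLp.prodContinuousLinearEquiv 2 ℝ (H1 Y) ℝ).toHomeomorph.secondCountableTopology

/-- The right-hand side depends on `x`, so the identity is read as a homogeneous linear relation for
the vector `(W x, g x)` in the Hilbert space `H1 Y × ℝ`; separability of that space then gives a
common null set. -/
theorem ae_forall_faceL_eq {g : R2 → ℝ} (s r : ℝ) (h : ∀ α β (hα : IsTest01 α) (hβ : IsTest01 β),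
      ∀ᵐ x ∂(volume.restrict ω), faceL hα hβ r (W x) = s * (mean α * mean β) * g x) :
    ∀ᵐ x ∂(volume.restrict ω), ∀ α β (hα : IsTest01 α) (hβ : IsTest01 β),
      faceL hα hβ r (W x) = s * (mean α * mean β) * g x := by
  have key := ae_forall_dual_eq_zero (μ := volume.restrict ω)
    {ℓ : StrongDual ℝ (WithLp 2 (H1 Y × ℝ)) | ∃ (α β : ℝ → ℝ) (hα : IsTest01 α) (hβ : IsTest01 β),
      ℓ = (faceL hα hβ r).comp (WithLp.fstL 2 ℝ _ _) -
        (s * (mean α * mean β)) • WithLp.sndL 2 ℝ _ _} (fun x => WithLp.toLp 2 (W x, g x)) (by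
    rintro _ ⟨α, β, hα, hβ, rfl⟩
    filter_upwards [h α β hα hβ] with x hx
    exact sub_eq_zero.2 hx)
  filter_upwards [key] with x hx α β hα hβ
  exact sub_eq_zero.1 (hx _ ⟨α, β, hα, hβ, rfl⟩)

end Limit

end

end Layer

/-! ### Compactness and identification of the limits. -/

theorem mainTheorem11
    (ω : Set Layer.R2) (hω : IsOpen ω) (L : ℝ) (hL : 0 < L)
    (ε : ℕ → ℝ) (hε : ∀ n, 0 < ε n ∧ ε n < L) (hε0 : Tendsto ε atTop (𝓝 0))
    (φ : ℕ → Layer.H1 (Layer.Om ω L)) (C : ℝ)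
    (hC : ∀ n,
      (Layer.sqNormOn (φ n) (Layer.OmAEps ω L (ε n)) + Layer.sqNormGradOn (φ n) (Layer.OmAEps ω L (ε n)))
        + (Layer.sqNormOn (φ n) (Layer.OmB ω L) + Layer.sqNormGradOn (φ n) (Layer.OmB ω L))
        + ε n * Layer.sqNormGradOn (φ n) (Layer.OmM ω (ε n))
        + (1 / ε n) * Layer.sqNormOn (φ n) (Layer.OmM ω (ε n)) ≤ C) :
    ∃ θ : ℕ → ℕ, StrictMono θ ∧
      ∃ (φb : Layer.H1 (Layer.OmB ω L)) (φa : Layer.H1 (Layer.OmA ω L)) (φhat : Layer.L2H1 ω),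
        -- the limit in the layer takes its values in the periodic functions
        (∀ᵐ x ∂(volume.restrict ω), Layer.IsPer (φhat x)) ∧
        -- the restrictions to the lower block converge weakly
        (∃ u : ℕ → Layer.H1 (Layer.OmB ω L),
          (∀ n, Layer.fn (u n) =ᵐ[volume.restrict (Layer.OmB ω L)] Layer.fn (φ n)) ∧
          Layer.WeakTendsto (fun k => u (θ k)) φb) ∧
        -- the shifted functions converge weakly on the upper block
        (∃ v : ℕ → Layer.H1 (Layer.OmA ω L),
          (∀ n, Layer.fn (v n) =ᵐ[volume.restrict (Layer.OmA ω L)]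
            Layer.shift L (ε n) (Layer.fn (φ n))) ∧
          Layer.WeakTendsto (fun k => v (θ k)) φa) ∧
        -- the unfolded functions converge weakly
        (∃ w : ℕ → Layer.L2H1 ω,
          (∀ n, ∀ᵐ x ∂(volume.restrict ω),
            Layer.fn (w n x) =ᵐ[volume.restrict Layer.Y] Layer.unfold ω (ε n) (Layer.fn (φ n)) x) ∧
          Layer.WeakTendsto (fun k => w (θ k)) φhat) ∧
        -- the traces match; those of the layer limit do not depend on `(y₁, y₂)`
        (∃ g : Layer.R2 → ℝ, Layer.IsTopTrace ω (-L) 0 φb g ∧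
          ∀ᵐ x ∂(volume.restrict ω), Layer.IsBottomTrace Layer.YPlane 0 1 (φhat x) (fun _ => g x)) ∧
        (∃ g : Layer.R2 → ℝ, Layer.IsBottomTrace ω 0 L φa g ∧
          ∀ᵐ x ∂(volume.restrict ω), Layer.IsTopTrace Layer.YPlane 0 1 (φhat x) (fun _ => g x)) := by
  have hB : Layer.OmB ω L ⊆ Layer.Om ω L :=
    Set.prod_mono le_rfl (Ioo_subset_Ioo le_rfl hL.le)
  have hU : ∀ n, Layer.OmM ω (ε n) ⊆ Layer.Om ω L := fun n => Layer.layer_subset (hε n).2 hL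
  set u := fun n => Layer.restrictH1 hB (φ n) with hu
  set v := fun n => Layer.shiftH1 hω.measurableSet (hε n).1 (hε n).2 (φ n) with hv
  set w := fun n => Layer.unfoldH1 (hε n).1 (φ n) (hU n) with hw
  -- bounds
  have p1 : ∀ n S, 0 ≤ Layer.sqNormOn (φ n) S := fun n S => integral_nonneg fun x => sq_nonneg _
  have p2 : ∀ n S, 0 ≤ Layer.sqNormGradOn (φ n) S := fun n S =>
    integral_nonneg fun x => Finset.sum_nonneg fun i _ => sq_nonneg _
  have q1 : ∀ n, 0 ≤ ε n * Layer.sqNormGradOn (φ n) (Layer.OmM ω (ε n)) := fun n =>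
    mul_nonneg (hε n).1.le (p2 _ _)
  have q2 : ∀ n, 0 ≤ (1 / ε n) * Layer.sqNormOn (φ n) (Layer.OmM ω (ε n)) := fun n =>
    mul_nonneg (one_div_nonneg.2 (hε n).1.le) (p1 _ _)
  -- The weights match: `ε⁻¹ (‖φ‖² + ε² ‖∇φ‖²)` is the sum of the two layer terms in the hypothesis.
  have hE : ∀ n, (ε n)⁻¹ * ∫ x in Layer.OmM ω (ε n), Layer.energy (φ n) (ε n) x ≤ C := by
    intro n
    have h0 := (hε n).1.ne'
    rw [Layer.integral_energy_eq (hU n), mul_add,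
      show (ε n)⁻¹ * (ε n ^ 2 * Layer.sqNormGradOn (φ n) (Layer.OmM ω (ε n))) =
        ε n * Layer.sqNormGradOn (φ n) (Layer.OmM ω (ε n)) by field_simp, ← one_div]
    linarith [hC n, p1 n (Layer.OmAEps ω L (ε n)), p2 n (Layer.OmAEps ω L (ε n)),
      p1 n (Layer.OmB ω L), p2 n (Layer.OmB ω L)]
  have hun : ∀ n, ‖u n‖ ^ 2 ≤ C := by
    intro n
    rw [Layer.norm_sq_restrictH1]
    linarith [hC n, p1 n (Layer.OmAEps ω L (ε n)), p2 n (Layer.OmAEps ω L (ε n)), q1 n, q2 n]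
  have hL2 : ∀ᶠ n in atTop, ε n < L / 2 := hε0.eventually_lt_const (by linarith)
  have hvn : ∀ᶠ n in atTop, ‖v n‖ ^ 2 ≤ 2 * C := by
    filter_upwards [hL2] with n hn
    refine (Layer.norm_sq_shiftH1_le hω.measurableSet (hε n).1 (hε n).2 hn (φ n)).trans ?_
    linarith [hC n, p1 n (Layer.OmB ω L), p2 n (Layer.OmB ω L), q1 n, q2 n]
  have hwn : ∀ n, ‖w n‖ ^ 2 ≤ C := fun n => (Layer.norm_sq_unfoldH1_le _ _ _).trans (hE n)
  -- subsequences
  obtain ⟨θ₁, hθ₁, φb, hφb⟩ := Layer.exists_weakTendsto_of_norm_le u (√C) fun n =>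
    Real.le_sqrt_of_sq_le (hun n)
  obtain ⟨θ₂, hθ₂, φa, hφa⟩ := Layer.exists_weakTendsto_of_eventually_norm_le (fun k => v (θ₁ k))
    (√(2 * C)) ((hθ₁.tendsto_atTop.eventually hvn).mono fun n hn => Real.le_sqrt_of_sq_le hn)
  obtain ⟨θ₃, hθ₃, φhat, hφhat⟩ := Layer.exists_weakTendsto_of_norm_le (fun k => w (θ₁ (θ₂ k))) (√C)
    fun n => Real.le_sqrt_of_sq_le (hwn _)
  set θ : ℕ → ℕ := fun k => θ₁ (θ₂ (θ₃ k)) with hθ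
  have hθm : StrictMono θ := hθ₁.comp (hθ₂.comp hθ₃)
  have hub : Layer.WeakTendsto (fun k => u (θ k)) φb := hφb.comp (hθ₂.comp hθ₃)
  have hva : Layer.WeakTendsto (fun k => v (θ k)) φa := hφa.comp hθ₃
  have hεθ : Tendsto (fun k => ε (θ k)) atTop (𝓝 0) := hε0.comp hθm.tendsto_atTop
  have hεp : ∀ k, 0 < ε (θ k) := fun k => (hε _).1
  -- traces on the two blocks
  choose gu hgu using fun k => Layer.exists_isTopTrace hω.measurableSet (neg_lt_zero.2 hL) (u (θ k))
  choose gv hgv using fun k => Layer.exists_isBottomTrace hω.measurableSet hL (v (θ k))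
  obtain ⟨gb, hgb⟩ := Layer.exists_isTopTrace hω.measurableSet (neg_lt_zero.2 hL) φb
  obtain ⟨ga, hga⟩ := Layer.exists_isBottomTrace hω.measurableSet hL φa
  -- An extension of `κ` that equals `κ` on `x₃ = 0` and is supported in `|x₃| ≤ 3L/4`; it is
  -- admissible for the traces of both blocks.
  have hη : ∀ κ, Layer.IsTest2 ω κ → ∀ J : Set ℝ, Icc (-(3 / 4 * L)) (3 / 4 * L) ⊆ J →
      Layer.IsTest (ω ×ˢ J) (fun x => κ x.1 * Layer.bumpAt 0 L x.2) := fun κ hκ J hJ =>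
    hκ.mul_snd (Layer.contDiff_bumpAt 0 L) (Layer.hasCompactSupport_bumpAt 0 hL)
      ((Layer.tsupport_bumpAt 0 hL).trans (by rwa [zero_sub, zero_add]))
  have limb : ∀ κ, Layer.IsTest2 ω κ →
      Tendsto (fun k => ∫ z in ω, gu k z * κ z) atTop (𝓝 (∫ z in ω, gb z * κ z)) := by
    intro κ hκ
    have := Layer.IsFaceTrace.tendsto one_ne_zero hgu hgb hub
      (hη κ hκ (Ioi (-L)) fun t ht => by have := ht.1; simp only [mem_Ioi]; linarith)
    simpa only [Layer.bumpAt_self, mul_one] using this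
  have lima : ∀ κ, Layer.IsTest2 ω κ →
      Tendsto (fun k => ∫ z in ω, gv k z * κ z) atTop (𝓝 (∫ z in ω, ga z * κ z)) := by
    intro κ hκ
    have := Layer.IsFaceTrace.tendsto (neg_ne_zero.2 one_ne_zero) hgv hga hva
      (hη κ hκ (Iio L) fun t ht => by have := ht.2; simp only [mem_Iio]; linarith)
    simpa only [Layer.bumpAt_self, mul_one] using this
  -- The sign `-1` is that of the outward normal of `Y` at `y₃ = 0`; at `y₃ = 1` below it is `+1`.
  have faceb := Layer.ae_forall_faceL_eq (W := φhat) (g := gb) (-1) 0 fun α β hα hβ =>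
    Layer.ae_faceL_eq hω hεp hεθ (fun k => hU (θ k)) (fun k => hE (θ k)) hφhat (-1) 0
      (fun k => (hgu k).1) hgb.1 limb hα hβ (fun κ hκ => by
        obtain ⟨D, hD⟩ := Layer.exists_oscillating_topTrace_bound hω L hκ hα hβ C
        exact ⟨D, Eventually.of_forall fun k => hD _ (hεp k) (hε _).2 _ _ (hun _) (hgu k)⟩)
      fun κ hκ => Eventually.of_forall fun k => by
        rw [neg_one_mul]
        exact Layer.layer_green_bottom hω.measurableSet (φ (θ k)) hκ (Layer.contDiff_per hα)
          (Layer.contDiff_per hβ) (hεp k) (hε _).2 (Layer.fn_ofFun _) (Layer.grad_ofFun _ 2) (hgu k)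
  -- Both the norm bound on `v` and the layer identity require `ε < L / 2`, hence hold only from
  -- some index on; this is enough for the limits.
  have facea := Layer.ae_forall_faceL_eq (W := φhat) (g := ga) 1 1 fun α β hα hβ =>
    Layer.ae_faceL_eq hω hεp hεθ (fun k => hU (θ k)) (fun k => hE (θ k)) hφhat 1 1
      (fun k => (hgv k).1) hga.1 lima hα hβ (fun κ hκ => by
        obtain ⟨D, hD⟩ := Layer.exists_oscillating_bottomTrace_bound hω L hκ hα hβ (2 * C)
        exact ⟨D, (hθm.tendsto_atTop.eventually hvn).mono fun k hk =>
          hD _ (hεp k) (hε _).2 _ _ hk (hgv k)⟩)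
      fun κ hκ => (hθm.tendsto_atTop.eventually hL2).mono fun k hk => by
        rw [one_mul]
        exact Layer.layer_green_top hω.measurableSet (φ (θ k)) hκ (Layer.contDiff_per hα)
          (Layer.contDiff_per hβ) (hεp k) hk (Layer.fn_ofFun _) (Layer.grad_ofFun _ 2) (hgv k)
  refine ⟨θ, hθm, φb, φa, φhat,
    Layer.ae_isPer hω hεp hεθ (fun k => hU (θ k)) (fun k => hE (θ k)) hφhat,
    ⟨u, fun n => Layer.fn_ofFun _, hub⟩, ⟨v, fun n => Layer.fn_ofFun _, hva⟩,
    ⟨w, fun n => Layer.fn_unfoldH1 _ _ _, hφhat⟩, ⟨gb, hgb, ?_⟩, ⟨ga, hga, ?_⟩⟩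
  · filter_upwards [faceb] with x hx
    refine Layer.isBottomTrace_const_of_forall_test fun α β hα hβ => ?_
    rw [← Layer.faceL_apply hα hβ, hx]
    ring
  · filter_upwards [facea] with x hx
    refine Layer.isTopTrace_const_of_forall_test fun α β hα hβ => ?_
    rw [← Layer.faceL_apply hα hβ, hx]
    ring
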